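/- Let $a>0$ and let $q:\mathbb{R}\to\mathbb{R}$ be locally integrable and $a$-periodic. For $k\in\mathbb{Z}$ put $c_k=\frac1a\int_0^a q(t)e^{-i2k\pi t/a}\,dt$, suppose that $c_0=0$, and for $m\ge 0$ put $$\rho(m)=\sup_{0\le x\le a}\Big|\int_0^x q(t)e^{-i2(2m+2)\pi t/a}\,dt\Big|$$ (since $q$ is real, the opposite sign in the exponent gives the same number). Let $\lambda_0\le\lambda_1\le\lambda_2\le\dots$ be the eigenvalues, repeated according to multiplicity, of the periodic problem $y''+(\lambda-q(x))y=0$, $y(0)=y(a)$, $y'(0)=y'(a)$. Assume that one of the following conditions holds: (i) $c_{2m+2}\ne0$ for all large $m$, and $\displaystyle\lim_{m\to\infty}\frac{\rho(m)}{m\,c_{2m+2}}=0$; (ii) there are constants $0<C_1<C_2$ with $C_1<|c_{2m+2}/\rho(m)|<C_2$ for all large $m$; (iii) there is an $\varepsilon>0$ with $|c_{2m+2}|>\varepsilon/m$ for all large $m$. Then for all sufficiently large $m$ the eigenvalues $\lambda_{2m+1}$ and $\lambda_{2m+2}$ are simple (their eigenspaces are one-dimensional), and as $m\to\infty$ $$\lambda_{2m+1}=\frac{(2m+2)^2\pi^2}{a^2}-|c_{2m+2}|+O\!\left(\frac{\rho(m)}{m}\right),\qquad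 \lambda_{2m+2}=\frac{(2m+2)^2\pi^2}{a^2}+|c_{2m+2}|+O\!\left(\frac{\rho(m)}{m}\right).$$ -/

import Mathlib

open Filter Topology MeasureTheory Asymptotics

noncomputable section

namespace Hill

/-- The right-hand side `(q - μ) y` of Hill's equation in the form `y'' = (q - μ) y`. -/
def rhs (q : ℝ → ℝ) (μ : ℝ) (y : ℝ → ℂ) (t : ℝ) : ℂ := ((q t - μ : ℝ) : ℂ) * y t

/-- `y` is a (Carathéodory) solution on the real line of `y'' + (μ - q) y = 0`: `y` is
differentiable and `y'` is an indefinite integral of `(q - μ) y`. Equivalently, `y'` is locally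
absolutely continuous and the equation holds almost everywhere.
When `q` is locally integrable, the integrability clause follows from the first one. -/
structure IsSolution (q : ℝ → ℝ) (μ : ℝ) (y : ℝ → ℂ) : Prop where
  differentiable : Differentiable ℝ y
  intervalIntegrable : ∀ x : ℝ, IntervalIntegrable (rhs q μ y) volume 0 x
  deriv_eq : ∀ x : ℝ, deriv y x = deriv y 0 + ∫ t in (0 : ℝ)..x, rhs q μ y t

/-- The space of solutions of `y'' + (μ - q) y = 0` that satisfy the periodic boundary
conditions `y(0) = y(a)`, `y'(0) = y'(a)`. Its dimension is the multiplicity of `μ` as a periodic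
eigenvalue (zero if `μ` is not an eigenvalue). -/
def eigenspace (q : ℝ → ℝ) (a μ : ℝ) : Submodule ℂ (ℝ → ℂ) where
  carrier := {y | IsSolution q μ y ∧ y 0 = y a ∧ deriv y 0 = deriv y a}
  zero_mem' := by
    have h : rhs q μ 0 = 0 := by funext t; simp [rhs]
    refine ⟨⟨differentiable_const (0 : ℂ), fun x => ?_, fun x => ?_⟩, rfl, ?_⟩
    · rw [h]; exact intervalIntegrable_const
    · rw [h]; simp
    · simp
  add_mem' := by
    rintro y z ⟨hy, hy0, hy1⟩ ⟨hz, hz0, hz1⟩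
    have h : rhs q μ (y + z) = fun t => rhs q μ y t + rhs q μ z t := by
      funext t; simp [rhs, mul_add]
    have hd : ∀ x, deriv (y + z) x = deriv y x + deriv z x := fun x =>
      deriv_add (hy.differentiable x) (hz.differentiable x)
    refine ⟨⟨hy.differentiable.add hz.differentiable, fun x => ?_, fun x => ?_⟩, ?_, ?_⟩
    · rw [h]; exact (hy.intervalIntegrable x).add (hz.intervalIntegrable x)
    · rw [h, hd, hd, intervalIntegral.integral_add (hy.intervalIntegrable x)
        (hz.intervalIntegrable x), hy.deriv_eq x, hz.deriv_eq x]
      ring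
    · simp [hy0, hz0]
    · rw [hd, hd, hy1, hz1]
  smul_mem' := by
    rintro k y ⟨hy, hy0, hy1⟩
    have h : rhs q μ (k • y) = fun t => k * rhs q μ y t := by
      funext t; simp [rhs]; ring
    have hd : ∀ x, deriv (k • y) x = k * deriv y x := fun x => by
      simpa using deriv_const_smul k (hy.differentiable x)
    refine ⟨⟨hy.differentiable.const_smul k, fun x => ?_, fun x => ?_⟩, ?_, ?_⟩
    · rw [h]; exact (hy.intervalIntegrable x).const_mul k
    · rw [h, hd, hd, intervalIntegral.integral_const_mul, hy.deriv_eq x]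
      ring
    · simp [hy0]
    · rw [hd, hd, hy1]

/-- The periodic eigenvalues `λ₀ ≤ λ₁ ≤ λ₂ ≤ …` in increasing order and repeated according to
multiplicity: `λₙ` is the least `μ` for which there are `n + 1` linearly independent
eigenfunctions with eigenvalues at most `μ`. -/
def eigenvalue (q : ℝ → ℝ) (a : ℝ) (n : ℕ) : ℝ :=
  sInf {μ : ℝ | ∃ f : Fin (n + 1) → (ℝ → ℂ), LinearIndependent ℂ f ∧
    ∀ i, ∃ ν ≤ μ, f i ∈ eigenspace q a ν}

/-- The Fourier coefficient `c_k = (1/a) ∫₀ᵃ q(t) e^{-i 2 k π t / a} dt`. -/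
def coeff (q : ℝ → ℝ) (a : ℝ) (k : ℤ) : ℂ :=
  (1 / (a : ℂ)) * ∫ t in (0 : ℝ)..a,
    (q t : ℂ) * Complex.exp (-(Complex.I * 2 * (k : ℂ) * (Real.pi : ℂ) * (t : ℂ) / (a : ℂ)))

/-- `ρ(m) = sup_{0 ≤ x ≤ a} |∫₀ˣ q(t) e^{-i 2 (2m+2) π t / a} dt|`. As `q` is real, the opposite
sign in the exponent gives the same number. -/
def rho (q : ℝ → ℝ) (a : ℝ) (m : ℕ) : ℝ :=
  ⨆ x : Set.Icc (0 : ℝ) a, ‖∫ t in (0 : ℝ)..(x : ℝ),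
    (q t : ℂ) * Complex.exp
      (-(Complex.I * 2 * (2 * (m : ℂ) + 2) * (Real.pi : ℂ) * (t : ℂ) / (a : ℂ)))‖

end Hill

end

/-!
Put `w = 2π/a` and `p = m + 1`, so that `(2m + 2)² π² / a² = (w p)²`.

**Fourier side.** A periodic eigenfunction has an absolutely convergent Fourier series, and its
coefficients solve `(ν - (w k)²) y_k = ∑ⱼ c_{k-j} y_j`. Conversely each summable solution of this
system (`IsEigSeq`) is the coefficient sequence of an eigenfunction. The two directions are
`isEigSeq_of_mem_eigenspace` and `trig_mem_eigenspace`; they allow `q` to be merely integrable.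

**Counting.** After conjugation with the square root of `w² (k² + P²)`, `P = m + 1`, the system becomes
`(1 + M) g = (ν + (w P)²) D g` on `ℓ²(ℤ)` with `P ‖M‖ → 0`. Min-max then shows that for large `m` there
are exactly `2m + 1` independent eigensequences below `w² (m + 1/2)²` (`eventually_card_le`,
`eventually_exists_low`). Hence exactly two lie in the window around `(w p)²`, namely those for
`λ_{2m+1}` and `λ_{2m+2}`.

**The resonant equations.** In the window the modes `u = y_p` and `v = y_{-p}` dominate and the others
respond to them. With `D = ν - (w p)²`, eliminating the others gives
`D u = c_{2p} v + O(ρ/p)` and `D v = conj(c_{2p}) u + O(ρ/p)` (`exists_window_approx`), relative to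
`|u| + |v|`. A direct estimate of the elimination would only give `O(1/p)`. The factor `ρ` is gained
in `exists_resolvent_bounds`: the first-order response is written in closed form through primitives of
`q` and of `q e^{2iκx}`, where `κ = w p`; the term with `∫ q W`, `W` the periodic primitive of `q`,
vanishes, and the others are integrated by parts. Second-order terms are `O(1/p²)`, which is `O(ρ/p)`
because `ρ ≥ b/p` for some `b > 0` (`exists_supOsc_ge`).

**Conclusion.** So `|D| = |c_{2p}| + O(ρ/p)`. Each of the three hypotheses implies `ρ/p = o(|c_{2p}|)`
(`eventually_supOsc_le_of_cond`), so `D` has a definite sign `s` and `u` is close to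
`s c_{2p} v / |c_{2p}|`. Two eigensequences with the same sign can therefore be neither orthogonal nor
independent (`exists_splitting`). There is exactly one for each sign, which gives simplicity and the
asymptotics at once.
-/

namespace Hill

/-! ### Symmetric pencils and compact symmetric operators -/

section Abstract

variable {H : Type*} [NormedAddCommGroup H] [InnerProductSpace ℂ H]

/-- Eigenvectors of a symmetric pencil `A x = s D x` for different `s` are `D`-orthogonal. -/
lemma inner_eq_zero_of_ne {A D : H →L[ℂ] H} (hA : (A : H →ₗ[ℂ] H).IsSymmetric)
    (hD : (D : H →ₗ[ℂ] H).IsSymmetric) {x y : H} {s t : ℝ} (hst : s ≠ t)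
    (hx : A x = (s : ℂ) • D x) (hy : A y = (t : ℂ) • D y) : inner ℂ (D x) y = 0 := by
  have h1 : inner ℂ (A x) y = inner ℂ x (A y) := hA x y
  have h2 : inner ℂ (D x) y = inner ℂ x (D y) := hD x y
  rw [hx, hy, inner_smul_left, inner_smul_right, ← h2, Complex.conj_ofReal] at h1
  have h3 : ((s : ℂ) - t) * inner ℂ (D x) y = 0 := by linear_combination h1
  rcases mul_eq_zero.mp h3 with h | h
  · exact absurd (by exact_mod_cast sub_eq_zero.mp h) hst
  · exact h

/-- The form of `A` is at most `t` times the form of `D` on sums of eigenvectors of the pencil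
`A x = s D x` with `s ≤ t`. Such a sum may involve equal parameters, so no orthogonal basis is used:
the defect is the form of `D` at `∑ √(t - sᵢ) xᵢ`. -/
lemma re_inner_sum_le {A D : H →L[ℂ] H} (hA : (A : H →ₗ[ℂ] H).IsSymmetric)
    (hD : (D : H →ₗ[ℂ] H).IsSymmetric) (hpos : ∀ x, 0 ≤ (inner ℂ (D x) x).re)
    {ι : Type*} (F : Finset ι) (x : ι → H) (s : ι → ℝ) (t : ℝ) (hs : ∀ i ∈ F, s i ≤ t)
    (hx : ∀ i ∈ F, A (x i) = (s i : ℂ) • D (x i)) :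
    (inner ℂ (A (∑ i ∈ F, x i)) (∑ i ∈ F, x i)).re ≤
      t * (inner ℂ (D (∑ i ∈ F, x i)) (∑ i ∈ F, x i)).re := by
  have key := hpos (∑ i ∈ F, ((√(t - s i) : ℝ) : ℂ) • x i)
  have e : inner ℂ (D (∑ i ∈ F, ((√(t - s i) : ℝ) : ℂ) • x i))
        (∑ i ∈ F, ((√(t - s i) : ℝ) : ℂ) • x i) =
      (t : ℂ) * inner ℂ (D (∑ i ∈ F, x i)) (∑ i ∈ F, x i)
        - inner ℂ (A (∑ i ∈ F, x i)) (∑ i ∈ F, x i) := by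
    simp only [map_sum, sum_inner, inner_sum, map_smul, inner_smul_left, inner_smul_right,
      Complex.conj_ofReal]
    rw [Finset.mul_sum, ← Finset.sum_sub_distrib]
    refine Finset.sum_congr rfl fun i hi => ?_
    rw [Finset.mul_sum F _ (t : ℂ), ← Finset.sum_sub_distrib, Finset.mul_sum]
    refine Finset.sum_congr rfl fun j hj => ?_
    rw [hx j hj, inner_smul_left, Complex.conj_ofReal]
    by_cases hij : s j = s i
    · rw [hij]
      have h : ((√(t - s i) : ℝ) : ℂ) * ((√(t - s i) : ℝ) : ℂ) = (t : ℂ) - s i := by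
        rw [← Complex.ofReal_mul, Real.mul_self_sqrt (sub_nonneg.mpr (hs i hi))]; simp
      linear_combination inner ℂ (D (x j)) (x i) * h
    · rw [inner_eq_zero_of_ne hA hD hij (hx j hj) (hx i hi)]; ring
  rw [e, Complex.sub_re, Complex.re_ofReal_mul] at key
  linarith

/-- A compact symmetric operator is at most `t` on the orthogonal complement of its eigenvectors
with eigenvalue at least `t`; by the spectral theorem that complement is the closed span of the
eigenvectors with eigenvalue less than `t`. -/
lemma re_inner_le_of_mem_orthogonal [CompleteSpace H] {K : H →L[ℂ] H} (hK : IsCompactOperator K)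
    (hK' : (K : H →ₗ[ℂ] H).IsSymmetric) {t : ℝ} {f : H}
    (hf : f ∈ (Submodule.span ℂ {x : H | ∃ s : ℝ, t ≤ s ∧ K x = (s : ℂ) • x})ᗮ) :
    (inner ℂ (K f) f).re ≤ t * ‖f‖ ^ 2 := by
  set E := Submodule.span ℂ {x : H | ∃ s : ℝ, t ≤ s ∧ K x = (s : ℂ) • x} with hE
  set F := Submodule.span ℂ {x : H | ∃ s : ℝ, s ≤ t ∧ s ≠ t ∧ K x = (s : ℂ) • x} with hF
  have hsym1 : ((ContinuousLinearMap.id ℂ H : H →L[ℂ] H) : H →ₗ[ℂ] H).IsSymmetric := fun x y => rfl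
  -- the spans `E` and `F` together contain all eigenvectors and are orthogonal to each other
  have hall : (⨆ μ, Module.End.eigenspace (K : Module.End ℂ H) μ) ≤ E ⊔ F := by
    refine iSup_le fun μ x hx => ?_
    have hx' : K x = μ • x := Module.End.mem_eigenspace_iff.mp hx
    by_cases hx0 : x = 0
    · rw [hx0]; exact zero_mem _
    have hμ : ((μ.re : ℝ) : ℂ) = μ := by
      have : Module.End.HasEigenvalue (K : Module.End ℂ H) μ :=
        Module.End.hasEigenvalue_of_hasEigenvector ⟨hx, hx0⟩
      exact Complex.conj_eq_iff_re.mp (hK'.conj_eigenvalue_eq_self this)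
    rcases le_or_gt t μ.re with h | h
    · exact Submodule.mem_sup_left (Submodule.subset_span ⟨μ.re, h, by rw [hμ, hx']⟩)
    · exact Submodule.mem_sup_right (Submodule.subset_span ⟨μ.re, h.le, h.ne, by rw [hμ, hx']⟩)
  have hbot : (E ⊔ F)ᗮ = ⊥ := by
    rw [eq_bot_iff, ← ContinuousLinearMap.orthogonalComplement_iSup_eigenspaces_eq_bot hK hK']
    exact Submodule.orthogonal_le hall
  have hEF : F ≤ Eᗮ := by
    refine Submodule.span_le.mpr ?_
    rintro x ⟨s, hs, hst, hx⟩
    rw [SetLike.mem_coe, Submodule.mem_orthogonal]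
    intro u hu
    refine Submodule.span_induction (p := fun u _ => inner ℂ u x = 0) ?_ ?_ ?_ ?_ hu
    · rintro y ⟨r, hr, hy⟩
      exact inner_eq_zero_of_ne (D := ContinuousLinearMap.id ℂ H) hK' hsym1
        (show r ≠ s by rintro rfl; exact hst (le_antisymm hs hr)) hy hx
    · simp
    · intro y z _ _ hy hz; rw [inner_add_left, hy, hz, add_zero]
    · intro a y _ hy; rw [inner_smul_left, hy, mul_zero]
  have hFc : f ∈ closure (F : Set H) := by
    rw [← Submodule.topologicalClosure_coe, SetLike.mem_coe]
    set G := F.topologicalClosure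
    have hGE : G ≤ Eᗮ := Submodule.topologicalClosure_minimal _ hEF E.isClosed_orthogonal
    have : CompleteSpace G := F.isClosed_topologicalClosure.completeSpace_coe
    obtain ⟨g, hg, h, hh, rfl⟩ := G.exists_add_mem_mem_orthogonal f
    have h1 : h ∈ Eᗮ := by simpa using sub_mem hf (hGE hg)
    have h2 : h ∈ Fᗮ := Submodule.orthogonal_le F.le_topologicalClosure hh
    have h3 : h ∈ (E ⊔ F)ᗮ := by
      rw [← Submodule.inf_orthogonal]; exact ⟨h1, h2⟩
    rw [hbot, Submodule.mem_bot] at h3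
    rw [h3, add_zero]; exact hg
  have hclosed : IsClosed {f : H | (inner ℂ (K f) f).re ≤ t * ‖f‖ ^ 2} :=
    isClosed_le (by fun_prop) (by fun_prop)
  refine hclosed.closure_subset_iff.mpr ?_ hFc
  intro y hy
  obtain ⟨c, T, hT, -, rfl⟩ := Submodule.mem_span_iff_exists_finset_subset.mp hy
  have hT' : ∀ i ∈ T, ∃ s : ℝ, s ≤ t ∧ K i = (s : ℂ) • i := fun i hi => by
    obtain ⟨s, h1, -, h2⟩ := hT hi; exact ⟨s, h1, h2⟩
  choose! s hs hs' using hT'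
  have := re_inner_sum_le (D := ContinuousLinearMap.id ℂ H) hK' hsym1
    (fun x => by simpa using inner_self_nonneg (𝕜 := ℂ) (x := x)) T (fun i => c i • i) s t hs
    (fun i hi => by
      rw [map_smul, hs' i hi, smul_comm]; rfl)
  simpa [← Complex.ofReal_pow] using this

/-- Min-max in the form needed here: if a compact symmetric operator exceeds `t` on a
`d`-dimensional space, then it has `d` independent eigenvectors with eigenvalue at least `t`. -/
lemma exists_linearIndependent_eigenvectors [CompleteSpace H] {K : H →L[ℂ] H}
    (hK : IsCompactOperator K) (hK' : (K : H →ₗ[ℂ] H).IsSymmetric) {t : ℝ} {d : ℕ}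
    (V : (Fin d → ℂ) →ₗ[ℂ] H) (hV : ∀ v, v ≠ 0 → t * ‖V v‖ ^ 2 < (inner ℂ (K (V v)) (V v)).re) :
    ∃ f : Fin d → H, LinearIndependent ℂ f ∧ ∀ i, ∃ s : ℝ, t ≤ s ∧ K (f i) = (s : ℂ) • f i := by
  obtain ⟨b, hbX, hbspan, hb⟩ := exists_linearIndependent ℂ
    {x : H | ∃ s : ℝ, t ≤ s ∧ K x = (s : ℂ) • x}
  by_cases hcard : Nonempty (Fin d ↪ b)
  · obtain ⟨e⟩ := hcard
    exact ⟨fun i => (e i : H), hb.comp e e.injective, fun i => hbX (e i).2⟩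
  · exfalso
    have hfin : Finite b := by
      by_contra h
      have : Infinite b := not_finite_iff_infinite.mp h
      exact hcard ⟨Fin.valEmbedding.trans (Infinite.natEmbedding b)⟩
    have := Fintype.ofFinite b
    have hlt : Fintype.card b < d := by
      by_contra h
      exact hcard (Function.Embedding.nonempty_of_card_le (by simpa using h))
    -- some nonzero vector of the image of `V` is orthogonal to all of `b`
    let Φ : (Fin d → ℂ) →ₗ[ℂ] (b → ℂ) :=
      LinearMap.pi fun x => ((innerSL ℂ (x : H) : H →L[ℂ] ℂ) : H →ₗ[ℂ] ℂ) ∘ₗ V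
    have hker : Φ.ker ≠ ⊥ := LinearMap.ker_ne_bot_of_finrank_lt (by simpa using hlt)
    obtain ⟨v, hv, hv0⟩ := Submodule.exists_mem_ne_zero_of_ne_bot hker
    refine absurd (hV v hv0) (not_lt.mpr (re_inner_le_of_mem_orthogonal hK hK' ?_))
    rw [← hbspan, Submodule.mem_orthogonal]
    intro u hu
    refine Submodule.span_induction (p := fun u _ => inner ℂ u (V v) = 0) ?_ ?_ ?_ ?_ hu
    · intro y hy
      exact congrFun (LinearMap.mem_ker.mp hv) ⟨y, hy⟩
    · simp
    · intro y z _ _ hy hz; rw [inner_add_left, hy, hz, add_zero]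
    · intro a y _ hy; rw [inner_smul_left, hy, mul_zero]

end Abstract

/-! ### Hilbert–Schmidt operators on sequences -/

section HilbertSchmidt

/-- The Hilbert space `ℓ²(ℤ)` of complex sequences. -/
abbrev SeqSpace : Type := lp (fun _ : ℤ => ℂ) 2

lemma hasSum_norm_sq (f : SeqSpace) : HasSum (fun k => ‖f k‖ ^ 2) (‖f‖ ^ 2) := by
  simpa using lp.hasSum_norm (p := 2) (by simp) f

lemma memSeq_iff {f : ℤ → ℂ} : Memℓp f 2 ↔ Summable fun k => ‖f k‖ ^ 2 := by
  simpa using memℓp_gen_iff (E := fun _ : ℤ => ℂ) (f := f) (p := 2) (by simp)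

lemma summable_norm_inner_sq {r : ℤ → SeqSpace} (hr : Summable fun j => ‖r j‖ ^ 2) (f : SeqSpace) :
    Summable fun j => ‖inner ℂ (r j) f‖ ^ 2 := by
  refine Summable.of_nonneg_of_le (fun j => by positivity) (fun j => ?_) (hr.mul_right (‖f‖ ^ 2))
  rw [← mul_pow]
  exact pow_le_pow_left₀ (norm_nonneg _) (norm_inner_le_norm _ _) 2

/-- The Hilbert–Schmidt operator `f ↦ (⟨r j, f⟩)_j` on `ℓ²(ℤ)` with (conjugated) rows `r j`. -/
noncomputable def hsOp (r : ℤ → SeqSpace) (hr : Summable fun j => ‖r j‖ ^ 2) :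
    SeqSpace →L[ℂ] SeqSpace :=
  LinearMap.mkContinuous
    { toFun := fun f => ⟨fun j => inner ℂ (r j) f, memSeq_iff.mpr (summable_norm_inner_sq hr f)⟩
      map_add' := fun f g => by ext j; exact inner_add_right _ _ _
      map_smul' := fun c f => by ext j; exact inner_smul_right _ _ _ }
    √(∑' j, ‖r j‖ ^ 2) (fun f => by
      refine le_of_sq_le_sq ?_ (by positivity)
      rw [mul_pow, Real.sq_sqrt (tsum_nonneg fun j => by positivity), ← tsum_mul_right]
      refine hasSum_le (fun j => ?_) (hasSum_norm_sq _) (hr.mul_right (‖f‖ ^ 2)).hasSum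
      rw [← mul_pow]
      exact pow_le_pow_left₀ (norm_nonneg _) (norm_inner_le_norm _ _) 2)

variable {r : ℤ → SeqSpace} (hr : Summable fun j => ‖r j‖ ^ 2)

@[simp] lemma hsOp_apply (f : SeqSpace) (j : ℤ) : hsOp r hr f j = inner ℂ (r j) f := rfl

lemma hsOp_norm_le : ‖hsOp r hr‖ ≤ √(∑' j, ‖r j‖ ^ 2) :=
  LinearMap.mkContinuous_norm_le _ (Real.sqrt_nonneg _) _

lemma hsOp_isCompact : IsCompactOperator (hsOp r hr) := by
  classical
  -- the truncations to finitely many rows have finite rank and converge in norm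
  let T : Finset ℤ → SeqSpace →L[ℂ] SeqSpace := fun F =>
    ∑ j ∈ F, (innerSL ℂ (r j)).smulRight (lp.single 2 j (1 : ℂ))
  have hT : ∀ F, IsCompactOperator (T F) := by
    intro F
    have : ∀ j, IsCompactOperator
        ((innerSL ℂ (r j)).smulRight (lp.single 2 j (1 : ℂ) : SeqSpace)) := by
      intro j
      have h := isCompactOperator_of_locallyCompactSpace_dom (innerSL ℂ (r j))
      exact h.clm_comp (ContinuousLinearMap.toSpanSingleton ℂ (lp.single 2 j (1 : ℂ) : SeqSpace))
    exact sum_mem (S := compactOperator (RingHom.id ℂ) SeqSpace SeqSpace) fun j _ => this j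
  refine isCompactOperator_of_tendsto (l := atTop) (F := T) ?_ (Eventually.of_forall hT)
  rw [tendsto_iff_norm_sub_tendsto_zero]
  have hlim : Tendsto (fun F : Finset ℤ => √(∑' j, ‖r j‖ ^ 2 - ∑ j ∈ F, ‖r j‖ ^ 2)) atTop (𝓝 0) := by
    have := (tendsto_const_nhds (x := ∑' j, ‖r j‖ ^ 2)).sub hr.hasSum
    simpa using this.sqrt
  refine squeeze_zero (fun _ => norm_nonneg _) (fun F => ?_) hlim
  refine ContinuousLinearMap.opNorm_le_bound _ (Real.sqrt_nonneg _) fun f => ?_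
  refine le_of_sq_le_sq ?_ (by positivity)
  have hnn : 0 ≤ ∑' j, ‖r j‖ ^ 2 - ∑ j ∈ F, ‖r j‖ ^ 2 :=
    sub_nonneg.mpr (hr.sum_le_tsum F fun j _ => by positivity)
  rw [mul_pow, Real.sq_sqrt hnn]
  have hs : HasSum (fun j => if j ∈ F then 0 else ‖r j‖ ^ 2)
      (∑' j, ‖r j‖ ^ 2 - ∑ j ∈ F, ‖r j‖ ^ 2) := by
    have h1 := hr.hasSum.sub (hasSum_sum_of_ne_finset_zero (s := F)
      (f := fun j => if j ∈ F then ‖r j‖ ^ 2 else 0) fun j hj => by simp [hj])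
    rw [Finset.sum_congr rfl fun j (hj : j ∈ F) => if_pos hj] at h1
    convert! h1 using 2 with j
    split_ifs <;> simp
  refine hasSum_le (fun j => ?_) (hasSum_norm_sq _) (hs.mul_right (‖f‖ ^ 2))
  have e : (T F - hsOp r hr) f j = if j ∈ F then 0 else - inner ℂ (r j) f := by
    have : (T F) f j = if j ∈ F then inner ℂ (r j) f else 0 := by
      simp only [T, sum_apply, lp.coeFn_sum, Finset.sum_apply,
        ContinuousLinearMap.smulRight_apply, lp.coeFn_smul, Pi.smul_apply, lp.single_apply,
        innerSL_apply_apply, smul_eq_mul]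
      simp [Pi.single_apply]
    rw [sub_apply, lp.coeFn_sub, Pi.sub_apply, this, hsOp_apply]
    split_ifs <;> simp
  rw [e]
  split_ifs
  · simp
  · rw [norm_neg, ← mul_pow]
    exact pow_le_pow_left₀ (norm_nonneg _) (norm_inner_le_norm _ _) 2

end HilbertSchmidt

/-! ### The weight of the quadratic form -/

section Weights

lemma hasSum_telescope {P : ℝ} (hP : 0 < P) :
    HasSum (fun n : ℕ => 1 / ((n + P) * (n + P + 1))) (1 / P) := by
  rw [hasSum_iff_tendsto_nat_of_nonneg (fun n => by positivity)]
  have h : ∀ N : ℕ, ∑ n ∈ Finset.range N, 1 / ((n + P) * (n + P + 1)) = 1 / P - 1 / (N + P) := by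
    intro N
    induction N with
    | zero => simp
    | succ N ih =>
      rw [Finset.sum_range_succ, ih]
      have h1 : (N : ℝ) + P ≠ 0 := by positivity
      have h2 : (N : ℝ) + P + 1 ≠ 0 := by positivity
      have h3 : (N : ℝ) + 1 + P ≠ 0 := by positivity
      push_cast
      field_simp
      ring
  simp_rw [h]
  have : Tendsto (fun N : ℕ => 1 / ((N : ℝ) + P)) atTop (𝓝 0) :=
    (tendsto_const_nhds.div_atTop (tendsto_natCast_atTop_atTop.atTop_add tendsto_const_nhds))
  simpa using tendsto_const_nhds.sub this

lemma summable_weight {P : ℝ} (hP : 1 ≤ P) :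
    Summable (fun k : ℤ => 1 / ((k : ℝ) ^ 2 + P ^ 2)) ∧
      ∑' k : ℤ, 1 / ((k : ℝ) ^ 2 + P ^ 2) ≤ 8 / P := by
  have hP0 : 0 < P := by linarith
  have h4 := (hasSum_telescope hP0).mul_left 4
  have hle : ∀ n : ℕ, 1 / ((n : ℝ) ^ 2 + P ^ 2) ≤ 4 * (1 / ((n + P) * (n + P + 1))) := by
    intro n
    rw [mul_one_div, div_le_div_iff₀ (by positivity) (by positivity)]
    nlinarith [sq_nonneg ((n : ℝ) - P), (Nat.cast_nonneg n : (0 : ℝ) ≤ n)]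
  have hle2 : ∀ n : ℕ, 1 / ((((-((n : ℤ) + 1)) : ℤ) : ℝ) ^ 2 + P ^ 2)
      ≤ 4 * (1 / ((n + P) * (n + P + 1))) := by
    intro n
    refine le_trans ?_ (hle n)
    refine one_div_le_one_div_of_le (by positivity) ?_
    push_cast
    nlinarith [(Nat.cast_nonneg n : (0 : ℝ) ≤ n)]
  have s1 : Summable fun n : ℕ => 1 / (((n : ℤ) : ℝ) ^ 2 + P ^ 2) :=
    Summable.of_nonneg_of_le (fun n => by positivity) (fun n => by simpa using hle n) h4.summable
  have s2 : Summable fun n : ℕ => 1 / ((((-((n : ℤ) + 1)) : ℤ) : ℝ) ^ 2 + P ^ 2) :=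
    Summable.of_nonneg_of_le (fun n => by positivity) hle2 h4.summable
  have hs := HasSum.of_nat_of_neg_add_one (f := fun k : ℤ => 1 / ((k : ℝ) ^ 2 + P ^ 2))
    s1.hasSum s2.hasSum
  refine ⟨hs.summable, ?_⟩
  rw [hs.tsum_eq]
  have b1 := hasSum_le (fun n => by simpa using hle n) s1.hasSum h4
  have b2 := hasSum_le hle2 s2.hasSum h4
  calc _ ≤ 4 * (1 / P) + 4 * (1 / P) := add_le_add b1 b2
    _ = 8 / P := by ring

/-- The form weight `w² (k² + P²)`: the symbol of `-d²/dx² + (w P)²` on the mode `k`. -/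
noncomputable def weight (w P : ℝ) (k : ℤ) : ℝ := w ^ 2 * ((k : ℝ) ^ 2 + P ^ 2)

variable {w P : ℝ}

lemma weight_pos (hw : 0 < w) (hP : 0 < P) (k : ℤ) : 0 < weight w P k := by
  unfold weight; positivity

lemma one_div_weight (k : ℤ) :
    1 / weight w P k = 1 / w ^ 2 * (1 / ((k : ℝ) ^ 2 + P ^ 2)) := by
  rw [weight, one_div_mul_one_div]

lemma summable_one_div_weight (hP : 1 ≤ P) : Summable fun k => 1 / weight w P k := by
  simp_rw [one_div_weight]
  exact (summable_weight hP).1.mul_left _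

lemma tsum_one_div_weight_le (hP : 1 ≤ P) :
    ∑' k, 1 / weight w P k ≤ 8 / (w ^ 2 * P) := by
  simp_rw [one_div_weight]
  rw [tsum_mul_left]
  calc _ ≤ 1 / w ^ 2 * (8 / P) := by gcongr; exact (summable_weight hP).2
    _ = _ := by rw [one_div_mul_eq_div, div_div, mul_comm]

lemma one_div_weight_le (hw : 0 < w) (hP : 0 < P) (k : ℤ) :
    1 / weight w P k ≤ 1 / (w ^ 2 * P ^ 2) := by
  unfold weight
  refine one_div_le_one_div_of_le (by positivity) ?_
  gcongr
  nlinarith [sq_nonneg (k : ℝ)]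

end Weights

/-! ### The potential as an operator -/

section Operators

variable {c : ℤ → ℂ} {w P : ℝ}

lemma exists_sqrt_weight_op (hw : 0 < w) (hP : 1 ≤ P) :
    ∃ S : SeqSpace →L[ℂ] SeqSpace, IsCompactOperator S ∧
      ∀ g k, S g k = ((1 / √(weight w P k) : ℝ) : ℂ) * g k := by
  classical
  have hP0 : 0 < P := by linarith
  let r : ℤ → SeqSpace := fun j => lp.single 2 j ((1 / √(weight w P j) : ℝ) : ℂ)
  have hr : Summable fun j => ‖r j‖ ^ 2 := by
    refine (summable_one_div_weight (w := w) hP).congr fun j => ?_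
    simp only [r]
    rw [lp.norm_single (by norm_num), Complex.norm_real, Real.norm_eq_abs, sq_abs, div_pow,
      Real.sq_sqrt (weight_pos hw hP0 j).le, one_pow]
  refine ⟨hsOp r hr, hsOp_isCompact hr, fun g k => ?_⟩
  rw [hsOp_apply, lp.inner_single_left]
  simp [mul_comm]

/-- A row of the squared, weighted convolution matrix. The coefficients are split into those of
size at most `ε` and finitely many of size at most `B`; only the latter lack the factor `ε²`, and they
gain a second power of `1 / P`. -/
lemma row_bound {B ε : ℝ} (hP : 1 ≤ P) (hw : 0 < w) (F : Finset ℤ)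
    (hc : ∀ l, ‖c l‖ ^ 2 ≤ ε ^ 2 + if l ∈ F then B ^ 2 else 0) (j : ℤ) :
    Summable (fun k => ‖c (j - k)‖ ^ 2 * (1 / weight w P k)) ∧
    ∑' k, ‖c (j - k)‖ ^ 2 * (1 / weight w P k) ≤
      ε ^ 2 * (8 / (w ^ 2 * P)) + F.card * (B ^ 2 * (1 / (w ^ 2 * P ^ 2))) := by
  have hP0 : 0 < P := by linarith
  have hs := (summable_one_div_weight (w := w) hP).hasSum.mul_left (ε ^ 2)
  have hF : HasSum (fun k => if j - k ∈ F then B ^ 2 * (1 / (w ^ 2 * P ^ 2)) else 0)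
      (∑ l ∈ F, B ^ 2 * (1 / (w ^ 2 * P ^ 2))) := by
    have h0 : HasSum (fun l => if l ∈ F then B ^ 2 * (1 / (w ^ 2 * P ^ 2)) else 0)
        (∑ l ∈ F, if l ∈ F then B ^ 2 * (1 / (w ^ 2 * P ^ 2)) else 0) :=
      hasSum_sum_of_ne_finset_zero fun l hl => by simp [hl]
    rw [Finset.sum_congr rfl fun l (hl : l ∈ F) => if_pos hl] at h0
    simpa only [Function.comp_def, Equiv.subLeft_apply] using
      (Equiv.hasSum_iff (Equiv.subLeft j)).mpr h0
  have hsum := hs.add hF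
  have hle : ∀ k, ‖c (j - k)‖ ^ 2 * (1 / weight w P k) ≤ ε ^ 2 * (1 / weight w P k) +
      if j - k ∈ F then B ^ 2 * (1 / (w ^ 2 * P ^ 2)) else 0 := by
    intro k
    have hwk : 0 < 1 / weight w P k := one_div_pos.mpr (weight_pos hw hP0 k)
    refine (mul_le_mul_of_nonneg_right (hc (j - k)) hwk.le).trans ?_
    rw [add_mul]
    gcongr
    split_ifs
    · gcongr ?_ * ?_
      exact one_div_weight_le hw hP0 k
    · simp
  have hsummable : Summable (fun k => ‖c (j - k)‖ ^ 2 * (1 / weight w P k)) :=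
    Summable.of_nonneg_of_le
      (fun k => mul_nonneg (by positivity) (one_div_pos.mpr (weight_pos hw hP0 k)).le)
      hle hsum.summable
  refine ⟨hsummable, (hasSum_le hle hsummable.hasSum hsum).trans ?_⟩
  rw [Finset.sum_const, nsmul_eq_mul]
  gcongr
  exact tsum_one_div_weight_le hP

/-- Multiplication by the potential, conjugated with the square root of the weight, is a
Hilbert–Schmidt operator on `ℓ²(ℤ)`, and its norm is bounded by the row bounds. -/
lemma exists_potential_op {B ε : ℝ} (hP : 1 ≤ P) (hw : 0 < w) (F : Finset ℤ)
    (hc : ∀ l, ‖c l‖ ^ 2 ≤ ε ^ 2 + if l ∈ F then B ^ 2 else 0) :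
    ∃ M : SeqSpace →L[ℂ] SeqSpace,
      (∀ g j, M g j = ((1 / √(weight w P j) : ℝ) : ℂ) *
        ∑' k, c (j - k) * (((1 / √(weight w P k) : ℝ) : ℂ) * g k)) ∧
      ‖M‖ ≤ √((ε ^ 2 * (8 / (w ^ 2 * P)) + F.card * (B ^ 2 * (1 / (w ^ 2 * P ^ 2))))
        * (8 / (w ^ 2 * P))) := by
  have hP0 : 0 < P := by linarith
  set C := ε ^ 2 * (8 / (w ^ 2 * P)) + F.card * (B ^ 2 * (1 / (w ^ 2 * P ^ 2))) with hC
  have hCnn : 0 ≤ C := by positivity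
  have hnorm : ∀ j k, ‖starRingEnd ℂ (((1 / √(weight w P j) : ℝ) : ℂ) *
      (c (j - k) * ((1 / √(weight w P k) : ℝ) : ℂ)))‖ ^ 2 =
      (1 / weight w P j) * (‖c (j - k)‖ ^ 2 * (1 / weight w P k)) := by
    intro j k
    rw [RCLike.norm_conj, norm_mul, norm_mul, Complex.norm_real, Complex.norm_real,
      Real.norm_eq_abs, Real.norm_eq_abs, mul_pow, mul_pow, sq_abs, sq_abs, div_pow, div_pow,
      Real.sq_sqrt (weight_pos hw hP0 j).le, Real.sq_sqrt (weight_pos hw hP0 k).le, one_pow]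
  have hmem : ∀ j, Memℓp (fun k => starRingEnd ℂ (((1 / √(weight w P j) : ℝ) : ℂ) *
      (c (j - k) * ((1 / √(weight w P k) : ℝ) : ℂ)))) 2 := by
    intro j
    rw [memSeq_iff]
    simp_rw [hnorm]
    exact (row_bound hP hw F hc j).1.mul_left _
  let r : ℤ → SeqSpace := fun j => ⟨_, hmem j⟩
  have hrn : ∀ j, ‖r j‖ ^ 2 ≤ C * (1 / weight w P j) := by
    intro j
    rw [← (hasSum_norm_sq (r j)).tsum_eq]
    simp only [r, hnorm]
    rw [tsum_mul_left, mul_comm]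
    exact mul_le_mul_of_nonneg_right (row_bound hP hw F hc j).2
      (one_div_pos.mpr (weight_pos hw hP0 j)).le
  have hr : Summable fun j => ‖r j‖ ^ 2 :=
    Summable.of_nonneg_of_le (fun j => by positivity) hrn
      ((summable_one_div_weight hP).mul_left C)
  refine ⟨hsOp r hr, fun g j => ?_, (hsOp_norm_le hr).trans (Real.sqrt_le_sqrt ?_)⟩
  · rw [hsOp_apply, lp.inner_eq_tsum, ← tsum_mul_left]
    refine tsum_congr fun k => ?_
    simp only [r, RCLike.inner_apply, RCLike.conj_conj]
    ring
  · refine (hasSum_le hrn hr.hasSum ((summable_one_div_weight hP).mul_left C).hasSum).trans ?_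
    rw [tsum_mul_left]
    gcongr
    exact tsum_one_div_weight_le hP

end Operators

/-! ### Counting eigensequences below a midpoint -/

section Counting

/-- `y` is absolutely summable and solves Hill's equation with eigenvalue `ν` on the Fourier side:
`(ν - (w k)²) y_k = ∑ⱼ c_{k-j} y_j`. With `c = coeff q a` and `w = 2π/a` these are exactly the
coefficient sequences of the periodic eigenfunctions (and `0`). -/
structure IsEigSeq (c : ℤ → ℂ) (w ν : ℝ) (y : ℤ → ℂ) : Prop where
  summable : Summable fun k => ‖y k‖
  eq : ∀ k : ℤ, ((ν - (w * k) ^ 2 : ℝ) : ℂ) * y k = ∑' j, c (k - j) * y j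

variable {c : ℤ → ℂ} {w : ℝ}

lemma exists_decomp_of_tendsto (h0 : Tendsto c cofinite (𝓝 0)) {ε : ℝ} (hε : 0 < ε) :
    ∃ (B : ℝ) (F : Finset ℤ), ∀ l, ‖c l‖ ^ 2 ≤ ε ^ 2 + if l ∈ F then B ^ 2 else 0 := by
  have hfin : {l | ¬ ‖c l‖ < ε}.Finite := by
    have := (tendsto_zero_iff_norm_tendsto_zero.mp h0).eventually (gt_mem_nhds hε)
    exact this
  refine ⟨∑ l ∈ hfin.toFinset, ‖c l‖, hfin.toFinset, fun l => ?_⟩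
  split_ifs with hl
  · have : ‖c l‖ ≤ ∑ l ∈ hfin.toFinset, ‖c l‖ :=
      Finset.single_le_sum (f := fun l => ‖c l‖) (fun _ _ => norm_nonneg _) hl
    have := pow_le_pow_left₀ (norm_nonneg _) this 2
    nlinarith [sq_nonneg ε]
  · have : ‖c l‖ < ε := by simpa using hl
    have := pow_le_pow_left₀ (norm_nonneg _) this.le 2
    linarith

/-- With `P = m + 1` the conjugated potential `M` satisfies `P ‖M‖ → 0`. This is where `c_k → 0` is
used: the perturbation is eventually small against the relative gap, of order `1 / m`, between
`m²` and `(m + 1)²`. -/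
lemma eventually_exists_potential_op (h0 : Tendsto c cofinite (𝓝 0)) (hw : 0 < w) {δ : ℝ}
    (hδ : 0 < δ) :
    ∀ᶠ m : ℕ in atTop, ∃ M : SeqSpace →L[ℂ] SeqSpace,
      (∀ g j, M g j = ((1 / √(weight w (m + 1) j) : ℝ) : ℂ) *
        ∑' k, c (j - k) * (((1 / √(weight w (m + 1) k) : ℝ) : ℂ) * g k)) ∧
      ((m : ℝ) + 1) * ‖M‖ ≤ δ := by
  obtain ⟨ε, hε, hεδ⟩ : ∃ ε : ℝ, 0 < ε ∧ 64 * ε ^ 2 / w ^ 4 < δ ^ 2 := by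
    have : Tendsto (fun ε : ℝ => 64 * ε ^ 2 / w ^ 4) (𝓝[>] 0) (𝓝 0) := by
      have h : ContinuousAt (fun ε : ℝ => 64 * ε ^ 2 / w ^ 4) 0 := by fun_prop
      have h2 := h.tendsto
      simp only [ne_eq, OfNat.ofNat_ne_zero, not_false_eq_true, zero_pow, mul_zero, zero_div] at h2
      exact h2.mono_left nhdsWithin_le_nhds
    have h3 := (this.eventually (gt_mem_nhds (by positivity : (0 : ℝ) < δ ^ 2))).and
      self_mem_nhdsWithin
    obtain ⟨ε, h1, h2⟩ := h3.exists
    exact ⟨ε, h2, h1⟩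
  obtain ⟨B, F, hF⟩ := exists_decomp_of_tendsto h0 hε
  have hlim : Tendsto (fun m : ℕ => 64 * ε ^ 2 / w ^ 4 + 8 * F.card * B ^ 2 / w ^ 4 / ((m : ℝ) + 1))
      atTop (𝓝 (64 * ε ^ 2 / w ^ 4 + 0)) :=
    tendsto_const_nhds.add (tendsto_const_nhds.div_atTop
      (tendsto_natCast_atTop_atTop.atTop_add tendsto_const_nhds))
  rw [add_zero] at hlim
  filter_upwards [hlim.eventually (gt_mem_nhds hεδ)] with m hm
  have hP : (1 : ℝ) ≤ m + 1 := by linarith [(Nat.cast_nonneg m : (0 : ℝ) ≤ m)]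
  have hP0 : (0 : ℝ) < m + 1 := by linarith
  obtain ⟨M, hM, hn⟩ := exists_potential_op hP hw F hF
  refine ⟨M, hM, ?_⟩
  refine (mul_le_mul_of_nonneg_left hn hP0.le).trans ?_
  refine le_of_sq_le_sq ?_ hδ.le
  rw [mul_pow, Real.sq_sqrt (by positivity)]
  refine le_trans (le_of_eq ?_) hm.le
  field_simp
  ring

lemma exists_norm_le_of_tendsto (h0 : Tendsto c cofinite (𝓝 0)) : ∃ B : ℝ, 0 ≤ B ∧ ∀ k, ‖c k‖ ≤ B := by
  obtain ⟨B, F, hF⟩ := exists_decomp_of_tendsto h0 one_pos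
  refine ⟨√(1 + B ^ 2), Real.sqrt_nonneg _, fun k => Real.le_sqrt_of_sq_le ((hF k).trans ?_)⟩
  split_ifs <;> nlinarith [sq_nonneg B]

lemma summable_scaled (hw : 0 < w) {P : ℝ} (hP : 1 ≤ P) (g : SeqSpace) :
    Summable fun k => ‖((1 / √(weight w P k) : ℝ) : ℂ) * g k‖ := by
  have hP0 : 0 < P := by linarith
  refine Summable.of_nonneg_of_le (fun k => norm_nonneg _) (fun k => ?_)
    ((summable_one_div_weight (w := w) hP).add (hasSum_norm_sq g).summable)
  have h1 : ‖((1 / √(weight w P k) : ℝ) : ℂ)‖ ^ 2 = 1 / weight w P k := by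
    rw [Complex.norm_real, Real.norm_eq_abs, sq_abs, div_pow,
      Real.sq_sqrt (weight_pos hw hP0 k).le, one_pow]
  rw [← h1, norm_mul]
  nlinarith [sq_nonneg (‖((1 / √(weight w P k) : ℝ) : ℂ)‖ - ‖g k‖),
    sq_nonneg (‖((1 / √(weight w P k) : ℝ) : ℂ)‖), sq_nonneg ‖g k‖]

/-- Convolution with a Hermitian sequence is symmetric. -/
lemma tsum_conv_symm (hherm : ∀ k, c (-k) = starRingEnd ℂ (c k)) {B : ℝ} (hB : ∀ k, ‖c k‖ ≤ B)
    {y z : ℤ → ℂ} (hy : Summable fun k => ‖y k‖) (hz : Summable fun k => ‖z k‖) :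
    ∑' j, z j * starRingEnd ℂ (∑' k, c (j - k) * y k) =
      ∑' k, (∑' j, c (k - j) * z j) * starRingEnd ℂ (y k) := by
  have e1 : ∀ j, z j * starRingEnd ℂ (∑' k, c (j - k) * y k) =
      ∑' k, c (k - j) * z j * starRingEnd ℂ (y k) := by
    intro j
    rw [Complex.conj_tsum, ← tsum_mul_left]
    refine tsum_congr fun k => ?_
    rw [map_mul, ← hherm, neg_sub]
    ring
  simp_rw [e1, ← tsum_mul_right]
  refine Summable.tsum_comm ?_
  refine Summable.of_norm_bounded (g := fun x : ℤ × ℤ => B * (‖y x.1‖ * ‖z x.2‖)) ?_ ?_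
  · exact (hy.mul_of_nonneg hz (fun _ => norm_nonneg _) (fun _ => norm_nonneg _)).mul_left B
  · rintro ⟨k, j⟩
    simp only [Function.uncurry]
    rw [norm_mul, norm_mul, RCLike.norm_conj]
    have := hB (k - j)
    calc ‖c (k - j)‖ * ‖z j‖ * ‖y k‖ ≤ B * ‖z j‖ * ‖y k‖ := by gcongr
      _ = _ := by ring

lemma potential_op_symm (hherm : ∀ k, c (-k) = starRingEnd ℂ (c k)) {B : ℝ}
    (hB : ∀ k, ‖c k‖ ≤ B) (hw : 0 < w) {P : ℝ} (hP : 1 ≤ P) {M : SeqSpace →L[ℂ] SeqSpace}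
    (hM : ∀ g j, M g j = ((1 / √(weight w P j) : ℝ) : ℂ) *
        ∑' k, c (j - k) * (((1 / √(weight w P k) : ℝ) : ℂ) * g k)) :
    (M : SeqSpace →ₗ[ℂ] SeqSpace).IsSymmetric := by
  intro f g
  simp only [ContinuousLinearMap.coe_coe]
  rw [lp.inner_eq_tsum, lp.inner_eq_tsum]
  have h := tsum_conv_symm hherm hB (summable_scaled hw hP f) (summable_scaled hw hP g)
  simp only [RCLike.inner_apply, hM]
  refine (tsum_congr fun k => ?_).trans (h.trans (tsum_congr fun k => ?_))
  · rw [map_mul, Complex.conj_ofReal]; ring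
  · rw [map_mul, Complex.conj_ofReal]; ring


lemma weight_mul_norm_sq_le {B : ℝ} (hB : ∀ k, ‖c k‖ ≤ B) {P ν : ℝ} {y : ℤ → ℂ}
    (hy : IsEigSeq c w ν y) (k : ℤ) :
    weight w P k * ‖y k‖ ^ 2 ≤
      ((B + |ν| + (w * P) ^ 2) * ∑' j, ‖y j‖) * ‖y k‖ := by
  have hyk : ‖y k‖ ≤ ∑' j, ‖y j‖ := hy.summable.le_tsum k fun _ _ => norm_nonneg _
  have h1 : |ν - (w * k) ^ 2| * ‖y k‖ ≤ B * ∑' j, ‖y j‖ := by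
    have := congrArg norm (hy.eq k)
    rw [norm_mul, Complex.norm_real, Real.norm_eq_abs] at this
    rw [this, ← tsum_mul_left]
    refine tsum_of_norm_bounded (hy.summable.mul_left B).hasSum fun j => ?_
    rw [norm_mul]
    exact mul_le_mul_of_nonneg_right (hB _) (norm_nonneg _)
  have h2 : weight w P k ≤ |ν - (w * k) ^ 2| + |ν| + (w * P) ^ 2 := by
    have := neg_abs_le (ν - (w * k) ^ 2)
    have := le_abs_self ν
    unfold weight
    linarith
  calc weight w P k * ‖y k‖ ^ 2 ≤ (|ν - (w * k) ^ 2| + |ν| + (w * P) ^ 2) * ‖y k‖ ^ 2 := by gcongr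
    _ = (|ν - (w * k) ^ 2| * ‖y k‖ + (|ν| + (w * P) ^ 2) * ‖y k‖) * ‖y k‖ := by ring
    _ ≤ (B * ∑' j, ‖y j‖ + (|ν| + (w * P) ^ 2) * ∑' j, ‖y j‖) * ‖y k‖ := by gcongr
    _ = _ := by ring

/-- The substitution `g = √weight · y` turns the equation for `y` into the pencil
`(1 + M) g = (ν + (w P)²) D g` on `ℓ²(ℤ)`, with `D` the multiplication by `1 / weight`. -/
lemma IsEigSeq.exists_form {B : ℝ} (hB : ∀ k, ‖c k‖ ≤ B) (hw : 0 < w) {P : ℝ} (hP : 1 ≤ P)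
    {M D : SeqSpace →L[ℂ] SeqSpace}
    (hM : ∀ g j, M g j = ((1 / √(weight w P j) : ℝ) : ℂ) *
        ∑' k, c (j - k) * (((1 / √(weight w P k) : ℝ) : ℂ) * g k))
    (hD : ∀ g k, D g k = ((1 / weight w P k : ℝ) : ℂ) * g k)
    {ν : ℝ} {y : ℤ → ℂ} (hy : IsEigSeq c w ν y) :
    ∃ g : SeqSpace, (∀ k, g k = ((√(weight w P k) : ℝ) : ℂ) * y k) ∧
      (1 + M) g = ((ν + (w * P) ^ 2 : ℝ) : ℂ) • D g := by
  have hP0 : 0 < P := by linarith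
  have hwt := weight_pos hw hP0
  have hmem : Memℓp (fun k => ((√(weight w P k) : ℝ) : ℂ) * y k) 2 := by
    rw [memSeq_iff]
    refine Summable.of_nonneg_of_le (fun k => by positivity) (fun k => ?_)
      (hy.summable.mul_left ((B + |ν| + (w * P) ^ 2) * ∑' j, ‖y j‖))
    rw [norm_mul, mul_pow, Complex.norm_real, Real.norm_eq_abs, sq_abs, Real.sq_sqrt (hwt k).le]
    exact weight_mul_norm_sq_le hB hy k
  refine ⟨⟨_, hmem⟩, fun k => rfl, ?_⟩
  ext k
  have hs : ∀ k, ((1 / √(weight w P k) : ℝ) : ℂ) * (((√(weight w P k) : ℝ) : ℂ) * y k) = y k := by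
    intro k
    rw [← mul_assoc, ← Complex.ofReal_mul, one_div_mul_cancel (Real.sqrt_pos.mpr (hwt k)).ne']
    simp
  have hsq : ((√(weight w P k) : ℝ) : ℂ) * ((√(weight w P k) : ℝ) : ℂ) = (weight w P k : ℝ) := by
    rw [← Complex.ofReal_mul, Real.mul_self_sqrt (hwt k).le]
  have hne : ((√(weight w P k) : ℝ) : ℂ) ≠ 0 := by
    exact_mod_cast (Real.sqrt_pos.mpr (hwt k)).ne'
  rw [add_apply, lp.coeFn_add, Pi.add_apply, hM, lp.coeFn_smul, Pi.smul_apply, hD]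
  simp only [one_apply_eq_self, hs, smul_eq_mul]
  rw [← hy.eq k]
  have hW : ((weight w P k : ℝ) : ℂ) = (w * k) ^ 2 + (w * P) ^ 2 := by
    unfold weight; push_cast; ring
  push_cast
  rw [← hsq] at hW ⊢
  field_simp
  linear_combination (y k) * hW

/-- The converse of `IsEigSeq.exists_form`; `g ∈ ℓ²` makes `g / √weight` absolutely summable. -/
lemma IsEigSeq.of_form (hw : 0 < w) {P : ℝ} (hP : 1 ≤ P)
    {M D : SeqSpace →L[ℂ] SeqSpace}
    (hM : ∀ g j, M g j = ((1 / √(weight w P j) : ℝ) : ℂ) *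
        ∑' k, c (j - k) * (((1 / √(weight w P k) : ℝ) : ℂ) * g k))
    (hD : ∀ g k, D g k = ((1 / weight w P k : ℝ) : ℂ) * g k)
    {ν : ℝ} {g : SeqSpace} (hg : (1 + M) g = ((ν + (w * P) ^ 2 : ℝ) : ℂ) • D g) :
    IsEigSeq c w ν fun k => ((1 / √(weight w P k) : ℝ) : ℂ) * g k := by
  have hP0 : 0 < P := by linarith
  have hwt := weight_pos hw hP0
  refine ⟨summable_scaled hw hP g, fun k => ?_⟩
  have hsq : ((√(weight w P k) : ℝ) : ℂ) * ((√(weight w P k) : ℝ) : ℂ) = (weight w P k : ℝ) := by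
    rw [← Complex.ofReal_mul, Real.mul_self_sqrt (hwt k).le]
  have hne : ((√(weight w P k) : ℝ) : ℂ) ≠ 0 := by
    exact_mod_cast (Real.sqrt_pos.mpr (hwt k)).ne'
  have h := congrArg (fun f : SeqSpace => f k) hg
  simp only [add_apply, lp.coeFn_add, Pi.add_apply, hM, lp.coeFn_smul, Pi.smul_apply, hD,
    one_apply_eq_self, smul_eq_mul] at h
  generalize ∑' j, c (k - j) * (((1 / √(weight w P j) : ℝ) : ℂ) * g j) = T at h ⊢
  have hW : ((weight w P k : ℝ) : ℂ) = (w * k) ^ 2 + (w * P) ^ 2 := by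
    unfold weight; push_cast; ring
  push_cast at h ⊢
  rw [← hsq] at hW h
  field_simp at h ⊢
  linear_combination -h + (g k) * hW

/-- Multiplication by `1 / √weight` and by `1 / weight` as operators on `ℓ²(ℤ)`. -/
lemma exists_weight_ops (hw : 0 < w) {P : ℝ} (hP : 1 ≤ P) :
    ∃ S D : SeqSpace →L[ℂ] SeqSpace, IsCompactOperator S ∧
      (∀ g k, S g k = ((1 / √(weight w P k) : ℝ) : ℂ) * g k) ∧
      (∀ g k, D g k = ((1 / weight w P k : ℝ) : ℂ) * g k) ∧
      (∀ g, S (S g) = D g) ∧ (∀ f g, inner ℂ (S f) g = inner ℂ f (S g)) := by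
  have hP0 : 0 < P := by linarith
  obtain ⟨S, hSc, hS⟩ := exists_sqrt_weight_op hw hP
  refine ⟨S, S ∘L S, hSc, hS, fun g k => ?_, fun g => rfl, fun f g => ?_⟩
  · rw [ContinuousLinearMap.comp_apply, hS, hS, ← mul_assoc, ← Complex.ofReal_mul,
      one_div_mul_one_div, Real.mul_self_sqrt (weight_pos hw hP0 k).le]
  · rw [lp.inner_eq_tsum, lp.inner_eq_tsum]
    refine tsum_congr fun k => ?_
    rw [hS, hS, RCLike.inner_apply, RCLike.inner_apply, map_mul, Complex.conj_ofReal]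
    ring

lemma re_inner_one_add_ge (M : SeqSpace →L[ℂ] SeqSpace) (g : SeqSpace) :
    (1 - ‖M‖) * ‖g‖ ^ 2 ≤ (inner ℂ ((1 + M) g) g).re := by
  have h1 : |(inner ℂ (M g) g).re| ≤ ‖M‖ * ‖g‖ ^ 2 := by
    refine (Complex.abs_re_le_norm _).trans ((norm_inner_le_norm _ _).trans ?_)
    nlinarith [M.le_opNorm g, norm_nonneg g]
  have h2 : (inner ℂ ((1 + M) g) g).re = ‖g‖ ^ 2 + (inner ℂ (M g) g).re := by
    rw [add_apply, inner_add_left, Complex.add_re, one_apply_eq_self]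
    congr 1
    exact inner_self_eq_norm_sq (𝕜 := ℂ) g
  rw [h2]
  linarith [neg_abs_le (inner ℂ (M g) g).re]

lemma re_inner_one_add_le (M : SeqSpace →L[ℂ] SeqSpace) (g : SeqSpace) :
    (inner ℂ ((1 + M) g) g).re ≤ (1 + ‖M‖) * ‖g‖ ^ 2 := by
  have h1 : |(inner ℂ (M g) g).re| ≤ ‖M‖ * ‖g‖ ^ 2 := by
    refine (Complex.abs_re_le_norm _).trans ((norm_inner_le_norm _ _).trans ?_)
    nlinarith [M.le_opNorm g, norm_nonneg g]
  have h2 : (inner ℂ ((1 + M) g) g).re = ‖g‖ ^ 2 + (inner ℂ (M g) g).re := by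
    rw [add_apply, inner_add_left, Complex.add_re, one_apply_eq_self]
    congr 1
    exact inner_self_eq_norm_sq (𝕜 := ℂ) g
  rw [h2]
  linarith [le_abs_self (inner ℂ (M g) g).re]

lemma one_add_symm {M : SeqSpace →L[ℂ] SeqSpace}
    (hM : (M : SeqSpace →ₗ[ℂ] SeqSpace).IsSymmetric) :
    ((1 + M : SeqSpace →L[ℂ] SeqSpace) : SeqSpace →ₗ[ℂ] SeqSpace).IsSymmetric := by
  intro f g
  have := hM f g
  simp only [ContinuousLinearMap.coe_coe, add_apply, one_apply_eq_self,
    inner_add_left, inner_add_right] at this ⊢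
  rw [this]

/-- At most `2m + 1` independent eigensequences lie below the midpoint `w² (m + 1/2)²`. One more
would give a combination without the modes `|k| ≤ m`; there the form of `1 + M` is too large. -/
theorem eventually_card_le (h0 : Tendsto c cofinite (𝓝 0))
    (hherm : ∀ k, c (-k) = starRingEnd ℂ (c k)) (hw : 0 < w) :
    ∀ᶠ m : ℕ in atTop, ∀ (d : ℕ) (y : Fin d → ℤ → ℂ), LinearIndependent ℂ y →
      (∀ i, ∃ ν ≤ w ^ 2 * ((m : ℝ) + 1 / 2) ^ 2, IsEigSeq c w ν (y i)) → d ≤ 2 * m + 1 := by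
  obtain ⟨B, -, hB⟩ := exists_norm_le_of_tendsto h0
  filter_upwards [eventually_exists_potential_op h0 hw (by norm_num : (0 : ℝ) < 1 / 8)] with
    m ⟨M, hM, hMn⟩ d y hy hν
  set P : ℝ := (m : ℝ) + 1 with hPdef
  have hm0 : (0 : ℝ) ≤ m := Nat.cast_nonneg m
  have hP : 1 ≤ P := by linarith
  have hP0 : 0 < P := by linarith
  by_contra! hd
  choose ν hνle hEig using hν
  obtain ⟨S, D, -, -, hD, hSD, hSs⟩ := exists_weight_ops hw hP
  choose g hgy hg using fun i => (hEig i).exists_form hB hw hP hM hD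
  -- `d > 2m + 1` sequences have a nontrivial combination that vanishes on the modes `|k| ≤ m`
  let Φ : (Fin d → ℂ) →ₗ[ℂ] (Finset.Icc (-(m : ℤ)) m → ℂ) :=
    LinearMap.pi fun k => LinearMap.proj (k : ℤ) ∘ₗ Fintype.linearCombination ℂ y
  have hker : Φ.ker ≠ ⊥ := LinearMap.ker_ne_bot_of_finrank_lt (by
    simp only [Module.finrank_fintype_fun_eq_card, Fintype.card_coe, Int.card_Icc, Fintype.card_fin]
    omega)
  obtain ⟨v, hv, hv0⟩ := Submodule.exists_mem_ne_zero_of_ne_bot hker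
  have hz : ∀ k : ℤ, -(m : ℤ) ≤ k → k ≤ m → ∑ i, v i * y i k = 0 := by
    intro k h1 h2
    have := congrFun (LinearMap.mem_ker.mp hv) ⟨k, Finset.mem_Icc.mpr ⟨h1, h2⟩⟩
    simpa [Φ, Fintype.linearCombination_apply] using this
  set G : SeqSpace := ∑ i, v i • g i with hG
  have hGk : ∀ k, G k = ((√(weight w P k) : ℝ) : ℂ) * ∑ i, v i * y i k := by
    intro k
    rw [hG, lp.coeFn_sum, Finset.sum_apply, Finset.mul_sum]
    refine Finset.sum_congr rfl fun i _ => ?_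
    rw [lp.coeFn_smul, Pi.smul_apply, hgy, smul_eq_mul]
    ring
  have hG0 : G ≠ 0 := by
    intro h
    apply hv0
    rw [Fintype.linearIndependent_iff] at hy
    refine funext (hy v ?_)
    ext k
    have h1 := hGk k
    rw [h] at h1
    have hne : ((√(weight w P k) : ℝ) : ℂ) ≠ 0 := by
      exact_mod_cast (Real.sqrt_pos.mpr (weight_pos hw hP0 k)).ne'
    have h2 := (mul_eq_zero.mp h1.symm).resolve_left hne
    simpa using h2
  have hform := re_inner_sum_le (A := 1 + M) (D := D)
    (one_add_symm (potential_op_symm hherm hB hw hP hM))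
    (fun f g => by
      simp only [ContinuousLinearMap.coe_coe]
      rw [← hSD, ← hSD, hSs, hSs])
    (fun x => by
      rw [← hSD, hSs]
      exact inner_self_nonneg (𝕜 := ℂ) (x := S x))
    Finset.univ (fun i => v i • g i) (fun i => ν i + (w * P) ^ 2)
    (w ^ 2 * ((m : ℝ) + 1 / 2) ^ 2 + (w * P) ^ 2) (fun i _ => by have := hνle i; gcongr)
    (fun i _ => by rw [map_smul, hg i, map_smul, smul_comm])
  rw [← hG] at hform
  have hDG : (inner ℂ (D G) G).re ≤ 1 / (w ^ 2 * (2 * P ^ 2)) * ‖G‖ ^ 2 := by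
    have h1 : inner ℂ (D G) G = ((∑' k, 1 / weight w P k * ‖G k‖ ^ 2 : ℝ) : ℂ) := by
      rw [lp.inner_eq_tsum, Complex.ofReal_tsum]
      refine tsum_congr fun k => ?_
      rw [hD, RCLike.inner_apply, map_mul, Complex.conj_ofReal, mul_left_comm, Complex.mul_conj,
        Complex.normSq_eq_norm_sq]
      push_cast
      ring
    have hle : ∀ k, 1 / weight w P k * ‖G k‖ ^ 2 ≤ 1 / (w ^ 2 * (2 * P ^ 2)) * ‖G k‖ ^ 2 := by
      intro k
      by_cases hk : -(m : ℤ) ≤ k ∧ k ≤ m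
      · rw [hGk, hz k hk.1 hk.2]; simp
      · have hk2 : P ^ 2 ≤ (k : ℝ) ^ 2 := by
          have : ((m : ℤ) + 1) ^ 2 ≤ k ^ 2 := by
            rw [sq_le_sq, abs_of_nonneg (by positivity)]
            rcases abs_cases k with h | h <;> omega
          rw [hPdef]; exact_mod_cast this
        gcongr
        unfold weight
        gcongr
        linarith
    rw [h1, Complex.ofReal_re]
    have hs := (hasSum_norm_sq G).mul_left (1 / (w ^ 2 * (2 * P ^ 2)))
    refine hasSum_le hle (Summable.of_nonneg_of_le (fun k => ?_) hle hs.summable).hasSum hs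
    exact mul_nonneg (one_div_pos.mpr (weight_pos hw hP0 k)).le (by positivity)
  have hlow := re_inner_one_add_ge M G
  have hGpos : 0 < ‖G‖ ^ 2 := by positivity
  have h3 : (1 - ‖M‖) * ‖G‖ ^ 2 ≤
      (w ^ 2 * ((m : ℝ) + 1 / 2) ^ 2 + (w * P) ^ 2) * (1 / (w ^ 2 * (2 * P ^ 2)) * ‖G‖ ^ 2) :=
    hlow.trans (hform.trans (by gcongr))
  have h4 : 1 - ‖M‖ ≤ (w ^ 2 * ((m : ℝ) + 1 / 2) ^ 2 + (w * P) ^ 2) / (w ^ 2 * (2 * P ^ 2)) := by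
    rw [← mul_assoc] at h3
    have := le_of_mul_le_mul_right h3 hGpos
    rwa [mul_one_div] at this
  rw [le_div_iff₀ (by positivity)] at h4
  have h5 : (1 - ‖M‖) * (2 * P ^ 2) ≤ ((m : ℝ) + 1 / 2) ^ 2 + P ^ 2 := by
    have : w ^ 2 * ((1 - ‖M‖) * (2 * P ^ 2)) ≤ w ^ 2 * (((m : ℝ) + 1 / 2) ^ 2 + P ^ 2) := by
      linarith
    exact le_of_mul_le_mul_left this (by positivity)
  -- with `m = P - 1` the inequality `h5` reads `P ≤ 1/4 + 2 P² ‖M‖`, against `P ‖M‖ ≤ 1/8`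
  have h6 : P * (P * ‖M‖) ≤ P * (1 / 8) := by gcongr
  have h7 : (m : ℝ) = P - 1 := by rw [hPdef]; ring
  rw [h7] at h5
  nlinarith

/-- At least `2m + 1` independent eigensequences lie below `w² (m + 1/2)²`. For `K = S (1 + M)⁻¹ S`
with `S = D^{1/2}`, eigenvectors of `K` with eigenvalue `r` correspond to solutions of the pencil with
parameter `1 / r`, and min-max is applied on the span of the modes `|k| ≤ m`. -/
theorem eventually_exists_low (h0 : Tendsto c cofinite (𝓝 0))
    (hherm : ∀ k, c (-k) = starRingEnd ℂ (c k)) (hw : 0 < w) :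
    ∀ᶠ m : ℕ in atTop, ∃ y : Fin (2 * m + 1) → ℤ → ℂ, LinearIndependent ℂ y ∧
      ∀ i, ∃ ν ≤ w ^ 2 * ((m : ℝ) + 1 / 2) ^ 2, IsEigSeq c w ν (y i) := by
  classical
  obtain ⟨B, -, hB⟩ := exists_norm_le_of_tendsto h0
  filter_upwards [eventually_exists_potential_op h0 hw (by norm_num : (0 : ℝ) < 1 / 16)] with
    m ⟨M, hM, hMn⟩
  set P : ℝ := (m : ℝ) + 1 with hPdef
  have hm0 : (0 : ℝ) ≤ m := Nat.cast_nonneg m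
  have hP : 1 ≤ P := by linarith
  have hP0 : 0 < P := by linarith
  have hM1 : ‖M‖ < 1 := by nlinarith [norm_nonneg M]
  have hMs := potential_op_symm hherm hB hw hP hM
  have hAs := one_add_symm hMs
  set A : SeqSpace →L[ℂ] SeqSpace := 1 + M with hA
  obtain ⟨S, D, hSc, hS, hD, hSD, hSs⟩ := exists_weight_ops hw hP
  obtain ⟨A', hAA'⟩ : ∃ A' : SeqSpace →L[ℂ] SeqSpace, ∀ x, A (A' x) = x := by
    let U := Units.oneSub (-M) (by rwa [norm_neg])
    refine ⟨(U⁻¹ : (SeqSpace →L[ℂ] SeqSpace)ˣ), fun x => ?_⟩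
    have h1 : (U : SeqSpace →L[ℂ] SeqSpace) = A := by simp [U, hA]
    have h2 := congrArg (fun T : SeqSpace →L[ℂ] SeqSpace => T x) U.mul_inv
    rw [h1] at h2
    exact h2
  have hA's : ∀ x y, inner ℂ (A' x) y = inner ℂ x (A' y) := by
    intro x y
    have := hAs (A' x) (A' y)
    simp only [ContinuousLinearMap.coe_coe, hAA'] at this
    exact this.symm
  set s : ℝ := w ^ 2 * ((m : ℝ) + 1 / 2) ^ 2 + (w * P) ^ 2 with hs
  have hs0 : 0 < s := by positivity
  let K : SeqSpace →L[ℂ] SeqSpace := S ∘L A' ∘L S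
  have hKc : IsCompactOperator K := hSc.comp_clm (A' ∘L S)
  have hKs : (K : SeqSpace →ₗ[ℂ] SeqSpace).IsSymmetric := by
    intro x y
    change inner ℂ (S (A' (S x))) y = inner ℂ x (S (A' (S y)))
    rw [hSs, hA's, hSs]
  let b : Fin (2 * m + 1) → SeqSpace := fun i => lp.single 2 ((i : ℤ) - m) (1 : ℂ)
  let V : (Fin (2 * m + 1) → ℂ) →ₗ[ℂ] SeqSpace := Fintype.linearCombination ℂ b
  have hVk : ∀ v k, V v k = ∑ i : Fin (2 * m + 1), if ((i : ℤ) - m) = k then v i else 0 := by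
    intro v k
    simp only [V, b, Fintype.linearCombination_apply, lp.coeFn_sum, Finset.sum_apply,
      lp.coeFn_smul, Pi.smul_apply, lp.single_apply, smul_eq_mul, Pi.single_apply]
    refine Finset.sum_congr rfl fun i _ => ?_
    simp [eq_comm]
  have hVsupp : ∀ v k, ¬ (-(m : ℤ) ≤ k ∧ k ≤ m) → V v k = 0 := by
    intro v k hk
    rw [hVk]
    refine Finset.sum_eq_zero fun i _ => if_neg fun h => hk ?_
    have := i.2
    omega
  have hVne : ∀ v, v ≠ 0 → V v ≠ 0 := by
    intro v hv h
    apply hv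
    ext i
    have h1 := hVk v ((i : ℤ) - m)
    rw [h, Finset.sum_eq_single i (fun j _ hj => if_neg fun h => hj (Fin.ext (by omega)))
      (fun h => absurd (Finset.mem_univ i) h), if_pos rfl] at h1
    exact h1.symm
  have hV : ∀ v, v ≠ 0 → 1 / s * ‖V v‖ ^ 2 < (inner ℂ (K (V v)) (V v)).re := by
    intro v hv
    have hf0 := hVne v hv
    have hfs := hVsupp v
    generalize V v = f at hf0 hfs
    have hmem : Memℓp (fun k => ((√(weight w P k) : ℝ) : ℂ) * f k) 2 := by
      rw [memSeq_iff]
      refine summable_of_ne_finset_zero (s := Finset.Icc (-(m : ℤ)) m) fun k hk => ?_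
      rw [hfs k (by simpa using hk)]; simp
    let z : SeqSpace := ⟨_, hmem⟩
    have hzk : ∀ k, z k = ((√(weight w P k) : ℝ) : ℂ) * f k := fun k => rfl
    have hSz : S z = f := by
      ext k
      rw [hS, hzk, ← mul_assoc, ← Complex.ofReal_mul,
        one_div_mul_cancel (Real.sqrt_pos.mpr (weight_pos hw hP0 k)).ne']
      simp
    have hzn : ‖z‖ ^ 2 ≤ w ^ 2 * ((m : ℝ) ^ 2 + P ^ 2) * ‖f‖ ^ 2 := by
      refine hasSum_le (fun k => ?_) (hasSum_norm_sq z) ((hasSum_norm_sq f).mul_left _)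
      by_cases hk : -(m : ℤ) ≤ k ∧ k ≤ m
      · rw [hzk, norm_mul, mul_pow, Complex.norm_real, Real.norm_eq_abs, sq_abs,
          Real.sq_sqrt (weight_pos hw hP0 k).le]
        have hk2 : (k : ℝ) ^ 2 ≤ (m : ℝ) ^ 2 := by
          have : k ^ 2 ≤ (m : ℤ) ^ 2 := by
            rw [sq_le_sq, abs_of_nonneg (by positivity : (0 : ℤ) ≤ m)]
            exact abs_le.mpr hk
          exact_mod_cast this
        unfold weight
        gcongr
      · rw [hzk, hfs k hk]; simp
    set x := A' (S f) with hx
    have hAx : A x = S f := hAA' _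
    have e1 : inner ℂ (K f) f = inner ℂ (A x) x := by
      change inner ℂ (S (A' (S f))) f = _
      rw [hAx, hSs, ← hx, ← hA's, hx]
    have e2 : inner ℂ (A x) z = ((‖f‖ ^ 2 : ℝ) : ℂ) := by
      rw [hAx, hSs, hSz]
      push_cast
      exact inner_self_eq_norm_sq_to_K f
    have e3 : inner ℂ (A z) x = ((‖f‖ ^ 2 : ℝ) : ℂ) := by
      have := hAs z x
      simp only [ContinuousLinearMap.coe_coe] at this
      rw [this, ← inner_conj_symm, e2, Complex.conj_ofReal]
    -- positivity of `A` at `x - z / s` gives `⟨K f, f⟩ ≥ 2 ‖f‖² / s - ⟨A z, z⟩ / s²`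
    have hpos := re_inner_one_add_ge M (x - ((1 / s : ℝ) : ℂ) • z)
    rw [← hA] at hpos
    have hnn : 0 ≤ (1 - ‖M‖) * ‖x - ((1 / s : ℝ) : ℂ) • z‖ ^ 2 :=
      mul_nonneg (by linarith) (by positivity)
    have e4 : (inner ℂ (A (x - ((1 / s : ℝ) : ℂ) • z)) (x - ((1 / s : ℝ) : ℂ) • z)).re =
        (inner ℂ (K f) f).re - 2 * (1 / s) * ‖f‖ ^ 2 + (1 / s) ^ 2 * (inner ℂ (A z) z).re := by
      simp only [map_sub, map_smul, inner_sub_left, inner_sub_right, inner_smul_left,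
        inner_smul_right, Complex.conj_ofReal, e1, e2, e3, Complex.sub_re, Complex.re_ofReal_mul,
        Complex.ofReal_re]
      ring
    rw [e4] at hpos
    have hfpos : 0 < ‖f‖ ^ 2 := by positivity
    have hAz : (inner ℂ (A z) z).re < s * ‖f‖ ^ 2 := by
      refine (re_inner_one_add_le M z).trans_lt ?_
      have h1 : (1 + ‖M‖) * (w ^ 2 * ((m : ℝ) ^ 2 + P ^ 2)) < s := by
        have h6 : P * (P * ‖M‖) ≤ P * (1 / 16) := by gcongr
        have h7 : (m : ℝ) = P - 1 := by rw [hPdef]; ring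
        have h8 : (1 + ‖M‖) * ((m : ℝ) ^ 2 + P ^ 2) < ((m : ℝ) + 1 / 2) ^ 2 + P ^ 2 := by
          have h9 : (m : ℝ) ^ 2 ≤ P ^ 2 := by gcongr; linarith
          nlinarith [norm_nonneg M]
        have := mul_lt_mul_of_pos_left h8 (by positivity : 0 < w ^ 2)
        rw [hs]
        linarith
      calc (1 + ‖M‖) * ‖z‖ ^ 2 ≤ (1 + ‖M‖) * (w ^ 2 * ((m : ℝ) ^ 2 + P ^ 2) * ‖f‖ ^ 2) := by gcongr
        _ = (1 + ‖M‖) * (w ^ 2 * ((m : ℝ) ^ 2 + P ^ 2)) * ‖f‖ ^ 2 := by ring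
        _ < s * ‖f‖ ^ 2 := by gcongr
    have h10 : (1 / s) ^ 2 * (inner ℂ (A z) z).re < (1 / s) ^ 2 * (s * ‖f‖ ^ 2) := by gcongr
    have h11 : (1 / s) ^ 2 * (s * ‖f‖ ^ 2) = 1 / s * ‖f‖ ^ 2 := by field_simp
    rw [h11] at h10
    linarith
  obtain ⟨f, hf, hfe⟩ := exists_linearIndependent_eigenvectors hKc hKs V hV
  let coe : SeqSpace →ₗ[ℂ] (ℤ → ℂ) :=
    { toFun := fun f => f, map_add' := fun _ _ => rfl, map_smul' := fun _ _ => rfl }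
  refine ⟨fun i => coe (f i), hf.map' coe ?_, fun i => ?_⟩
  · rw [LinearMap.ker_eq_bot]
    intro f g h
    exact lp.ext h
  · obtain ⟨r, hr, hKr⟩ := hfe i
    have hr0 : 0 < r := lt_of_lt_of_le (by positivity) hr
    refine ⟨1 / r - (w * P) ^ 2, ?_, ?_⟩
    · have : 1 / r ≤ s := by
        rw [div_le_iff₀ hr0]
        rw [div_le_iff₀ hs0] at hr
        linarith
      linarith
    · have hKr' : S (A' (S (f i))) = (r : ℂ) • f i := hKr
      have hrC : (r : ℂ) ≠ 0 := by exact_mod_cast hr0.ne'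
      have hSg : S ((r : ℂ)⁻¹ • A' (S (f i))) = f i := by
        rw [map_smul, hKr', smul_smul, inv_mul_cancel₀ hrC, one_smul]
      have key := IsEigSeq.of_form (ν := 1 / r - (w * P) ^ 2)
        (g := (r : ℂ)⁻¹ • A' (S (f i))) hw hP hM hD (by
          rw [← hSD, hSg, map_smul, ← hA, hAA']
          simp)
      convert! key using 1
      ext k
      rw [← hS, hSg]
      rfl

end Counting

/-! ### Integration by parts -/

section Parts

/-- Integration by parts for two integrable functions, by Fubini on the two triangles of the
square `(0, a]²`. -/
lemma integral_mul_primitive_add {f g : ℝ → ℂ} {a : ℝ} (ha : 0 ≤ a)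
    (hf : IntervalIntegrable f volume 0 a) (hg : IntervalIntegrable g volume 0 a) :
    (∫ s in (0 : ℝ)..a, f s * ∫ t in (0 : ℝ)..s, g t) +
      (∫ t in (0 : ℝ)..a, (∫ s in (0 : ℝ)..t, f s) * g t) =
      (∫ s in (0 : ℝ)..a, f s) * ∫ t in (0 : ℝ)..a, g t := by
  rw [intervalIntegrable_iff_integrableOn_Ioc_of_le ha] at hf hg
  set μ := volume.restrict (Set.Ioc 0 a) with hμ
  have hfg : Integrable (fun p : ℝ × ℝ => f p.1 * g p.2) (μ.prod μ) := hf.mul_prod hg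
  have hm1 : MeasurableSet {p : ℝ × ℝ | p.2 ≤ p.1} := measurableSet_le measurable_snd measurable_fst
  have e1 : (∫ s in (0 : ℝ)..a, f s * ∫ t in (0 : ℝ)..s, g t) =
      ∫ p, Set.indicator {p : ℝ × ℝ | p.2 ≤ p.1} (fun p => f p.1 * g p.2) p ∂(μ.prod μ) := by
    rw [integral_prod _ (hfg.indicator hm1), intervalIntegral.integral_of_le ha]
    refine setIntegral_congr_fun measurableSet_Ioc fun s hs => ?_
    have : (fun t => Set.indicator {p : ℝ × ℝ | p.2 ≤ p.1} (fun p => f p.1 * g p.2) (s, t)) =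
        fun t => f s * Set.indicator (Set.Iic s) g t := by
      ext t
      simp only [Set.indicator_apply, Set.mem_ofPred_eq, Set.mem_Iic]
      split_ifs <;> simp
    rw [this, integral_const_mul, integral_indicator measurableSet_Iic, hμ,
      Measure.restrict_restrict measurableSet_Iic, intervalIntegral.integral_of_le hs.1.le]
    congr 3
    ext t
    simp only [Set.mem_inter_iff, Set.mem_Iic, Set.mem_Ioc]
    exact ⟨fun h => ⟨h.2, h.1, h.2.trans hs.2⟩, fun h => ⟨h.2.1, h.1⟩⟩
  have e2 : (∫ t in (0 : ℝ)..a, (∫ s in (0 : ℝ)..t, f s) * g t) =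
      ∫ p, Set.indicator {p : ℝ × ℝ | p.2 ≤ p.1}ᶜ (fun p => f p.1 * g p.2) p ∂(μ.prod μ) := by
    rw [integral_prod_symm _ (hfg.indicator hm1.compl), intervalIntegral.integral_of_le ha]
    refine setIntegral_congr_fun measurableSet_Ioc fun t ht => ?_
    have : (fun s => Set.indicator {p : ℝ × ℝ | p.2 ≤ p.1}ᶜ (fun p => f p.1 * g p.2) (s, t)) =
        fun s => Set.indicator (Set.Iio t) f s * g t := by
      ext s
      simp only [Set.indicator_apply, Set.mem_ofPred_eq, Set.mem_Iio, Set.mem_compl_iff, not_le]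
      split_ifs <;> simp
    rw [this, integral_mul_const, integral_indicator measurableSet_Iio, hμ,
      Measure.restrict_restrict measurableSet_Iio, intervalIntegral.integral_of_le ht.1.le,
      integral_Ioc_eq_integral_Ioo]
    congr 3
    ext s
    simp only [Set.mem_inter_iff, Set.mem_Iio, Set.mem_Ioc, Set.mem_Ioo]
    exact ⟨fun h => ⟨h.2, h.1, h.2.le.trans ht.2⟩, fun h => ⟨h.2.1, h.1⟩⟩
  rw [e1, e2, ← integral_add (hfg.indicator hm1) (hfg.indicator hm1.compl),
    intervalIntegral.integral_of_le ha, intervalIntegral.integral_of_le ha,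
    ← integral_prod_mul (μ := μ) (ν := μ)]
  refine integral_congr_ae (Eventually.of_forall fun p => ?_)
  exact Set.indicator_self_add_compl_apply _ _ _

/-- Integration by parts for indefinite integrals of integrable functions. -/
lemma integral_primitive_mul {f g F G : ℝ → ℂ} {a : ℝ} (ha : 0 ≤ a)
    (hf : IntervalIntegrable f volume 0 a) (hg : IntervalIntegrable g volume 0 a)
    (hF : ∀ t ∈ Set.Icc 0 a, F t = F 0 + ∫ s in (0 : ℝ)..t, f s)
    (hG : ∀ t ∈ Set.Icc 0 a, G t = G 0 + ∫ s in (0 : ℝ)..t, g s) :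
    ∫ t in (0 : ℝ)..a, F t * g t = F a * G a - F 0 * G 0 - ∫ t in (0 : ℝ)..a, f t * G t := by
  have hcF : ContinuousOn (fun t => ∫ s in (0 : ℝ)..t, f s) (Set.uIcc 0 a) :=
    intervalIntegral.continuousOn_primitive_interval'  hf Set.left_mem_uIcc
  have hcG : ContinuousOn (fun t => ∫ s in (0 : ℝ)..t, g s) (Set.uIcc 0 a) :=
    intervalIntegral.continuousOn_primitive_interval'  hg Set.left_mem_uIcc
  have e1 : ∫ t in (0 : ℝ)..a, F t * g t =
      F 0 * (∫ t in (0 : ℝ)..a, g t) + ∫ t in (0 : ℝ)..a, (∫ s in (0 : ℝ)..t, f s) * g t := by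
    rw [← intervalIntegral.integral_const_mul, ← intervalIntegral.integral_add (hg.const_mul _)
      (hg.continuousOn_mul hcF)]
    refine intervalIntegral.integral_congr fun t ht => ?_
    rw [Set.uIcc_of_le ha] at ht
    rw [hF t ht]; ring
  have e2 : ∫ t in (0 : ℝ)..a, f t * G t =
      (∫ t in (0 : ℝ)..a, f t) * G 0 + ∫ t in (0 : ℝ)..a, f t * (∫ s in (0 : ℝ)..t, g s) := by
    rw [← intervalIntegral.integral_mul_const, ← intervalIntegral.integral_add (hf.mul_const _)
      (hf.mul_continuousOn hcG)]
    refine intervalIntegral.integral_congr fun t ht => ?_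
    rw [Set.uIcc_of_le ha] at ht
    rw [hG t ht]; ring
  have h := integral_mul_primitive_add ha hf hg
  rw [e1, e2, hF a ⟨ha, le_rfl⟩, hG a ⟨ha, le_rfl⟩]
  linear_combination h

end Parts

/-! ### Fourier coefficients and absolutely convergent series -/

section Harmonics

variable {a : ℝ}

/-- The harmonic `e^{2π i k t / a}`. -/
noncomputable def harm (a : ℝ) (k : ℤ) (t : ℝ) : ℂ :=
  Complex.exp (Complex.I * 2 * (k : ℂ) * (Real.pi : ℂ) * (t : ℂ) / (a : ℂ))

lemma harm_eq_fourier (k : ℤ) (t : ℝ) : harm a k t = fourier k (t : AddCircle a) := by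
  rw [fourier_coe_apply, harm]; congr 1; ring

lemma harm_neg_eq (k : ℤ) (t : ℝ) : harm a (-k) t =
    Complex.exp (-(Complex.I * 2 * (k : ℂ) * (Real.pi : ℂ) * (t : ℂ) / (a : ℂ))) := by
  rw [harm]; congr 1; push_cast; ring

@[simp] lemma harm_zero (t : ℝ) : harm a 0 t = 1 := by simp [harm]

@[simp] lemma harm_at_zero (k : ℤ) : harm a k 0 = 1 := by simp [harm]

lemma harm_add (j k : ℤ) (t : ℝ) : harm a (j + k) t = harm a j t * harm a k t := by
  rw [harm, harm, harm, ← Complex.exp_add]; congr 1; push_cast; ring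

lemma conj_harm (k : ℤ) (t : ℝ) : starRingEnd ℂ (harm a k t) = harm a (-k) t := by
  rw [harm, harm, ← Complex.exp_conj]
  congr 1
  simp only [map_div₀, map_mul, Complex.conj_I, Complex.conj_ofReal, map_ofNat, map_intCast]
  push_cast; ring

@[simp] lemma norm_harm (k : ℤ) (t : ℝ) : ‖harm a k t‖ = 1 := by
  rw [harm_eq_fourier, fourier_apply, Circle.norm_coe]

@[fun_prop] lemma continuous_harm (k : ℤ) : Continuous (harm a k) := by
  unfold harm; fun_prop

lemma harm_periodic (k : ℤ) : Function.Periodic (harm a k) a := by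
  intro t; rw [harm_eq_fourier, harm_eq_fourier, AddCircle.coe_add_period]

lemma hasDerivAt_harm (k : ℤ) (t : ℝ) :
    HasDerivAt (harm a k) (Complex.I * ((2 * Real.pi / a : ℝ) * k) * harm a k t) t := by
  have h := hasDerivAt_fourier a k t
  have e : harm a k = fun y : ℝ => (fourier k (y : AddCircle a) : ℂ) := by
    ext; rw [harm_eq_fourier]
  rw [e]
  convert! h using 1
  push_cast; ring

lemma harm_eq_integral (k : ℤ) (t : ℝ) :
    harm a k t = harm a k 0 + ∫ s in (0 : ℝ)..t,
      Complex.I * ((2 * Real.pi / a : ℝ) * k) * harm a k s := by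
  rw [intervalIntegral.integral_eq_sub_of_hasDerivAt (fun s _ => hasDerivAt_harm k s)
    (by apply Continuous.intervalIntegrable; fun_prop)]
  ring

/-- The `k`-th Fourier coefficient over the period `[0, a]`. -/
noncomputable def fc (a : ℝ) (f : ℝ → ℂ) (k : ℤ) : ℂ :=
  (1 / (a : ℂ)) * ∫ t in (0 : ℝ)..a, f t * harm a (-k) t

lemma coeff_eq_fc (q : ℝ → ℝ) (k : ℤ) : coeff q a k = fc a (fun t => (q t : ℂ)) k := by
  simp only [coeff, fc, harm_neg_eq]

lemma fc_mul_harm (f : ℝ → ℂ) (j k : ℤ) : fc a (fun t => f t * harm a j t) k = fc a f (k - j) := by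
  unfold fc
  congr 1
  refine intervalIntegral.integral_congr fun t _ => ?_
  simp only
  rw [mul_assoc, ← harm_add]; congr 2; ring

lemma norm_fc_le (ha : 0 < a) {f : ℝ → ℂ} (k : ℤ) :
    ‖fc a f k‖ ≤ (1 / a) * ∫ t in (0 : ℝ)..a, ‖f t‖ := by
  rw [fc, norm_mul, norm_div, norm_one, Complex.norm_real, Real.norm_of_nonneg ha.le]
  gcongr
  refine (intervalIntegral.norm_integral_le_integral_norm ha.le).trans (le_of_eq ?_)
  refine intervalIntegral.integral_congr fun t _ => ?_
  simp

lemma fc_add {f g : ℝ → ℂ} (hf : IntervalIntegrable f volume 0 a)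
    (hg : IntervalIntegrable g volume 0 a) (k : ℤ) :
    fc a (fun t => f t + g t) k = fc a f k + fc a g k := by
  unfold fc
  rw [← mul_add, ← intervalIntegral.integral_add]
  · simp only [add_mul]
  · exact hf.mul_continuousOn (continuous_harm _).continuousOn
  · exact hg.mul_continuousOn (continuous_harm _).continuousOn

lemma fc_sub {f g : ℝ → ℂ} (hf : IntervalIntegrable f volume 0 a)
    (hg : IntervalIntegrable g volume 0 a) (k : ℤ) :
    fc a (fun t => f t - g t) k = fc a f k - fc a g k := by
  unfold fc
  rw [← mul_sub, ← intervalIntegral.integral_sub]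
  · simp only [sub_mul]
  · exact hf.mul_continuousOn (continuous_harm _).continuousOn
  · exact hg.mul_continuousOn (continuous_harm _).continuousOn

lemma fc_const_mul (f : ℝ → ℂ) (z : ℂ) (k : ℤ) : fc a (fun t => z * f t) k = z * fc a f k := by
  unfold fc
  simp only [mul_assoc, intervalIntegral.integral_const_mul]
  ring

/-- Fourier coefficients of an indefinite integral. `F` need not be periodic, whence the boundary
term. -/
lemma fc_of_primitive (ha : 0 < a) {f F : ℝ → ℂ} (hf : IntervalIntegrable f volume 0 a)
    (hF : ∀ t ∈ Set.Icc 0 a, F t = F 0 + ∫ s in (0 : ℝ)..t, f s) (k : ℤ) :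
    fc a f k = (F a - F 0) / a + Complex.I * ((2 * Real.pi / a : ℝ) * k) * fc a F k := by
  have h := integral_primitive_mul (G := harm a (-k)) ha.le hf
    (g := fun s => Complex.I * ((2 * Real.pi / a : ℝ) * (-k : ℤ)) * harm a (-k) s)
    (by apply Continuous.intervalIntegrable; fun_prop) hF (fun t _ => harm_eq_integral (-k) t)
  have h1 : harm a (-k) a = 1 := by
    have := harm_periodic (a := a) (-k) 0
    simpa using this
  rw [h1, harm_at_zero] at h
  have h2 : ∫ t in (0 : ℝ)..a, F t * (Complex.I * ((2 * Real.pi / a : ℝ) * (-k : ℤ)) *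
      harm a (-k) t) = Complex.I * ((2 * Real.pi / a : ℝ) * (-k : ℤ)) *
      ∫ t in (0 : ℝ)..a, F t * harm a (-k) t := by
    rw [← intervalIntegral.integral_const_mul]
    refine intervalIntegral.integral_congr fun t _ => ?_
    ring
  rw [h2] at h
  have ha' : (a : ℂ) ≠ 0 := by exact_mod_cast ha.ne'
  unfold fc
  push_cast at h ⊢
  linear_combination (1 / (a : ℂ)) * h

/-- Fourier inversion for a continuous periodic function with summable coefficients. -/
lemma hasSum_fc (ha : 0 < a) {f : ℝ → ℂ} (hf : Continuous f) (hper : Function.Periodic f a)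
    (hs : Summable (fc a f)) (x : ℝ) : HasSum (fun k => fc a f k * harm a k x) (f x) := by
  have : Fact (0 < a) := ⟨ha⟩
  let F : C(AddCircle a, ℂ) := ⟨hper.lift, continuous_coinduced_dom.mpr hf⟩
  have hF : ∀ t : ℝ, F (t : AddCircle a) = f t := fun t => hper.lift_coe t
  have hc : ∀ k, fourierCoeff F k = fc a f k := by
    intro k
    rw [fourierCoeff_eq_intervalIntegral _ k 0, zero_add, fc, Complex.real_smul]
    push_cast
    congr 1
    refine intervalIntegral.integral_congr fun t _ => ?_
    simp only [hF, smul_eq_mul]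
    rw [harm_eq_fourier, mul_comm]
  have h := has_pointwise_sum_fourier_series_of_summable (f := F)
    (by rw [show fourierCoeff F = fc a f from funext hc]; exact hs) (x : AddCircle a)
  simpa only [hc, hF, smul_eq_mul, ← harm_eq_fourier] using h

/-- The function with the Fourier coefficients `y`; it is meant for absolutely summable `y`. -/
noncomputable def trig (a : ℝ) (y : ℤ → ℂ) (x : ℝ) : ℂ := ∑' k, y k * harm a k x

lemma summable_trig {y : ℤ → ℂ} (hy : Summable fun k => ‖y k‖) (x : ℝ) :
    Summable fun k => y k * harm a k x :=
  Summable.of_norm (by simpa using hy)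

lemma continuous_trig {y : ℤ → ℂ} (hy : Summable fun k => ‖y k‖) : Continuous (trig a y) :=
  continuous_tsum (fun k => by fun_prop) hy (fun k x => by simp)

lemma trig_periodic (y : ℤ → ℂ) : Function.Periodic (trig a y) a := by
  intro x
  simp only [trig, harm_periodic _ x]

lemma norm_trig_le {y : ℤ → ℂ} (hy : Summable fun k => ‖y k‖) (x : ℝ) :
    ‖trig a y x‖ ≤ ∑' k, ‖y k‖ := by
  refine tsum_of_norm_bounded hy.hasSum fun k => ?_
  simp

lemma hasSum_integral_mul_trig {f : ℝ → ℂ} (hf : IntervalIntegrable f volume 0 a)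
    {y : ℤ → ℂ} (hy : Summable fun k => ‖y k‖) :
    HasSum (fun j => y j * ∫ t in (0 : ℝ)..a, f t * harm a j t)
      (∫ t in (0 : ℝ)..a, f t * trig a y t) := by
  have h := intervalIntegral.hasSum_integral_of_dominated_convergence (μ := volume) (a := 0) (b := a)
    (F := fun (j : ℤ) t => y j * (f t * harm a j t)) (f := fun t => f t * trig a y t)
    (fun j t => ‖y j‖ * ‖f t‖) (fun j => ?_) (fun j => ?_) ?_ ?_ ?_
  · simpa only [intervalIntegral.integral_const_mul] using h
  · exact ((hf.aestronglyMeasurable_restrict_uIoc).mul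
      (continuous_harm j).aestronglyMeasurable).const_mul _
  · exact Eventually.of_forall fun t _ => by simp
  · exact Eventually.of_forall fun t _ => hy.mul_right _
  · simp only [tsum_mul_right]
    exact hf.norm.const_mul _
  · refine Eventually.of_forall fun t _ => ?_
    convert! (summable_trig (a := a) hy t).hasSum.mul_left (f t) using 1
    ext j; ring

/-- Fourier coefficients of a product are a convolution; one factor is merely integrable, the other
has an absolutely convergent Fourier series. -/
lemma hasSum_fc_mul_trig {f : ℝ → ℂ} (hf : IntervalIntegrable f volume 0 a)
    {y : ℤ → ℂ} (hy : Summable fun k => ‖y k‖) (k : ℤ) :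
    HasSum (fun j => fc a f (k - j) * y j) (fc a (fun t => f t * trig a y t) k) := by
  have h := (hasSum_integral_mul_trig (hf.mul_continuousOn (continuous_harm (a := a) (-k)).continuousOn)
    hy).mul_left (1 / (a : ℂ))
  convert! h using 1
  · ext j
    unfold fc
    rw [mul_assoc, mul_comm _ (y j)]
    congr 2
    refine intervalIntegral.integral_congr fun t _ => ?_
    rw [mul_assoc, ← harm_add]; congr 2; ring
  · unfold fc
    congr 1
    refine intervalIntegral.integral_congr fun t _ => ?_
    simp only
    ring

lemma fc_one (ha : 0 < a) (k : ℤ) : fc a (fun _ => 1) k = if k = 0 then 1 else 0 := by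
  have ha' : (a : ℂ) ≠ 0 := by exact_mod_cast ha.ne'
  split_ifs with h
  · simp [h, fc, ha']
  · have := fc_of_primitive (F := fun _ => 1) (f := fun _ => 0) ha intervalIntegrable_const
      (by simp) k
    have h0 : fc a (fun _ => 0) k = 0 := by simp [fc]
    have hk : (k : ℂ) ≠ 0 := by exact_mod_cast h
    have hpi : (Real.pi : ℂ) ≠ 0 := by exact_mod_cast Real.pi_ne_zero
    rw [h0] at this
    simpa [ha', hk, hpi] using this

lemma fc_trig (ha : 0 < a) {y : ℤ → ℂ} (hy : Summable fun k => ‖y k‖) (k : ℤ) :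
    fc a (trig a y) k = y k := by
  have h := hasSum_fc_mul_trig (f := fun _ => 1) (a := a) intervalIntegrable_const hy k
  simp only [one_mul, fc_one ha] at h
  have h2 : HasSum (fun j => (if k - j = 0 then (1 : ℂ) else 0) * y j) (y k) := by
    have h3 := hasSum_single (f := fun j => (if k - j = 0 then (1 : ℂ) else 0) * y j) k
      fun j hj => by rw [if_neg (fun h => hj (sub_eq_zero.mp h).symm), zero_mul]
    simpa only [sub_self, if_true, one_mul] using h3
  exact h.unique h2

end Harmonics

/-! ### Uniqueness for solutions of Hill's equation -/

section Uniqueness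

variable {a : ℝ} {q : ℝ → ℝ} {μ : ℝ} {y : ℝ → ℂ}

lemma intervalIntegrable_of_locallyIntegrable (hq : LocallyIntegrable q volume) (x z : ℝ) :
    IntervalIntegrable q volume x z :=
  (hq.integrableOn_isCompact isCompact_uIcc).intervalIntegrable

lemma intervalIntegrable_ofReal (hq : LocallyIntegrable q volume) (x z : ℝ) :
    IntervalIntegrable (fun t => (q t : ℂ)) volume x z := by
  have h := intervalIntegrable_of_locallyIntegrable hq x z
  exact ⟨h.1.ofReal, h.2.ofReal⟩

lemma IsSolution.intervalIntegrable' (hy : IsSolution q μ y) (x z : ℝ) :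
    IntervalIntegrable (rhs q μ y) volume x z :=
  (hy.intervalIntegrable x).symm.trans (hy.intervalIntegrable z)

lemma IsSolution.deriv_sub (hy : IsSolution q μ y) (x z : ℝ) :
    deriv y z - deriv y x = ∫ t in x..z, rhs q μ y t := by
  rw [hy.deriv_eq x, hy.deriv_eq z, add_sub_add_left_eq_sub,
    intervalIntegral.integral_interval_sub_left (hy.intervalIntegrable z) (hy.intervalIntegrable x)]

lemma IsSolution.continuous_deriv (hy : IsSolution q μ y) : Continuous (deriv y) := by
  rw [show deriv y = fun x => deriv y 0 + ∫ t in (0 : ℝ)..x, rhs q μ y t from funext hy.deriv_eq]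
  exact continuous_const.add
    (intervalIntegral.continuous_primitive (fun x z => hy.intervalIntegrable' x z) 0)

lemma IsSolution.eq_integral (hy : IsSolution q μ y) (x : ℝ) :
    y x = y 0 + ∫ t in (0 : ℝ)..x, deriv y t := by
  rw [intervalIntegral.integral_deriv_eq_sub (fun t _ => hy.differentiable t)
    (hy.continuous_deriv.intervalIntegrable _ _)]
  ring

/-- A solution with zero Cauchy data at `x₀` vanishes near `x₀`: if `|y|` has maximum `Y` on the
interval, then `|y'| ≤ C Y` there and so `Y ≤ h C Y`, which forces `Y = 0`. -/
lemma IsSolution.local_uniqueness (hq : LocallyIntegrable q volume) (hy : IsSolution q μ y)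
    {x₀ h : ℝ} (hh : 0 ≤ h) (h0 : y x₀ = 0) (h1 : deriv y x₀ = 0)
    (hsmall : h * (∫ t in (x₀ - h)..(x₀ + h), |q t - μ|) < 1) :
    ∀ x ∈ Set.Icc (x₀ - h) (x₀ + h), y x = 0 ∧ deriv y x = 0 := by
  set C := ∫ t in (x₀ - h)..(x₀ + h), |q t - μ| with hC
  have hx₀ : x₀ ∈ Set.Icc (x₀ - h) (x₀ + h) := ⟨by linarith, by linarith⟩
  obtain ⟨x₁, hx₁, hmax⟩ := isCompact_Icc.exists_isMaxOn ⟨x₀, hx₀⟩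
    (hy.differentiable.continuous.norm.continuousOn (s := Set.Icc (x₀ - h) (x₀ + h)))
  have hM : ∀ x ∈ Set.Icc (x₀ - h) (x₀ + h), ‖y x‖ ≤ ‖y x₁‖ := fun x hx => hmax hx
  have hp : IntervalIntegrable (fun t => |q t - μ|) volume (x₀ - h) (x₀ + h) :=
    ((intervalIntegrable_of_locallyIntegrable hq _ _).sub intervalIntegrable_const).abs
  have hd : ∀ x ∈ Set.Icc (x₀ - h) (x₀ + h), ‖deriv y x‖ ≤ C * ‖y x₁‖ := by
    intro x hx
    have e : deriv y x = ∫ t in x₀..x, rhs q μ y t := by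
      rw [← hy.deriv_sub x₀ x, h1, sub_zero]
    have hsub : Set.uIoc x₀ x ⊆ Set.Ioc (x₀ - h) (x₀ + h) := by
      intro t ht
      rw [Set.mem_uIoc] at ht
      rcases ht with ht | ht
      · exact ⟨by linarith [ht.1], ht.2.trans hx.2⟩
      · exact ⟨by linarith [ht.1, hx.1], by linarith [ht.2]⟩
    rw [e, hC, ← intervalIntegral.integral_mul_const]
    refine (intervalIntegral.norm_integral_le_integral_norm_uIoc).trans ?_
    rw [intervalIntegral.integral_of_le (by linarith)]
    have hint : IntegrableOn (fun t => |q t - μ| * ‖y x₁‖) (Set.Ioc (x₀ - h) (x₀ + h)) volume :=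
      ((intervalIntegrable_iff_integrableOn_Ioc_of_le (by linarith)).mp hp).mul_const _
    refine (setIntegral_mono_on (hy.intervalIntegrable' x₀ x).def'.norm
      (hint.mono_set hsub) measurableSet_uIoc fun t ht => ?_).trans
      (setIntegral_mono_set hint (Eventually.of_forall fun t => by positivity)
        (Eventually.of_forall hsub))
    rw [rhs, norm_mul, Complex.norm_real, Real.norm_eq_abs]
    exact mul_le_mul_of_nonneg_left (hM t (Set.Ioc_subset_Icc_self (hsub ht))) (abs_nonneg _)
  have hy1 : ‖y x₁‖ ≤ C * ‖y x₁‖ * ‖x₁ - x₀‖ := by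
    have := (convex_Icc (x₀ - h) (x₀ + h)).norm_image_sub_le_of_norm_deriv_le
      (fun x _ => hy.differentiable x) hd hx₀ hx₁
    rwa [h0, sub_zero] at this
  have hCnn : 0 ≤ C := intervalIntegral.integral_nonneg (by linarith) fun t _ => abs_nonneg _
  have hdist : ‖x₁ - x₀‖ ≤ h := by
    rw [Real.norm_eq_abs, abs_le]; exact ⟨by linarith [hx₁.1], by linarith [hx₁.2]⟩
  have hz : ‖y x₁‖ = 0 := by
    by_contra hne
    have hpos : 0 < ‖y x₁‖ := lt_of_le_of_ne (norm_nonneg _) (Ne.symm hne)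
    have : C * ‖y x₁‖ * ‖x₁ - x₀‖ ≤ C * ‖y x₁‖ * h := by gcongr
    nlinarith
  intro x hx
  refine ⟨norm_le_zero_iff.mp ((hM x hx).trans hz.le), norm_le_zero_iff.mp ?_⟩
  simpa [hz] using hd x hx

lemma IsSolution.eq_zero (ha : 0 < a) (hq : LocallyIntegrable q volume)
    (hper : Function.Periodic q a) (hy : IsSolution q μ y) (h0 : y 0 = 0) (h1 : deriv y 0 = 0)
    (x : ℝ) : y x = 0 := by
  have hpint : ∀ s t, IntervalIntegrable (fun t => |q t - μ|) volume s t := fun s t =>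
    ((intervalIntegrable_of_locallyIntegrable hq _ _).sub intervalIntegrable_const).abs
  have hpper : Function.Periodic (fun t => |q t - μ|) a := fun t => by simp only [hper t]
  set C := ∫ t in (0 : ℝ)..a, |q t - μ| with hC
  have hCnn : 0 ≤ C := intervalIntegral.integral_nonneg ha.le fun t _ => abs_nonneg _
  -- a step length that works at every point, by periodicity
  obtain ⟨h, hh, hha, hhC⟩ : ∃ h : ℝ, 0 < h ∧ 2 * h ≤ a ∧ h * C < 1 := by
    refine ⟨min (a / 2) (1 / (C + 1)), by positivity, ?_, ?_⟩
    · linarith [min_le_left (a / 2) (1 / (C + 1))]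
    · calc min (a / 2) (1 / (C + 1)) * C ≤ 1 / (C + 1) * C := by gcongr; exact min_le_right _ _
        _ < 1 := by rw [one_div_mul_eq_div, div_lt_one (by positivity)]; linarith
  have hsmall : ∀ x₀, h * (∫ t in (x₀ - h)..(x₀ + h), |q t - μ|) < 1 := by
    intro x₀
    refine lt_of_le_of_lt ?_ hhC
    gcongr
    rw [hC, ← zero_add a, ← hpper.intervalIntegral_add_eq (x₀ - h) 0]
    exact intervalIntegral.integral_mono_interval le_rfl (by linarith) (by linarith)
      (Eventually.of_forall fun t => abs_nonneg _) (hpint _ _)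
  -- induction on the number of steps of length `h`, from `0` in the direction of `x`
  have key : ∀ n : ℕ, ∀ x : ℝ, |x| ≤ n * h → y x = 0 ∧ deriv y x = 0 := by
    intro n
    induction n with
    | zero =>
      intro x hx
      have : x = 0 := by simpa using hx
      rw [this]; exact ⟨h0, h1⟩
    | succ n ih =>
      intro x hx
      have hn : (0 : ℝ) < n + 1 := by positivity
      push_cast at hx
      have e : x - x * (n / (n + 1)) = x / (n + 1) := by field_simp; ring
      have hx0 := ih (x * (n / (n + 1))) (by
        rw [abs_mul, abs_of_nonneg (by positivity : (0 : ℝ) ≤ n / (n + 1))]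
        calc |x| * (n / (n + 1)) ≤ ((n + 1) * h) * (n / (n + 1)) := by gcongr
          _ = n * h := by field_simp)
      refine hy.local_uniqueness hq hh.le hx0.1 hx0.2 (hsmall _) x ?_
      have hd : |x - x * (n / (n + 1))| ≤ h := by
        rw [e, abs_div, abs_of_pos hn, div_le_iff₀ hn]; linarith
      rw [abs_le] at hd
      constructor <;> linarith [hd.1, hd.2]
  obtain ⟨n, hn⟩ := exists_nat_ge (|x| / h)
  exact (key n x (by rwa [div_le_iff₀ hh] at hn)).1

/-- The boundary conditions make `y(x + a) - y(x)` a solution with zero Cauchy data at `0`. -/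
lemma periodic_of_mem_eigenspace (ha : 0 < a) (hq : LocallyIntegrable q volume)
    (hper : Function.Periodic q a) (hy : y ∈ eigenspace q a μ) : Function.Periodic y a := by
  obtain ⟨hs, hy0, hy1⟩ := hy
  have hrhs : rhs q μ (fun x => y (x + a) - y x) =
      fun t => rhs q μ y (t + a) - rhs q μ y t := by
    funext t; simp only [rhs, hper t]; ring
  have hdsh : ∀ x, DifferentiableAt ℝ (fun x => y (x + a)) x := fun x =>
    (hs.differentiable (x + a)).comp x (differentiableAt_id.add_const a)
  have hd : ∀ x, deriv (fun x => y (x + a) - y x) x = deriv y (x + a) - deriv y x := by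
    intro x
    rw [deriv_fun_sub (hdsh x)
      (hs.differentiable x), deriv_comp_add_const]
  have hsh : ∀ x, IntervalIntegrable (fun t => rhs q μ y (t + a)) volume 0 x := fun x => by
    simpa using (hs.intervalIntegrable' (0 + a) (x + a)).comp_add_right a
  have hz : IsSolution q μ (fun x => y (x + a) - y x) := by
    refine ⟨fun x => ?_, fun x => ?_, fun x => ?_⟩
    · exact (hdsh x).sub (hs.differentiable x)
    · rw [hrhs]; exact (hsh x).sub (hs.intervalIntegrable x)
    · rw [hrhs, hd, hd, intervalIntegral.integral_sub (hsh x) (hs.intervalIntegrable x),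
        intervalIntegral.integral_comp_add_right, ← hs.deriv_sub, ← hs.deriv_sub]
      ring
  intro x
  have := hz.eq_zero ha hq hper (by simp [hy0]) (by rw [hd]; simp [hy1]) x
  exact sub_eq_zero.mp this

end Uniqueness

/-! ### Eigenfunctions and eigensequences -/

section Bridge

variable {a : ℝ} {q : ℝ → ℝ} {μ : ℝ} {y : ℝ → ℂ}

lemma fc_rhs (hq : LocallyIntegrable q volume) (hy : Continuous y) (k : ℤ) :
    fc a (rhs q μ y) k = fc a (fun t => (q t : ℂ) * y t) k - μ * fc a y k := by
  rw [← fc_const_mul, ← fc_sub]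
  · congr 1; ext t; simp only [rhs]; push_cast; ring
  · exact (intervalIntegrable_ofReal hq 0 a).mul_continuousOn hy.continuousOn
  · exact (hy.const_smul (μ : ℂ)).intervalIntegrable _ _

/-- The Fourier coefficients of a periodic eigenfunction form an eigensequence, and the
eigenfunction is the sum of its Fourier series. -/
lemma isEigSeq_of_mem_eigenspace (ha : 0 < a) (hq : LocallyIntegrable q volume)
    (hper : Function.Periodic q a) (hy : y ∈ eigenspace q a μ) :
    IsEigSeq (coeff q a) (2 * Real.pi / a) μ (fc a y) ∧ trig a (fc a y) = y := by
  have hyper := periodic_of_mem_eigenspace ha hq hper hy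
  obtain ⟨hs, hy0, hy1⟩ := hy
  have hyc := hs.differentiable.continuous
  have hw : 0 < 2 * Real.pi / a := by have := Real.pi_pos; positivity
  have e1 : ∀ k, fc a (deriv y) k = Complex.I * ((2 * Real.pi / a : ℝ) * k) * fc a y k := by
    intro k
    rw [fc_of_primitive ha (hs.continuous_deriv.intervalIntegrable 0 a)
      (fun t _ => hs.eq_integral t) k, hy0]
    simp
  have e2 : ∀ k, fc a (rhs q μ y) k =
      Complex.I * ((2 * Real.pi / a : ℝ) * k) * fc a (deriv y) k := by
    intro k
    rw [fc_of_primitive ha (hs.intervalIntegrable a) (fun t _ => hs.deriv_eq t) k, hy1]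
    simp
  have e3 : ∀ k : ℤ, ((μ - (2 * Real.pi / a * k) ^ 2 : ℝ) : ℂ) * fc a y k =
      fc a (fun t => (q t : ℂ) * y t) k := by
    intro k
    have := e2 k
    rw [e1, fc_rhs hq hyc] at this
    push_cast at this ⊢
    linear_combination -this - ((2 * Real.pi / a * k) ^ 2 * fc a y k) * Complex.I_sq
  set C1 := (1 / a) * ∫ t in (0 : ℝ)..a, ‖(q t : ℂ) * y t‖
  set C2 := (1 / a) * ∫ t in (0 : ℝ)..a, ‖y t‖
  have hsum : Summable fun k => ‖fc a y k‖ := by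
    refine Summable.of_nonneg_of_le (fun k => norm_nonneg _) (fun k => ?_)
      ((summable_one_div_weight (w := 2 * Real.pi / a) (P := 1) le_rfl).mul_left
        (C1 + (|μ| + (2 * Real.pi / a) ^ 2) * C2))
    rw [mul_one_div, le_div_iff₀ (weight_pos hw one_pos k)]
    have h1 : |μ - (2 * Real.pi / a * k) ^ 2| * ‖fc a y k‖ ≤ C1 := by
      have := congrArg norm (e3 k)
      rw [norm_mul, Complex.norm_real, Real.norm_eq_abs] at this
      rw [this]; exact norm_fc_le ha k
    have h2 : ‖fc a y k‖ ≤ C2 := norm_fc_le ha k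
    have h3 : weight (2 * Real.pi / a) 1 k ≤
        |μ - (2 * Real.pi / a * k) ^ 2| + (|μ| + (2 * Real.pi / a) ^ 2) := by
      have := neg_abs_le (μ - (2 * Real.pi / a * k) ^ 2)
      have := le_abs_self μ
      unfold weight
      linarith
    calc ‖fc a y k‖ * weight (2 * Real.pi / a) 1 k
        ≤ ‖fc a y k‖ * (|μ - (2 * Real.pi / a * k) ^ 2| + (|μ| + (2 * Real.pi / a) ^ 2)) := by gcongr
      _ = |μ - (2 * Real.pi / a * k) ^ 2| * ‖fc a y k‖ +
          (|μ| + (2 * Real.pi / a) ^ 2) * ‖fc a y k‖ := by ring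
      _ ≤ _ := by gcongr
  have htrig : trig a (fc a y) = y := by
    ext x
    exact (hasSum_fc ha hyc hyper hsum.of_norm x).tsum_eq
  refine ⟨⟨hsum, fun k => ?_⟩, htrig⟩
  rw [e3 k]
  have h := (hasSum_fc_mul_trig (intervalIntegrable_ofReal hq 0 a) hsum k).tsum_eq
  rw [htrig] at h
  simp only [coeff_eq_fc, h]

lemma primitive_periodic {f : ℝ → ℂ} (hf : ∀ x z, IntervalIntegrable f volume x z)
    (hper : Function.Periodic f a) (h0 : ∫ t in (0 : ℝ)..a, f t = 0) :
    Function.Periodic (fun x => ∫ t in (0 : ℝ)..x, f t) a := by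
  intro x
  simp only
  rw [← intervalIntegral.integral_add_adjacent_intervals (hf 0 x) (hf x (x + a)),
    hper.intervalIntegral_add_eq x 0, zero_add, h0, add_zero]

/-- Conversely, the Fourier series of an eigensequence is a periodic eigenfunction. Termwise
differentiation is not available; instead `(q - μ) y` is integrated twice, the constants are fixed by
the Fourier coefficients, and the result is identified with `y` by Fourier inversion. -/
lemma trig_mem_eigenspace (ha : 0 < a) (hq : LocallyIntegrable q volume)
    (hper : Function.Periodic q a) {y : ℤ → ℂ}
    (hy : IsEigSeq (coeff q a) (2 * Real.pi / a) μ y) : trig a y ∈ eigenspace q a μ := by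
  have ha' : (a : ℂ) ≠ 0 := by exact_mod_cast ha.ne'
  have hw : ∀ k : ℤ, k ≠ 0 → Complex.I * (((2 * Real.pi / a : ℝ) : ℂ) * k) ≠ 0 := by
    intro k hk
    have h1 : ((2 * Real.pi / a : ℝ) : ℂ) ≠ 0 := by
      have := Real.pi_pos
      exact_mod_cast (by positivity : (2 * Real.pi / a : ℝ) ≠ 0)
    have h2 : (k : ℂ) ≠ 0 := by exact_mod_cast hk
    exact mul_ne_zero Complex.I_ne_zero (mul_ne_zero h1 h2)
  set Y := trig a y with hYdef
  have hYc : Continuous Y := continuous_trig hy.summable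
  have hYper : Function.Periodic Y a := trig_periodic y
  set f := rhs q μ Y with hf
  have hfint : ∀ x z, IntervalIntegrable f volume x z := by
    intro x z
    have : IntervalIntegrable (fun t => ((q t : ℂ) - μ) * Y t) volume x z :=
      ((intervalIntegrable_ofReal hq x z).sub intervalIntegrable_const).mul_continuousOn
        hYc.continuousOn
    convert! this using 1
    ext t; simp only [hf, rhs]; push_cast; ring
  have hfper : Function.Periodic f a := by
    intro t; simp only [hf, rhs, hper t, hYper t]
  have hfc : ∀ k : ℤ, fc a f k = -((2 * Real.pi / a : ℝ) * k) ^ 2 * y k := by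
    intro k
    have h1 := hy.eq k
    simp only [coeff_eq_fc] at h1
    rw [(hasSum_fc_mul_trig (intervalIntegrable_ofReal hq 0 a) hy.summable k).tsum_eq] at h1
    rw [hf, fc_rhs hq hYc, ← h1, hYdef, fc_trig ha hy.summable]
    push_cast; ring
  have hf0 : ∫ t in (0 : ℝ)..a, f t = 0 := by
    have := hfc 0
    simpa [fc, ha'] using this
  -- the first integration; `Y₁` is the candidate for the derivative, normalized to mean zero
  set Z₁ : ℝ → ℂ := fun x => ∫ t in (0 : ℝ)..x, f t with hZ₁
  have hZ₁c : Continuous Z₁ := intervalIntegral.continuous_primitive hfint 0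
  have hZ₁per : Function.Periodic Z₁ a := primitive_periodic hfint hfper hf0
  set Y₁ : ℝ → ℂ := fun x => Z₁ x - fc a Z₁ 0 with hY₁
  have hY₁c : Continuous Y₁ := hZ₁c.sub continuous_const
  have hY₁per : Function.Periodic Y₁ a := fun x => by simp only [hY₁, hZ₁per x]
  have hY₁eq : ∀ x, Y₁ x = Y₁ 0 + ∫ t in (0 : ℝ)..x, f t := by
    intro x; simp only [hY₁, hZ₁, intervalIntegral.integral_same]; ring
  have hY₁fc : ∀ k : ℤ, fc a Y₁ k = Complex.I * ((2 * Real.pi / a : ℝ) * k) * y k := by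
    intro k
    by_cases hk : k = 0
    · rw [hk, hY₁, fc_sub (hZ₁c.intervalIntegrable _ _) intervalIntegrable_const]
      simp [fc, ha']
    · have h1 := fc_of_primitive ha (hfint 0 a) (fun t _ => hY₁eq t) k
      have h2 : Y₁ a = Y₁ 0 := by simpa using hY₁per 0
      rw [hfc, h2] at h1
      apply mul_left_cancel₀ (hw k hk)
      rw [← sub_eq_zero] at h1 ⊢
      linear_combination -h1 - ((2 * Real.pi / a : ℝ) * k) ^ 2 * y k * Complex.I_sq
  have hY₁0 : ∫ t in (0 : ℝ)..a, Y₁ t = 0 := by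
    have := hY₁fc 0
    simpa [fc, ha'] using this
  -- the second integration; the constant is chosen so that the mean is `y 0`
  set Z₂ : ℝ → ℂ := fun x => ∫ t in (0 : ℝ)..x, Y₁ t with hZ₂
  have hZ₂c : Continuous Z₂ :=
    intervalIntegral.continuous_primitive (fun x z => hY₁c.intervalIntegrable x z) 0
  have hZ₂per : Function.Periodic Z₂ a :=
    primitive_periodic (fun x z => hY₁c.intervalIntegrable x z) hY₁per hY₁0
  have hZ₂fc : ∀ k : ℤ, k ≠ 0 → fc a Z₂ k = y k := by
    intro k hk
    have h1 := fc_of_primitive ha (hY₁c.intervalIntegrable 0 a) (F := Z₂)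
      (fun t _ => by simp [hZ₂]) k
    have h2 : Z₂ a = Z₂ 0 := by simpa using hZ₂per 0
    rw [hY₁fc, h2, sub_self, zero_div, zero_add] at h1
    exact (mul_left_cancel₀ (hw k hk) h1).symm
  set Y₂ : ℝ → ℂ := fun x => Z₂ x + (y 0 - fc a Z₂ 0) with hY₂
  have hY₂fc : fc a Y₂ = y := by
    ext k
    rw [hY₂, fc_add (hZ₂c.intervalIntegrable _ _) intervalIntegrable_const]
    have h1 := fc_const_mul (a := a) (fun _ => 1) (y 0 - fc a Z₂ 0) k
    simp only [mul_one] at h1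
    rw [h1, fc_one ha]
    by_cases hk : k = 0
    · simp [hk]
    · simp [hk, hZ₂fc k hk]
  have hY₂Y : Y₂ = Y := by
    ext x
    have h1 := hasSum_fc (f := Y₂) ha (hZ₂c.add continuous_const)
      (fun x => by simp only [hY₂, hZ₂per x]) (by rw [hY₂fc]; exact hy.summable.of_norm) x
    rw [hY₂fc] at h1
    exact h1.tsum_eq.symm
  have hderiv : ∀ x, HasDerivAt Y (Y₁ x) x := by
    intro x
    rw [← hY₂Y]
    exact (hY₁c.integral_hasStrictDerivAt 0 x).hasDerivAt.add_const _
  have hd : deriv Y = Y₁ := funext fun x => (hderiv x).deriv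
  refine ⟨⟨fun x => (hderiv x).differentiableAt, fun x => hfint 0 x, fun x => ?_⟩, ?_, ?_⟩
  · rw [hd]; exact hY₁eq x
  · simpa using (hYper 0).symm
  · rw [hd]; simpa using (hY₁per 0).symm

end Bridge

/-! ### Sums over inverse gaps -/

section GapSums

/-- The inverse gap `1 / |k² - p²|`, which is `0` at the resonant modes `k = ±p`. -/
noncomputable def gapInv (p : ℕ) (k : ℤ) : ℝ := 1 / |(k : ℝ) ^ 2 - (p : ℝ) ^ 2|

lemma gapInv_nonneg (p : ℕ) (k : ℤ) : 0 ≤ gapInv p k := by unfold gapInv; positivity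

lemma gapInv_eq (p : ℕ) (k : ℤ) :
    gapInv p k = 1 / (|((k - p : ℤ) : ℝ)| * |((k + p : ℤ) : ℝ)|) := by
  rw [gapInv, ← abs_mul]; congr 2; push_cast; ring

lemma one_le_abs_of_ne_zero {j : ℤ} (h : j ≠ 0) : (1 : ℝ) ≤ |(j : ℝ)| := by
  exact_mod_cast Int.one_le_abs h

lemma gapInv_le_aux {p x z : ℝ} (hx : 0 < x) (hp : 0 < p) (hxz : x ≤ z) (hpz : p ≤ z) :
    1 / (x * z) ≤ 1 / √p * (1 / (x * √x)) := by
  rw [one_div_mul_one_div]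
  refine one_div_le_one_div_of_le (by positivity) ?_
  have h1 : √p * √x ≤ z := by
    have := mul_le_mul (Real.sqrt_le_sqrt hpz) (Real.sqrt_le_sqrt hxz) (Real.sqrt_nonneg _)
      (Real.sqrt_nonneg _)
    rwa [Real.mul_self_sqrt (by linarith)] at this
  calc √p * (x * √x) = x * (√p * √x) := by ring
    _ ≤ x * z := by gcongr

lemma gapInv_sq_le_aux {p x z : ℝ} (hx : 0 < x) (hp : 0 < p) (hpz : p ≤ z) :
    (1 / (x * z)) ^ 2 ≤ 1 / p ^ 2 * (1 / x ^ 2) := by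
  rw [one_div_mul_one_div, div_pow, one_pow]
  refine one_div_le_one_div_of_le (by positivity) ?_
  rw [mul_pow, mul_comm]
  gcongr

/-- The larger of `|k - p|` and `|k + p|` is at least `p`. -/
lemma abs_sub_le_abs_add_or {p : ℕ} (k : ℤ) : (|((k - p : ℤ) : ℝ)| ≤ |((k + p : ℤ) : ℝ)| ∧
    (p : ℝ) ≤ |((k + p : ℤ) : ℝ)|) ∨ (|((k + p : ℤ) : ℝ)| ≤ |((k - p : ℤ) : ℝ)| ∧
    (p : ℝ) ≤ |((k - p : ℤ) : ℝ)|) := by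
  have hp : (0 : ℝ) ≤ p := Nat.cast_nonneg p
  push_cast
  rcases le_total 0 (k : ℝ) with h | h
  · left
    rw [abs_of_nonneg (by linarith : (0 : ℝ) ≤ k + p)]
    exact ⟨abs_le.mpr ⟨by linarith, by linarith⟩, by linarith⟩
  · right
    rw [abs_of_nonpos (by linarith : (k : ℝ) - p ≤ 0)]
    exact ⟨abs_le.mpr ⟨by linarith, by linarith⟩, by linarith⟩

lemma gapInv_le {p : ℕ} (hp : 0 < p) (k : ℤ) : gapInv p k ≤
    1 / √p * (1 / (|((k - p : ℤ) : ℝ)| * √|((k - p : ℤ) : ℝ)|)) +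
    1 / √p * (1 / (|((k + p : ℤ) : ℝ)| * √|((k + p : ℤ) : ℝ)|)) := by
  have hp' : (0 : ℝ) < p := by exact_mod_cast hp
  rw [gapInv_eq]
  by_cases h1 : k - p = 0
  · rw [h1]; simp; positivity
  by_cases h2 : k + p = 0
  · rw [h2]; simp; positivity
  have hx := lt_of_lt_of_le one_pos (one_le_abs_of_ne_zero h1)
  have hz := lt_of_lt_of_le one_pos (one_le_abs_of_ne_zero h2)
  rcases abs_sub_le_abs_add_or (p := p) k with ⟨h3, h4⟩ | ⟨h3, h4⟩
  · exact (gapInv_le_aux hx hp' h3 h4).trans (le_add_of_nonneg_right (by positivity))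
  · rw [mul_comm |((k - p : ℤ) : ℝ)| |((k + p : ℤ) : ℝ)|]
    exact (gapInv_le_aux hz hp' h3 h4).trans (le_add_of_nonneg_left (by positivity))

lemma gapInv_sq_le {p : ℕ} (hp : 0 < p) (k : ℤ) : gapInv p k ^ 2 ≤
    1 / (p : ℝ) ^ 2 * (1 / |((k - p : ℤ) : ℝ)| ^ 2) +
    1 / (p : ℝ) ^ 2 * (1 / |((k + p : ℤ) : ℝ)| ^ 2) := by
  have hp' : (0 : ℝ) < p := by exact_mod_cast hp
  rw [gapInv_eq]
  by_cases h1 : k - p = 0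
  · rw [h1]; simp; positivity
  by_cases h2 : k + p = 0
  · rw [h2]; simp; positivity
  have hx := lt_of_lt_of_le one_pos (one_le_abs_of_ne_zero h1)
  have hz := lt_of_lt_of_le one_pos (one_le_abs_of_ne_zero h2)
  rcases abs_sub_le_abs_add_or (p := p) k with ⟨h3, h4⟩ | ⟨h3, h4⟩
  · exact (gapInv_sq_le_aux hx hp' h4).trans (le_add_of_nonneg_right (by positivity))
  · rw [mul_comm |((k - p : ℤ) : ℝ)| |((k + p : ℤ) : ℝ)|]
    exact (gapInv_sq_le_aux hz hp' h4).trans (le_add_of_nonneg_left (by positivity))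

lemma summable_inv_three_halves : Summable fun j : ℤ => 1 / (|(j : ℝ)| * √|(j : ℝ)|) := by
  have h := Real.summable_abs_int_rpow (b := 3 / 2) (by norm_num)
  refine h.congr fun j => ?_
  rw [Real.rpow_neg (abs_nonneg _), one_div]
  congr 1
  rw [show (3 / 2 : ℝ) = 1 + 1 / 2 by norm_num, Real.rpow_add_of_nonneg (abs_nonneg _)
    (by norm_num) (by norm_num), Real.rpow_one, ← Real.sqrt_eq_rpow]

lemma summable_inv_sq : Summable fun j : ℤ => 1 / |(j : ℝ)| ^ 2 := by
  simp only [sq_abs]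
  exact Real.summable_one_div_int_pow.mpr (by norm_num)

lemma tsum_le_of_shift {f g : ℤ → ℝ} {b : ℝ} (p : ℤ) (hf : ∀ k, 0 ≤ f k) (hg : Summable g)
    (h : ∀ k, f k ≤ b * g (k - p) + b * g (k + p)) :
    Summable f ∧ ∑' k, f k ≤ b * (2 * ∑' k, g k) := by
  have h1 : HasSum (fun k => g (k - p)) (∑' k, g k) := (Equiv.subRight p).hasSum_iff.mpr hg.hasSum
  have h2 : HasSum (fun k => g (k + p)) (∑' k, g k) := (Equiv.addRight p).hasSum_iff.mpr hg.hasSum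
  have h3 := (h1.mul_left b).add (h2.mul_left b)
  have hs : Summable f := Summable.of_nonneg_of_le hf h h3.summable
  refine ⟨hs, (hasSum_le h hs.hasSum h3).trans (le_of_eq (by ring))⟩

/-- The two sums over inverse gaps. The exponent `1/2` in the first is not optimal (it is
`O(log p / p)`), but suffices. -/
lemma exists_gapInv_bounds : ∃ C : ℝ, 0 < C ∧ ∀ p : ℕ, 0 < p →
    (Summable (gapInv p) ∧ ∑' k, gapInv p k ≤ C / √p) ∧
    (Summable (fun k => gapInv p k ^ 2) ∧ ∑' k, gapInv p k ^ 2 ≤ C / (p : ℝ) ^ 2) := by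
  set S1 := ∑' j : ℤ, 1 / (|(j : ℝ)| * √|(j : ℝ)|)
  set S2 := ∑' j : ℤ, 1 / |(j : ℝ)| ^ 2
  have hS1 : 0 ≤ S1 := tsum_nonneg fun j => by positivity
  have hS2 : 0 ≤ S2 := tsum_nonneg fun j => by positivity
  refine ⟨2 * S1 + 2 * S2 + 1, by positivity, fun p hp => ?_⟩
  have hp' : (0 : ℝ) < p := by exact_mod_cast hp
  obtain ⟨a1, a2⟩ := tsum_le_of_shift p (gapInv_nonneg p) summable_inv_three_halves (gapInv_le hp)
  obtain ⟨b1, b2⟩ := tsum_le_of_shift p (fun k => sq_nonneg (gapInv p k)) summable_inv_sq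
    (gapInv_sq_le hp)
  refine ⟨⟨a1, a2.trans ?_⟩, ⟨b1, b2.trans ?_⟩⟩
  · rw [one_div_mul_eq_div]; gcongr; linarith
  · rw [one_div_mul_eq_div]; gcongr; linarith

end GapSums

/-! ### Zero-mean primitives -/

section Primitive

variable {a : ℝ}

/-- The primitive of `f` with mean zero over `[0, a]`. -/
noncomputable def prim (a : ℝ) (f : ℝ → ℂ) (x : ℝ) : ℂ :=
  (∫ t in (0 : ℝ)..x, f t) - fc a (fun x => ∫ t in (0 : ℝ)..x, f t) 0

variable {f : ℝ → ℂ}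

lemma continuous_prim (hf : ∀ x z, IntervalIntegrable f volume x z) : Continuous (prim a f) :=
  (intervalIntegral.continuous_primitive hf 0).sub continuous_const

lemma prim_eq (x : ℝ) : prim a f x = prim a f 0 + ∫ t in (0 : ℝ)..x, f t := by
  simp only [prim, intervalIntegral.integral_same]; ring

lemma prim_periodic (hf : ∀ x z, IntervalIntegrable f volume x z)
    (hper : Function.Periodic f a) (h0 : ∫ t in (0 : ℝ)..a, f t = 0) :
    Function.Periodic (prim a f) a := by
  intro x
  have := primitive_periodic hf hper h0 x
  simp only at this
  simp only [prim, this]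

lemma fc_prim (ha : 0 < a) (hf : ∀ x z, IntervalIntegrable f volume x z)
    (h0 : ∫ t in (0 : ℝ)..a, f t = 0) (k : ℤ) :
    fc a (prim a f) k = fc a f k / (Complex.I * ((2 * Real.pi / a : ℝ) * k)) := by
  have ha' : (a : ℂ) ≠ 0 := by exact_mod_cast ha.ne'
  by_cases hk : k = 0
  · have hc : Continuous fun x => ∫ t in (0 : ℝ)..x, f t :=
      intervalIntegral.continuous_primitive hf 0
    have h1 : fc a (prim a f) 0 = fc a (fun x => ∫ t in (0 : ℝ)..x, f t) 0 -
        fc a (fun _ => fc a (fun x => ∫ t in (0 : ℝ)..x, f t) 0) 0 :=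
      fc_sub (hc.intervalIntegrable _ _) intervalIntegrable_const 0
    rw [hk, h1]
    simp [fc, ha']
  · have h1 : ((2 * Real.pi / a : ℝ) : ℂ) ≠ 0 := by
      have := Real.pi_pos
      exact_mod_cast (by positivity : (2 * Real.pi / a : ℝ) ≠ 0)
    have h2 : (k : ℂ) ≠ 0 := by exact_mod_cast hk
    have hne : Complex.I * (((2 * Real.pi / a : ℝ) : ℂ) * k) ≠ 0 :=
      mul_ne_zero Complex.I_ne_zero (mul_ne_zero h1 h2)
    have h := fc_of_primitive ha (hf 0 a) (fun t _ => prim_eq (a := a) (f := f) t) k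
    have h3 : prim a f a = prim a f 0 := by rw [prim_eq, h0, add_zero]
    rw [h3, sub_self, zero_div, zero_add] at h
    rw [eq_div_iff hne, h]; ring

lemma norm_prim_le (ha : 0 < a) {R : ℝ}
    (hR : ∀ x ∈ Set.Icc 0 a, ‖∫ t in (0 : ℝ)..x, f t‖ ≤ R) :
    ∀ x ∈ Set.Icc 0 a, ‖prim a f x‖ ≤ 2 * R := by
  have h1 : ‖fc a (fun x => ∫ t in (0 : ℝ)..x, f t) 0‖ ≤ R := by
    unfold fc
    rw [norm_mul, norm_div, norm_one, Complex.norm_real, Real.norm_of_nonneg ha.le]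
    have := intervalIntegral.norm_integral_le_of_norm_le_const (a := 0) (b := a) (C := R)
      (f := fun x => (∫ t in (0 : ℝ)..x, f t) * harm a (-0) x) (fun x hx => by
        rw [Set.uIoc_of_le ha.le] at hx
        simpa using hR x ⟨hx.1.le, hx.2⟩)
    rw [sub_zero, abs_of_pos ha] at this
    calc _ ≤ 1 / a * (R * a) := by gcongr
      _ = R := by field_simp
  intro x hx
  calc ‖prim a f x‖ ≤ _ := norm_sub_le _ _
    _ ≤ R + R := add_le_add (hR x hx) h1
    _ = 2 * R := by ring

lemma norm_integral_le_total (hf : IntervalIntegrable f volume 0 a) {x : ℝ}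
    (hx : x ∈ Set.Icc 0 a) : ‖∫ t in (0 : ℝ)..x, f t‖ ≤ ∫ t in (0 : ℝ)..a, ‖f t‖ :=
  (intervalIntegral.norm_integral_le_integral_norm hx.1).trans
    (intervalIntegral.integral_mono_interval le_rfl hx.1 hx.2
      (Eventually.of_forall fun _ => norm_nonneg _) hf.norm)

lemma norm_integral_mul_le (ha : 0 < a) {g : ℝ → ℂ} (hf : IntervalIntegrable f volume 0 a)
    {R : ℝ} (hR : ∀ x ∈ Set.Icc 0 a, ‖g x‖ ≤ R) :
    ‖∫ t in (0 : ℝ)..a, f t * g t‖ ≤ (∫ t in (0 : ℝ)..a, ‖f t‖) * R := by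
  rw [← intervalIntegral.integral_mul_const]
  refine intervalIntegral.norm_integral_le_of_norm_le ha.le
    (Eventually.of_forall fun t ht => ?_) (hf.norm.mul_const R)
  rw [norm_mul]
  exact mul_le_mul_of_nonneg_left (hR t ⟨ht.1.le, ht.2⟩) (norm_nonneg _)

lemma norm_fc_mul_le (ha : 0 < a) {g : ℝ → ℂ} (hf : IntervalIntegrable f volume 0 a)
    {R : ℝ} (hR : ∀ x ∈ Set.Icc 0 a, ‖g x‖ ≤ R) (k : ℤ) :
    ‖fc a (fun t => f t * g t) k‖ ≤ (1 / a * ∫ t in (0 : ℝ)..a, ‖f t‖) * R := by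
  unfold fc
  rw [norm_mul, norm_div, norm_one, Complex.norm_real, Real.norm_of_nonneg ha.le, mul_assoc]
  gcongr
  have := norm_integral_mul_le (g := fun t => g t * harm a (-k) t) ha hf (R := R)
    (fun x hx => by simpa using hR x hx)
  simpa only [mul_assoc] using this

end Primitive

/-! ### First-order response of the non-resonant modes -/

section Resolvent

variable {a : ℝ} {q : ℝ → ℝ}

/-- The first-order response of the non-resonant modes to the mode `p`: for `k ≠ ±p` the solution
of `w² (p² - k²) G_k = c_{k-p}`. Division by zero makes it `0` at `k = ±p`. -/
noncomputable def gseq (q : ℝ → ℝ) (a : ℝ) (p : ℕ) (k : ℤ) : ℂ :=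
  coeff q a (k - p) / (((2 * Real.pi / a) ^ 2 * ((p : ℝ) ^ 2 - (k : ℝ) ^ 2) : ℝ) : ℂ)

/-- The mean of `|q|` over a period. -/
noncomputable def qmean (q : ℝ → ℝ) (a : ℝ) : ℝ := 1 / a * ∫ t in (0 : ℝ)..a, ‖(q t : ℂ)‖

lemma norm_coeff_le (ha : 0 < a) (k : ℤ) : ‖coeff q a k‖ ≤ qmean q a := by
  rw [coeff_eq_fc]; exact norm_fc_le ha k

lemma qmean_nonneg (ha : 0 < a) : 0 ≤ qmean q a := (norm_nonneg _).trans (norm_coeff_le ha 0)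

lemma coeff_neg (k : ℤ) : coeff q a (-k) = starRingEnd ℂ (coeff q a k) := by
  simp only [coeff_eq_fc, fc]
  rw [map_mul, map_div₀, map_one, Complex.conj_ofReal, ← intervalIntegral.intervalIntegral_conj]
  simp only [map_mul, Complex.conj_ofReal, conj_harm]

lemma norm_inv_gap (p : ℕ) (k : ℤ) :
    ‖(((2 * Real.pi / a) ^ 2 * ((p : ℝ) ^ 2 - (k : ℝ) ^ 2) : ℝ) : ℂ)‖⁻¹ =
      1 / (2 * Real.pi / a) ^ 2 * gapInv p k := by
  rw [Complex.norm_real, Real.norm_eq_abs, abs_mul, abs_of_nonneg (by positivity), gapInv,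
    abs_sub_comm, one_div_mul_one_div, one_div]

lemma norm_gseq_le (ha : 0 < a) (p : ℕ) (k : ℤ) :
    ‖gseq q a p k‖ ≤ qmean q a / (2 * Real.pi / a) ^ 2 * gapInv p k := by
  rw [gseq, norm_div, div_eq_mul_inv, norm_inv_gap, ← mul_assoc, mul_one_div]
  have := gapInv_nonneg p k
  gcongr
  exact norm_coeff_le ha _

lemma summable_gseq (ha : 0 < a) {p : ℕ} (hp : 0 < p) : Summable fun k => ‖gseq q a p k‖ := by
  obtain ⟨C, -, hC⟩ := exists_gapInv_bounds
  exact Summable.of_nonneg_of_le (fun k => norm_nonneg _) (norm_gseq_le ha p)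
    ((hC p hp).1.1.mul_left _)

/-- The function `q e^{2i κ x}`, with `κ = 2π p / a`, minus its mean. -/
noncomputable def osc (q : ℝ → ℝ) (a : ℝ) (p : ℕ) (t : ℝ) : ℂ :=
  (q t : ℂ) * harm a (2 * p) t - coeff q a (-(2 * p))

lemma osc_intervalIntegrable (hq : LocallyIntegrable q volume) (p : ℕ) (x z : ℝ) :
    IntervalIntegrable (osc q a p) volume x z :=
  ((intervalIntegrable_ofReal hq x z).mul_continuousOn
    (continuous_harm (2 * p)).continuousOn).sub intervalIntegrable_const

lemma integral_osc (ha : 0 < a) (hq : LocallyIntegrable q volume) (p : ℕ) :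
    ∫ t in (0 : ℝ)..a, osc q a p t = 0 := by
  have ha' : (a : ℂ) ≠ 0 := by exact_mod_cast ha.ne'
  unfold osc
  rw [intervalIntegral.integral_sub ((intervalIntegrable_ofReal hq 0 a).mul_continuousOn
    (continuous_harm (2 * p)).continuousOn) intervalIntegrable_const,
    intervalIntegral.integral_const, coeff_eq_fc, fc, neg_neg]
  simp only [sub_zero, Complex.real_smul]
  field_simp
  ring

lemma fc_osc (ha : 0 < a) (hq : LocallyIntegrable q volume) (p : ℕ) {k : ℤ} (hk : k ≠ 0) :
    fc a (osc q a p) k = coeff q a (k - 2 * p) := by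
  unfold osc
  rw [fc_sub ((intervalIntegrable_ofReal hq 0 a).mul_continuousOn
    (continuous_harm (2 * p)).continuousOn) intervalIntegrable_const, fc_mul_harm, ← coeff_eq_fc]
  have h1 := fc_const_mul (a := a) (fun _ => 1) (coeff q a (-(2 * p))) k
  simp only [mul_one, fc_one ha, if_neg hk, mul_zero] at h1
  rw [h1, sub_zero]

/-- Consequences of a bound `R` for the partial integrals of `q e^{-2iκx}`; in the application `R`
is `ρ`. -/
lemma norm_osc_integral_le (ha : 0 < a) (hq : LocallyIntegrable q volume) {p : ℕ} {R : ℝ}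
    (hR : ∀ x ∈ Set.Icc 0 a, ‖∫ t in (0 : ℝ)..x, (q t : ℂ) * harm a (-(2 * p)) t‖ ≤ R) :
    ‖coeff q a (2 * p)‖ ≤ R / a ∧
    (∀ x ∈ Set.Icc 0 a, ‖∫ t in (0 : ℝ)..x, (q t : ℂ) * harm a (2 * p) t‖ ≤ R) ∧
    ∀ x ∈ Set.Icc 0 a, ‖∫ t in (0 : ℝ)..x, osc q a p t‖ ≤ 2 * R := by
  have hc : ‖coeff q a (2 * p)‖ ≤ R / a := by
    rw [coeff_eq_fc, fc, norm_mul, norm_div, norm_one, Complex.norm_real,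
      Real.norm_of_nonneg ha.le, one_div, div_eq_inv_mul]
    gcongr
    exact hR a ⟨ha.le, le_rfl⟩
  have h2 : ∀ x ∈ Set.Icc 0 a, ‖∫ t in (0 : ℝ)..x, (q t : ℂ) * harm a (2 * p) t‖ ≤ R := by
    intro x hx
    refine le_trans (le_of_eq ?_) (hR x hx)
    rw [← RCLike.norm_conj, ← intervalIntegral.intervalIntegral_conj]
    simp only [map_mul, Complex.conj_ofReal, conj_harm]
  refine ⟨hc, h2, fun x hx => ?_⟩
  unfold osc
  rw [intervalIntegral.integral_sub ((intervalIntegrable_ofReal hq 0 x).mul_continuousOn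
    (continuous_harm (2 * p)).continuousOn) intervalIntegrable_const,
    intervalIntegral.integral_const]
  refine (norm_sub_le _ _).trans ?_
  rw [two_mul R]
  refine add_le_add (h2 x hx) ?_
  rw [sub_zero, Complex.real_smul, norm_mul, Complex.norm_real, Real.norm_of_nonneg hx.1,
    coeff_neg, RCLike.norm_conj]
  calc x * ‖coeff q a (2 * p)‖ ≤ a * (R / a) := by
        have := hx.2
        gcongr
    _ = R := by field_simp

/-- Closed form of the response `G`: the partial fractions of `1 / (p² - k²)` turn it into
zero-mean primitives of `q` and of `osc`, modulated by `e^{±iκx}`. The last term corrects the mode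
`k = -p`, at which `gseq` is `0`. -/
lemma trig_gseq_eq (ha : 0 < a) (hq : LocallyIntegrable q volume)
    (hper : Function.Periodic q a) (h0 : coeff q a 0 = 0) {p : ℕ} (hp : 0 < p) (x : ℝ) :
    trig a (gseq q a p) x =
      (1 / (2 * Complex.I * ((2 * Real.pi / a * p : ℝ) : ℂ))) *
        (prim a (fun t => (q t : ℂ)) x * harm a p x - prim a (osc q a p) x * harm a (-p) x) -
      coeff q a (-(2 * p)) / (4 * ((2 * Real.pi / a * p : ℝ) : ℂ) ^ 2) * harm a (-p) x := by
  have hπ := Real.pi_pos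
  have ha' : (a : ℂ) ≠ 0 := by exact_mod_cast ha.ne'
  have hπ' : (Real.pi : ℂ) ≠ 0 := by exact_mod_cast hπ.ne'
  have hp' : (p : ℂ) ≠ 0 := by exact_mod_cast hp.ne'
  have hqi : ∀ x z, IntervalIntegrable (fun t => (q t : ℂ)) volume x z :=
    intervalIntegrable_ofReal hq
  have hq0 : ∫ t in (0 : ℝ)..a, (q t : ℂ) = 0 := by
    have := h0
    rw [coeff_eq_fc] at this
    simpa [fc, ha'] using this
  have hqp : Function.Periodic (fun t => (q t : ℂ)) a := fun t => by simp only [hper t]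
  have hoi := osc_intervalIntegrable (a := a) hq p
  have ho0 := integral_osc ha hq p
  have hop : Function.Periodic (osc q a p) a := fun t => by
    simp only [osc, hper t, harm_periodic (2 * (p : ℤ)) t]
  set κ : ℂ := ((2 * Real.pi / a * p : ℝ) : ℂ) with hκ
  have hκ0 : κ ≠ 0 := by
    rw [hκ]; exact_mod_cast (by positivity : (2 * Real.pi / a * p : ℝ) ≠ 0)
  set G : ℝ → ℂ := fun x => (1 / (2 * Complex.I * κ)) *
        (prim a (fun t => (q t : ℂ)) x * harm a p x - prim a (osc q a p) x * harm a (-p) x) -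
      coeff q a (-(2 * p)) / (4 * κ ^ 2) * harm a (-p) x with hG
  have c1 : Continuous (prim a (fun t => (q t : ℂ))) := continuous_prim hqi
  have c2 : Continuous (prim a (osc q a p)) := continuous_prim hoi
  have hGc : Continuous G := by fun_prop
  have hGp : Function.Periodic G a := fun x => by
    simp only [hG, prim_periodic hqi hqp hq0 x, prim_periodic hoi hop ho0 x, harm_periodic _ x]
  have hGfc : fc a G = gseq q a p := by
    ext k
    have e1 : fc a (fun x => harm a (-p) x) k = if k + p = 0 then 1 else 0 := by
      have := fc_mul_harm (a := a) (fun _ => 1) (-(p : ℤ)) k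
      simp only [one_mul, fc_one ha, sub_neg_eq_add] at this
      exact this
    rw [hG, fc_sub (Continuous.intervalIntegrable (by fun_prop) _ _)
      (Continuous.intervalIntegrable (by fun_prop) _ _), fc_const_mul, fc_const_mul,
      fc_sub (Continuous.intervalIntegrable (by fun_prop) _ _)
      (Continuous.intervalIntegrable (by fun_prop) _ _), fc_mul_harm, fc_mul_harm,
      fc_prim ha hqi hq0, fc_prim ha hoi ho0, ← coeff_eq_fc, e1, sub_neg_eq_add, gseq]
    by_cases hk1 : k = p
    · have hk : k + p ≠ 0 := by omega
      rw [fc_osc ha hq p hk, hk1, if_neg (by omega), show ((p : ℤ) + p - 2 * p) = 0 by ring, h0]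
      simp
    by_cases hk2 : k + p = 0
    · have hk3 : k = -p := by omega
      rw [if_pos hk2, hk2, hk3, show (-(p : ℤ) - p) = -(2 * p) by ring]
      have hI := Complex.I_sq
      rw [hκ]
      push_cast
      simp only [mul_zero, div_zero, sub_zero, even_two, Even.neg_pow, sub_self]
      field_simp
      rw [hI]
      ring
    · rw [fc_osc ha hq p hk2, if_neg hk2, show k + p - 2 * p = k - (p : ℤ) by ring]
      have h1 : ((k : ℂ) - p) ≠ 0 := by
        rw [sub_ne_zero]; exact_mod_cast hk1
      have h2 : ((k : ℂ) + p) ≠ 0 := by exact_mod_cast hk2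
      have h3 : ((p : ℂ) ^ 2 - (k : ℂ) ^ 2) ≠ 0 := by
        rw [show ((p : ℂ) ^ 2 - (k : ℂ) ^ 2) = -((k - p) * (k + p)) by ring]
        exact neg_ne_zero.mpr (mul_ne_zero h1 h2)
      have hI := Complex.I_sq
      rw [hκ]
      push_cast
      rw [show ((p : ℂ) ^ 2 - (k : ℂ) ^ 2) = -((k - p) * (k + p)) by ring]
      field_simp
      rw [hI]
      ring
  have hsum := summable_gseq (q := q) ha hp
  have := hasSum_fc ha hGc hGp (by rw [hGfc]; exact hsum.of_norm) x
  rw [hGfc] at this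
  exact this.tsum_eq

/-- `q W` is half the derivative of `W²` for the periodic primitive `W` of `q`. -/
lemma integral_mul_prim_self (ha : 0 < a) (hq : LocallyIntegrable q volume)
    (h0 : coeff q a 0 = 0) : ∫ t in (0 : ℝ)..a, (q t : ℂ) * prim a (fun t => (q t : ℂ)) t = 0 := by
  have ha' : (a : ℂ) ≠ 0 := by exact_mod_cast ha.ne'
  have hqi := intervalIntegrable_ofReal hq 0 a
  have hq0 : ∫ t in (0 : ℝ)..a, (q t : ℂ) = 0 := by
    have := h0
    rw [coeff_eq_fc] at this
    simpa [fc, ha'] using this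
  have h := integral_primitive_mul ha.le hqi hqi
    (fun t _ => prim_eq (a := a) (f := fun t => (q t : ℂ)) t)
    (fun t _ => prim_eq (a := a) (f := fun t => (q t : ℂ)) t)
  have h3 : prim a (fun t => (q t : ℂ)) a = prim a (fun t => (q t : ℂ)) 0 := by
    rw [prim_eq, hq0, add_zero]
  have h4 : ∫ t in (0 : ℝ)..a, prim a (fun t => (q t : ℂ)) t * (q t : ℂ) =
      ∫ t in (0 : ℝ)..a, (q t : ℂ) * prim a (fun t => (q t : ℂ)) t := by
    simp only [mul_comm]
  rw [h3, h4, sub_self, zero_sub] at h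
  have h5 : (2 : ℂ) * ∫ t in (0 : ℝ)..a, (q t : ℂ) * prim a (fun t => (q t : ℂ)) t = 0 := by
    linear_combination h
  exact (mul_eq_zero.mp h5).resolve_left two_ne_zero

/-- The integral of `W q e^{2iκx}` is of the order of `R`, by integrating the oscillating factor. -/
lemma norm_integral_harm_prim_le (ha : 0 < a) (hq : LocallyIntegrable q volume) {p : ℕ} {R : ℝ}
    (hR : ∀ x ∈ Set.Icc 0 a, ‖∫ t in (0 : ℝ)..x, (q t : ℂ) * harm a (2 * p) t‖ ≤ R) :
    ‖∫ t in (0 : ℝ)..a, prim a (fun t => (q t : ℂ)) t * ((q t : ℂ) * harm a (2 * p) t)‖ ≤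
      3 * (∫ t in (0 : ℝ)..a, ‖(q t : ℂ)‖) * R := by
  have hqi := intervalIntegrable_ofReal hq 0 a
  have hgi : IntervalIntegrable (fun t => (q t : ℂ) * harm a (2 * p) t) volume 0 a :=
    hqi.mul_continuousOn (continuous_harm (2 * p)).continuousOn
  rw [integral_primitive_mul ha.le hqi hgi
    (fun t _ => prim_eq (a := a) (f := fun t => (q t : ℂ)) t)
    (G := fun x => ∫ t in (0 : ℝ)..x, (q t : ℂ) * harm a (2 * p) t) (fun t _ => by simp)]
  simp only [intervalIntegral.integral_same, mul_zero, sub_zero]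
  have h1 := norm_prim_le (f := fun t => (q t : ℂ)) ha
    (fun x hx => norm_integral_le_total hqi hx) a ⟨ha.le, le_rfl⟩
  have h2 := hR a ⟨ha.le, le_rfl⟩
  have h3 := norm_integral_mul_le ha hqi hR
  refine (norm_sub_le _ _).trans ?_
  rw [norm_mul]
  have hA : 0 ≤ ∫ t in (0 : ℝ)..a, ‖(q t : ℂ)‖ :=
    intervalIntegral.integral_nonneg ha.le fun t _ => norm_nonneg _
  calc _ ≤ 2 * (∫ t in (0 : ℝ)..a, ‖(q t : ℂ)‖) * R + (∫ t in (0 : ℝ)..a, ‖(q t : ℂ)‖) * R := by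
        gcongr
    _ = _ := by ring

/-- The Fourier coefficients of `q G`, from the closed form of `G`. -/
lemma fc_mul_trig_gseq (ha : 0 < a) (hq : LocallyIntegrable q volume)
    (hper : Function.Periodic q a) (h0 : coeff q a 0 = 0) {p : ℕ} (hp : 0 < p) (k : ℤ) :
    fc a (fun t => (q t : ℂ) * trig a (gseq q a p) t) k =
      (1 / (2 * Complex.I * ((2 * Real.pi / a * p : ℝ) : ℂ))) *
        (fc a (fun t => (q t : ℂ) * prim a (fun t => (q t : ℂ)) t) (k - p) -
          fc a (fun t => (q t : ℂ) * prim a (osc q a p) t) (k + p)) -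
      coeff q a (-(2 * p)) / (4 * ((2 * Real.pi / a * p : ℝ) : ℂ) ^ 2) * coeff q a (k + p) := by
  have hqi := intervalIntegrable_ofReal hq
  have c1 : Continuous (prim a (fun t => (q t : ℂ))) := continuous_prim hqi
  have c2 : Continuous (prim a (osc q a p)) := continuous_prim (osc_intervalIntegrable hq p)
  have e : (fun t => (q t : ℂ) * trig a (gseq q a p) t) = fun t =>
      (1 / (2 * Complex.I * ((2 * Real.pi / a * p : ℝ) : ℂ))) *
        ((q t : ℂ) * prim a (fun t => (q t : ℂ)) t * harm a p t -
          (q t : ℂ) * prim a (osc q a p) t * harm a (-p) t) -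
      coeff q a (-(2 * p)) / (4 * ((2 * Real.pi / a * p : ℝ) : ℂ) ^ 2) *
        ((q t : ℂ) * harm a (-p) t) := by
    ext t
    rw [trig_gseq_eq ha hq hper h0 hp]; ring
  have i1 : IntervalIntegrable (fun t => (q t : ℂ) * prim a (fun t => (q t : ℂ)) t * harm a p t)
      volume 0 a := ((hqi 0 a).mul_continuousOn c1.continuousOn).mul_continuousOn
        (continuous_harm _).continuousOn
  have i2 : IntervalIntegrable (fun t => (q t : ℂ) * prim a (osc q a p) t * harm a (-p) t)
      volume 0 a := ((hqi 0 a).mul_continuousOn c2.continuousOn).mul_continuousOn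
        (continuous_harm _).continuousOn
  have i3 : IntervalIntegrable (fun t => (q t : ℂ) * harm a (-p) t) volume 0 a :=
    (hqi 0 a).mul_continuousOn (continuous_harm _).continuousOn
  rw [e, fc_sub ((i1.sub i2).const_mul _) (i3.const_mul _), fc_const_mul, fc_const_mul,
    fc_sub i1 i2, fc_mul_harm, fc_mul_harm, fc_mul_harm, sub_neg_eq_add, coeff_eq_fc, coeff_eq_fc]

/-- The response satisfies `G = O(1/p)` uniformly, and the resonant coefficients of `q G` are
`O(R/p)`. The gain of the factor `R` comes from `∫ q W = 0` at `k = p` and from integration by parts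
against `q e^{±2iκx}` elsewhere. -/
lemma exists_resolvent_bounds (ha : 0 < a) (hq : LocallyIntegrable q volume)
    (hper : Function.Periodic q a) (h0 : coeff q a 0 = 0) :
    ∃ C : ℝ, 0 < C ∧ ∀ p : ℕ, 0 < p → ∀ R : ℝ, R ≤ (∫ t in (0 : ℝ)..a, ‖(q t : ℂ)‖) →
      (∀ x ∈ Set.Icc 0 a, ‖∫ t in (0 : ℝ)..x, (q t : ℂ) * harm a (-(2 * p)) t‖ ≤ R) →
      (∀ x ∈ Set.Icc 0 a, ‖trig a (gseq q a p) x‖ ≤ C / p) ∧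
      ‖fc a (fun t => (q t : ℂ) * trig a (gseq q a p) t) p‖ ≤ C * R / p ∧
      ‖fc a (fun t => (q t : ℂ) * trig a (gseq q a p) t) (-p)‖ ≤ C * R / p := by
  set A := ∫ t in (0 : ℝ)..a, ‖(q t : ℂ)‖ with hA
  have hA0 : 0 ≤ A := intervalIntegral.integral_nonneg ha.le fun t _ => norm_nonneg _
  have hw : 0 < 2 * Real.pi / a := by have := Real.pi_pos; positivity
  set w := 2 * Real.pi / a with hwdef
  have hqm : qmean q a = 1 / a * A := rfl
  have hqm0 : 0 ≤ qmean q a := qmean_nonneg ha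
  refine ⟨1 / (2 * w) * (6 * A) + qmean q a / (4 * w ^ 2) + 1 / (2 * w) * (7 * (1 / a * A)) +
    1 / a * qmean q a / (4 * w ^ 2) + 1, by positivity, fun p hp R hRA hR => ?_⟩
  have hp' : (1 : ℝ) ≤ p := by exact_mod_cast hp
  have hp0 : (0 : ℝ) < p := by linarith
  have hqi := intervalIntegrable_ofReal hq 0 a
  obtain ⟨hc, hR2, hosc⟩ := norm_osc_integral_le ha hq hR
  have hR0 : 0 ≤ R := (norm_nonneg _).trans (hR 0 ⟨le_rfl, ha.le⟩)
  have hW := norm_prim_le (f := fun t => (q t : ℂ)) ha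
    (fun x hx => norm_integral_le_total hqi hx)
  have hQ := norm_prim_le (f := osc q a p) ha hosc
  have n1 : ‖1 / (2 * Complex.I * ((w * p : ℝ) : ℂ))‖ = 1 / (2 * w) / p := by
    rw [norm_div, norm_mul, norm_mul, Complex.norm_I, Complex.norm_real,
      Real.norm_of_nonneg (by positivity), norm_one, Complex.norm_ofNat]
    field_simp
  have n2 : ∀ z : ℂ, ‖z / (4 * ((w * p : ℝ) : ℂ) ^ 2)‖ ≤ ‖z‖ / (4 * w ^ 2) / p := by
    intro z
    rw [norm_div, norm_mul, norm_pow, Complex.norm_real, Real.norm_of_nonneg (by positivity),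
      Complex.norm_ofNat, div_div]
    have : 4 * w ^ 2 * (p : ℝ) ≤ 4 * (w * p) ^ 2 := by
      rw [mul_pow, ← mul_assoc]
      gcongr
      nlinarith
    gcongr
  have hcneg : ‖coeff q a (-(2 * p))‖ ≤ R / a := by rw [coeff_neg, RCLike.norm_conj]; exact hc
  refine ⟨fun x hx => ?_, ?_, ?_⟩
  · rw [trig_gseq_eq ha hq hper h0 hp]
    have b1 : ‖prim a (fun t => (q t : ℂ)) x * harm a p x - prim a (osc q a p) x * harm a (-p) x‖ ≤
        6 * A := by
      refine (norm_sub_le _ _).trans ?_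
      rw [norm_mul, norm_mul, norm_harm, norm_harm, mul_one, mul_one]
      linarith [hW x hx, hQ x hx]
    have b2 := n2 (coeff q a (-(2 * p)))
    have b3 := norm_coeff_le (q := q) ha (-(2 * p))
    refine (norm_sub_le _ _).trans ?_
    rw [norm_mul, norm_mul, norm_harm, mul_one, n1]
    calc _ ≤ 1 / (2 * w) / p * (6 * A) + qmean q a / (4 * w ^ 2) / p := by
          gcongr
          exact b2.trans (by gcongr)
      _ = (1 / (2 * w) * (6 * A) + qmean q a / (4 * w ^ 2)) / p := by ring
      _ ≤ _ := by
          refine div_le_div_of_nonneg_right ?_ hp0.le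
          have : 0 ≤ 1 / (2 * w) * (7 * (1 / a * A)) := by positivity
          have : 0 ≤ 1 / a * qmean q a / (4 * w ^ 2) := by positivity
          linarith
  · rw [fc_mul_trig_gseq ha hq hper h0 hp, sub_self]
    have e0 : fc a (fun t => (q t : ℂ) * prim a (fun t => (q t : ℂ)) t) 0 = 0 := by
      rw [fc, neg_zero]
      simp only [harm_zero, mul_one, integral_mul_prim_self ha hq h0, mul_zero]
    have b1 := norm_fc_mul_le ha hqi hQ (p + p)
    have b2 := n2 (coeff q a (-(2 * p)))
    have b3 := norm_coeff_le (q := q) ha (p + p)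
    rw [e0, zero_sub]
    refine (norm_sub_le _ _).trans ?_
    rw [norm_mul, norm_mul, norm_neg, n1]
    calc _ ≤ 1 / (2 * w) / p * ((1 / a * A) * (2 * (2 * R))) +
          (R / a) / (4 * w ^ 2) / p * qmean q a := by
          gcongr
          exact b2.trans (by gcongr)
      _ = (1 / (2 * w) * (4 * (1 / a * A)) + 1 / a * qmean q a / (4 * w ^ 2)) * R / p := by ring
      _ ≤ _ := by
          refine div_le_div_of_nonneg_right (mul_le_mul_of_nonneg_right ?_ hR0) hp0.le
          have h1 : 0 ≤ 1 / (2 * w) * (6 * A) := by positivity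
          have h2 : 0 ≤ qmean q a / (4 * w ^ 2) := by positivity
          have h3 : 1 / (2 * w) * (4 * (1 / a * A)) ≤ 1 / (2 * w) * (7 * (1 / a * A)) := by
            gcongr; norm_num
          linarith
  · rw [fc_mul_trig_gseq ha hq hper h0 hp, neg_add_cancel, h0, mul_zero, sub_zero]
    have b1 := norm_fc_mul_le ha hqi hQ 0
    have b2 : ‖fc a (fun t => (q t : ℂ) * prim a (fun t => (q t : ℂ)) t) (-p - p)‖ ≤
        1 / a * (3 * A * R) := by
      rw [fc, norm_mul, norm_div, norm_one, Complex.norm_real, Real.norm_of_nonneg ha.le]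
      gcongr
      refine le_trans (le_of_eq ?_) (norm_integral_harm_prim_le ha hq hR2)
      congr 1
      refine intervalIntegral.integral_congr fun t _ => ?_
      rw [show -(-(p : ℤ) - p) = 2 * p by ring]
      ring
    rw [norm_mul, n1]
    calc _ ≤ 1 / (2 * w) / p * (1 / a * (3 * A * R) + (1 / a * A) * (2 * (2 * R))) := by
          gcongr
          exact (norm_sub_le _ _).trans (add_le_add b2 b1)
      _ = (1 / (2 * w) * (7 * (1 / a * A))) * R / p := by ring
      _ ≤ _ := by
          refine div_le_div_of_nonneg_right (mul_le_mul_of_nonneg_right ?_ hR0) hp0.le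
          have h1 : 0 ≤ 1 / (2 * w) * (6 * A) := by positivity
          have h2 : 0 ≤ qmean q a / (4 * w ^ 2) := by positivity
          have h3 : 0 ≤ 1 / a * qmean q a / (4 * w ^ 2) := by positivity
          linarith

end Resolvent

/-! ### Non-resonant modes in a window -/

section Window

variable {a : ℝ} {q : ℝ → ℝ}

/-- In the window around `(w p)²` a non-resonant mode is at a distance from `ν` comparable to its
distance from `(w p)²`. -/
lemma gap_le {w ν : ℝ} {p : ℕ} (hp : 0 < p) (h1 : w ^ 2 * ((p : ℝ) - 1 / 2) ^ 2 ≤ ν)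
    (h2 : ν ≤ w ^ 2 * ((p : ℝ) + 1 / 2) ^ 2) {k : ℤ} (hk1 : k ≠ p) (hk2 : k ≠ -p) :
    w ^ 2 / 4 * |(k : ℝ) ^ 2 - (p : ℝ) ^ 2| ≤ |ν - (w * k) ^ 2| := by
  have hp1 : (1 : ℝ) ≤ p := by exact_mod_cast hp
  have hw := sq_nonneg w
  have hcase : ((p : ℤ) + 1) ^ 2 ≤ k ^ 2 ∨ k ^ 2 ≤ ((p : ℤ) - 1) ^ 2 := by
    rcases le_or_gt ((p : ℤ) + 1) |k| with h | h
    · left; rw [sq_le_sq, abs_of_nonneg (by positivity : (0 : ℤ) ≤ p + 1)]; exact h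
    · right
      rw [sq_le_sq, abs_of_nonneg (by omega : (0 : ℤ) ≤ p - 1)]
      rcases abs_cases k with h3 | h3 <;> omega
  rcases hcase with h | h
  · have h' : ((p : ℝ) + 1) ^ 2 ≤ (k : ℝ) ^ 2 := by exact_mod_cast h
    rw [abs_of_nonneg (by nlinarith), abs_sub_comm]
    refine le_trans ?_ (le_abs_self _)
    have : w ^ 2 * (((p : ℝ) + 1 / 2) ^ 2 + ((k : ℝ) ^ 2 - (p : ℝ) ^ 2) / 4) ≤ w ^ 2 * (k : ℝ) ^ 2 := by
      gcongr
      nlinarith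
    nlinarith
  · have h' : (k : ℝ) ^ 2 ≤ ((p : ℝ) - 1) ^ 2 := by exact_mod_cast h
    rw [abs_of_nonpos (by nlinarith)]
    refine le_trans ?_ (le_abs_self _)
    have : w ^ 2 * ((k : ℝ) ^ 2 + ((p : ℝ) ^ 2 - (k : ℝ) ^ 2) / 4) ≤ w ^ 2 * ((p : ℝ) - 1 / 2) ^ 2 := by
      gcongr
      nlinarith
    nlinarith

/-- The sequence `y` without its resonant modes `±p`. -/
def rest (p : ℕ) (y : ℤ → ℂ) (k : ℤ) : ℂ := if k = p ∨ k = -p then 0 else y k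

lemma tsum_split {E : Type*} [NormedAddCommGroup E] [CompleteSpace E] {f : ℤ → E}
    (hf : Summable f) {p : ℕ} (hp : 0 < p) :
    ∑' k, f k = f p + f (-p) + ∑' k : ℤ, if k = p ∨ k = -p then 0 else f k := by
  have hs : Summable fun k : ℤ => if k = (p : ℤ) then 0 else f k := by
    refine (hf.sub (hasSum_ite_eq (p : ℤ) (f p)).summable).congr fun k => ?_
    split_ifs with h
    · rw [h, sub_self]
    · rw [sub_zero]
  rw [hf.tsum_eq_add_tsum_ite (p : ℤ), hs.tsum_eq_add_tsum_ite (-(p : ℤ)),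
    if_neg (by omega), add_assoc]
  congr 2
  refine tsum_congr fun k => ?_
  by_cases h1 : k = p <;> by_cases h2 : k = -p <;> simp [h1, h2]

lemma norm_rest_le (p : ℕ) (y : ℤ → ℂ) (k : ℤ) : ‖rest p y k‖ ≤ ‖y k‖ := by
  unfold rest; split_ifs <;> simp

lemma summable_rest {y : ℤ → ℂ} (hy : Summable fun k => ‖y k‖) (p : ℕ) :
    Summable fun k => ‖rest p y k‖ :=
  Summable.of_nonneg_of_le (fun _ => norm_nonneg _) (norm_rest_le p y) hy

lemma tsum_norm_eq {y : ℤ → ℂ} (hy : Summable fun k => ‖y k‖) {p : ℕ} (hp : 0 < p) :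
    ∑' k, ‖y k‖ = ‖y p‖ + ‖y (-p)‖ + ∑' k, ‖rest p y k‖ := by
  rw [tsum_split hy hp]
  congr 1
  refine tsum_congr fun k => ?_
  unfold rest; split_ifs <;> simp

lemma norm_conv_le {c : ℤ → ℂ} {B : ℝ} (hB : ∀ k, ‖c k‖ ≤ B) {y : ℤ → ℂ}
    (hy : Summable fun k => ‖y k‖) (k : ℤ) : ‖∑' j, c (k - j) * y j‖ ≤ B * ∑' j, ‖y j‖ := by
  rw [← tsum_mul_left]
  refine tsum_of_norm_bounded (hy.mul_left B).hasSum fun j => ?_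
  rw [norm_mul]
  exact mul_le_mul_of_nonneg_right (hB _) (norm_nonneg _)

lemma summable_conv {c : ℤ → ℂ} {B : ℝ} (hB : ∀ k, ‖c k‖ ≤ B) {y : ℤ → ℂ}
    (hy : Summable fun k => ‖y k‖) (k : ℤ) : Summable fun j => c (k - j) * y j := by
  refine Summable.of_norm_bounded (hy.mul_left B) fun j => ?_
  rw [norm_mul]
  exact mul_le_mul_of_nonneg_right (hB _) (norm_nonneg _)

lemma conv_split {c : ℤ → ℂ} {B : ℝ} (hB : ∀ k, ‖c k‖ ≤ B) {y : ℤ → ℂ}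
    (hy : Summable fun k => ‖y k‖) {p : ℕ} (hp : 0 < p) (k : ℤ) :
    ∑' j, c (k - j) * y j = c (k - p) * y p + c (k + p) * y (-p) +
      ∑' j, c (k - j) * rest p y j := by
  rw [tsum_split (summable_conv hB hy k) hp, sub_neg_eq_add]
  congr 1
  refine tsum_congr fun j => ?_
  unfold rest; split_ifs <;> simp

/-- The non-resonant modes of an eigensequence in the window are controlled by the two resonant
ones: first their sum is `O(p^{-1/2})`, which then gives the pointwise bound. -/
lemma exists_rest_bound {c : ℤ → ℂ} {w B : ℝ} (hw : 0 < w) (hB : ∀ k, ‖c k‖ ≤ B) :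
    ∃ C : ℝ, 0 < C ∧ ∀ᶠ p : ℕ in atTop, 0 < p ∧ ∀ (ν : ℝ) (y : ℤ → ℂ), IsEigSeq c w ν y →
      w ^ 2 * ((p : ℝ) - 1 / 2) ^ 2 ≤ ν → ν ≤ w ^ 2 * ((p : ℝ) + 1 / 2) ^ 2 →
      (∀ k, ‖rest p y k‖ ≤ C * (‖y p‖ + ‖y (-p)‖) * gapInv p k) ∧
      ∑' k, ‖rest p y k‖ ≤ C / √p * (‖y p‖ + ‖y (-p)‖) := by
  obtain ⟨Cg, hCg, hg⟩ := exists_gapInv_bounds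
  have hB0 : 0 ≤ B := (norm_nonneg _).trans (hB 0)
  have hlim : Tendsto (fun p : ℕ => B * (4 / w ^ 2) * Cg / √p) atTop (𝓝 0) :=
    tendsto_const_nhds.div_atTop (Real.tendsto_sqrt_atTop.comp tendsto_natCast_atTop_atTop)
  refine ⟨2 * (B * (4 / w ^ 2)) + 2 * (B * (4 / w ^ 2) * Cg) + 1, by positivity, ?_⟩
  filter_upwards [hlim.eventually (gt_mem_nhds (by norm_num : (0 : ℝ) < 1 / 2)),
    eventually_gt_atTop 0] with p hsmall hp
  refine ⟨hp, fun ν y hy h1 h2 => ?_⟩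
  have hp' : (0 : ℝ) < p := by exact_mod_cast hp
  set Y := ‖y p‖ + ‖y (-p)‖ with hY
  set N := ∑' k, ‖rest p y k‖ with hN
  have hY0 : 0 ≤ Y := by positivity
  have hN0 : 0 ≤ N := tsum_nonneg fun _ => norm_nonneg _
  have hr : ∀ k, ‖rest p y k‖ ≤ B * (4 / w ^ 2) * (Y + N) * gapInv p k := by
    intro k
    have hgn := gapInv_nonneg p k
    by_cases hk : k = p ∨ k = -p
    · rw [rest, if_pos hk, norm_zero]; positivity
    · rw [rest, if_neg hk]
      push Not at hk
      have hgap := gap_le hp h1 h2 hk.1 hk.2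
      have he := congrArg norm (hy.eq k)
      rw [norm_mul, Complex.norm_real, Real.norm_eq_abs] at he
      have hT := norm_conv_le hB hy.summable k
      rw [tsum_norm_eq hy.summable hp] at hT
      have hpos : 0 < |(k : ℝ) ^ 2 - (p : ℝ) ^ 2| := by
        rw [abs_pos, sub_ne_zero]
        intro h
        have h' : k ^ 2 = (p : ℤ) ^ 2 := by exact_mod_cast h
        rcases sq_eq_sq_iff_eq_or_eq_neg.mp h' with h | h
        · exact hk.1 h
        · exact hk.2 h
      rw [gapInv, mul_one_div, le_div_iff₀ hpos]
      have h3 : w ^ 2 / 4 * (‖y k‖ * |(k : ℝ) ^ 2 - (p : ℝ) ^ 2|) ≤ B * (Y + N) := by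
        calc _ = w ^ 2 / 4 * |(k : ℝ) ^ 2 - (p : ℝ) ^ 2| * ‖y k‖ := by ring
          _ ≤ |ν - (w * k) ^ 2| * ‖y k‖ := by gcongr
          _ ≤ B * (Y + N) := he ▸ hT
      calc ‖y k‖ * |(k : ℝ) ^ 2 - (p : ℝ) ^ 2| =
            4 / w ^ 2 * (w ^ 2 / 4 * (‖y k‖ * |(k : ℝ) ^ 2 - (p : ℝ) ^ 2|)) := by field_simp
        _ ≤ 4 / w ^ 2 * (B * (Y + N)) := by gcongr
        _ = _ := by ring
  obtain ⟨⟨gs, gb⟩, -⟩ := hg p hp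
  have hNle : N ≤ B * (4 / w ^ 2) * (Y + N) * (Cg / √p) := by
    refine (hasSum_le hr (summable_rest hy.summable p).hasSum (gs.mul_left _).hasSum).trans ?_
    rw [tsum_mul_left]
    gcongr
  have hNle' : N ≤ B * (4 / w ^ 2) * Cg / √p * (Y + N) := hNle.trans (le_of_eq (by ring))
  -- `N ≤ (Y + N) / 2` for large `p`
  have hNY : N ≤ Y := by
    have : B * (4 / w ^ 2) * Cg / √p * (Y + N) ≤ 1 / 2 * (Y + N) := by gcongr
    linarith
  refine ⟨fun k => (hr k).trans ?_, hNle.trans ?_⟩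
  · refine mul_le_mul_of_nonneg_right ?_ (gapInv_nonneg p k)
    calc B * (4 / w ^ 2) * (Y + N) ≤ B * (4 / w ^ 2) * (Y + Y) := by gcongr
      _ = 2 * (B * (4 / w ^ 2)) * Y := by ring
      _ ≤ _ := by
        have : 0 ≤ 2 * (B * (4 / w ^ 2) * Cg) := by positivity
        exact mul_le_mul_of_nonneg_right (by linarith) hY0
  · calc B * (4 / w ^ 2) * (Y + N) * (Cg / √p) ≤ B * (4 / w ^ 2) * (Y + Y) * (Cg / √p) := by gcongr
      _ = 2 * (B * (4 / w ^ 2) * Cg) / √p * Y := by ring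
      _ ≤ _ := by
        refine mul_le_mul_of_nonneg_right (div_le_div_of_nonneg_right ?_ (Real.sqrt_nonneg _)) hY0
        have : 0 ≤ 2 * (B * (4 / w ^ 2)) := by positivity
        linarith

/-- Complex conjugation of eigenfunctions, on the Fourier side; it exchanges the modes `±p`. -/
lemma IsEigSeq.conj_neg {c : ℤ → ℂ} (hherm : ∀ k, c (-k) = starRingEnd ℂ (c k)) {w ν : ℝ}
    {y : ℤ → ℂ} (hy : IsEigSeq c w ν y) : IsEigSeq c w ν fun k => starRingEnd ℂ (y (-k)) := by
  refine ⟨?_, fun k => ?_⟩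
  · simp only [RCLike.norm_conj]
    exact (Equiv.neg ℤ).summable_iff.mpr hy.summable
  · have h := congrArg (starRingEnd ℂ) (hy.eq (-k))
    rw [map_mul, Complex.conj_ofReal, Complex.conj_tsum] at h
    push_cast at h ⊢
    rw [mul_neg, neg_sq] at h
    rw [h, ← (Equiv.neg ℤ).tsum_eq]
    refine tsum_congr fun j => ?_
    rw [map_mul, ← hherm, Equiv.neg_apply]
    congr 2
    ring

end Window

/-! ### The resonant equations -/

section WindowEstimate

variable {a : ℝ} {q : ℝ → ℝ}

lemma trig_conj_neg (z : ℤ → ℂ) (x : ℝ) :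
    trig a (fun k => starRingEnd ℂ (z (-k))) x = starRingEnd ℂ (trig a z x) := by
  rw [trig, trig, Complex.conj_tsum, ← (Equiv.neg ℤ).tsum_eq]
  refine tsum_congr fun k => ?_
  rw [map_mul, conj_harm, Equiv.neg_apply, neg_neg]

lemma summable_norm_conj_neg {z : ℤ → ℂ} (hz : Summable fun k => ‖z k‖) :
    Summable fun k => ‖starRingEnd ℂ (z (-k))‖ := by
  simp only [RCLike.norm_conj]
  exact (Equiv.neg ℤ).summable_iff.mpr hz

lemma gseq_at_resonance (p : ℕ) : gseq q a p p = 0 ∧ gseq q a p (-p) = 0 := by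
  simp [gseq]

/-- The part of the non-resonant modes beyond their first-order response to the modes `±p`. -/
noncomputable def remainder (q : ℝ → ℝ) (a : ℝ) (p : ℕ) (y : ℤ → ℂ) (k : ℤ) : ℂ :=
  rest p y k - y p * gseq q a p k - y (-p) * starRingEnd ℂ (gseq q a p (-k))

/-- The Fourier coefficients of `q` times the non-resonant part. -/
noncomputable def restConv (q : ℝ → ℝ) (a : ℝ) (p : ℕ) (y : ℤ → ℂ) (k : ℤ) : ℂ :=
  ∑' j, coeff q a (k - j) * rest p y j

lemma summable_remainder (ha : 0 < a) {y : ℤ → ℂ} (hy : Summable fun k => ‖y k‖) {p : ℕ}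
    (hp : 0 < p) : Summable fun k => ‖remainder q a p y k‖ := by
  have hG := summable_gseq (q := q) ha hp
  exact (((summable_rest hy p).of_norm.sub (hG.of_norm.mul_left (y p))).sub
    ((summable_norm_conj_neg hG).of_norm.mul_left (y (-p)))).norm

/-- The eigenvalue equation away from the resonant modes, solved for the remainder. -/
lemma mul_remainder (ha : 0 < a) {ν : ℝ} {y : ℤ → ℂ}
    (hy : IsEigSeq (coeff q a) (2 * Real.pi / a) ν y) {p : ℕ} (hp : 0 < p) {k : ℤ}
    (hk1 : k ≠ p) (hk2 : k ≠ -p) :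
    remainder q a p y k =
      (((2 * Real.pi / a) ^ 2 * ((p : ℝ) ^ 2 - (k : ℝ) ^ 2) : ℝ) : ℂ)⁻¹ *
      (restConv q a p y k - ((ν - (2 * Real.pi / a * p) ^ 2 : ℝ) : ℂ) * rest p y k) := by
  have hπ := Real.pi_pos
  have h := hy.eq k
  rw [conv_split (norm_coeff_le ha) hy.summable hp] at h
  have hne : (((2 * Real.pi / a) ^ 2 * ((p : ℝ) ^ 2 - (k : ℝ) ^ 2) : ℝ) : ℂ) ≠ 0 := by
    have h2 : (p : ℝ) ^ 2 - (k : ℝ) ^ 2 ≠ 0 := by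
      rw [sub_ne_zero]
      intro h
      have h' : k ^ 2 = (p : ℤ) ^ 2 := by exact_mod_cast h.symm
      rcases sq_eq_sq_iff_eq_or_eq_neg.mp h' with h | h
      · exact hk1 h
      · exact hk2 h
    have : (2 * Real.pi / a) ^ 2 ≠ 0 := by positivity
    exact_mod_cast mul_ne_zero this h2
  have hr : rest p y k = y k := by rw [rest, if_neg (by tauto)]
  have hc : starRingEnd ℂ (gseq q a p (-k)) = coeff q a (k + p) /
      (((2 * Real.pi / a) ^ 2 * ((p : ℝ) ^ 2 - (k : ℝ) ^ 2) : ℝ) : ℂ) := by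
    rw [gseq, map_div₀, Complex.conj_ofReal, ← coeff_neg]
    push_cast
    rw [neg_sq]
    congr 2
    ring
  have h' : (((2 * Real.pi / a) ^ 2 * ((p : ℝ) ^ 2 - (k : ℝ) ^ 2) : ℝ) : ℂ) * y k =
      ((ν - (2 * Real.pi / a * k) ^ 2 : ℝ) : ℂ) * y k -
        ((ν - (2 * Real.pi / a * p) ^ 2 : ℝ) : ℂ) * y k := by
    push_cast; ring
  rw [h] at h'
  rw [remainder, hc, gseq, hr, eq_inv_mul_iff_mul_eq₀ hne, restConv, mul_sub, mul_sub, h',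
    mul_left_comm _ (y p), mul_left_comm _ (y (-p)), mul_div_cancel₀ _ hne, mul_div_cancel₀ _ hne]
  ring

lemma remainder_eq_zero {y : ℤ → ℂ} {p : ℕ} {k : ℤ} (hk : k = p ∨ k = -p) :
    remainder q a p y k = 0 := by
  have := gseq_at_resonance (q := q) (a := a) p
  rcases hk with rfl | rfl <;> simp [remainder, rest, this.1, this.2]

lemma norm_remainder_le (ha : 0 < a) {ν : ℝ} {y : ℤ → ℂ}
    (hy : IsEigSeq (coeff q a) (2 * Real.pi / a) ν y) {p : ℕ} (hp : 0 < p) (k : ℤ) :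
    ‖remainder q a p y k‖ ≤ 1 / (2 * Real.pi / a) ^ 2 * gapInv p k *
      (qmean q a * (∑' j, ‖rest p y j‖) + |ν - (2 * Real.pi / a * p) ^ 2| * ‖rest p y k‖) := by
  have hg := gapInv_nonneg p k
  have hq0 := qmean_nonneg (q := q) ha
  have hN : 0 ≤ ∑' j, ‖rest p y j‖ := tsum_nonneg fun _ => norm_nonneg _
  by_cases hk : k = p ∨ k = -p
  · rw [remainder_eq_zero hk, norm_zero]
    positivity
  · push Not at hk
    rw [mul_remainder ha hy hp hk.1 hk.2, norm_mul, norm_inv, norm_inv_gap]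
    refine mul_le_mul_of_nonneg_left ((norm_sub_le _ _).trans ?_) (by positivity)
    rw [norm_mul, Complex.norm_real, Real.norm_eq_abs]
    exact add_le_add_left (norm_conv_le (norm_coeff_le ha) (summable_rest hy.summable p) k) _

/-- The remainder enters the equation at `p` only through the response `G`. -/
lemma coeff_mul_remainder (ha : 0 < a) {ν : ℝ} {y : ℤ → ℂ}
    (hy : IsEigSeq (coeff q a) (2 * Real.pi / a) ν y) {p : ℕ} (hp : 0 < p) (j : ℤ) :
    coeff q a (p - j) * remainder q a p y j = starRingEnd ℂ (gseq q a p j) *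
      (restConv q a p y j - ((ν - (2 * Real.pi / a * p) ^ 2 : ℝ) : ℂ) * rest p y j) := by
  by_cases hk : j = p ∨ j = -p
  · have := gseq_at_resonance (q := q) (a := a) p
    rw [remainder_eq_zero hk]
    rcases hk with rfl | rfl <;> simp [this.1, this.2]
  · push Not at hk
    rw [mul_remainder ha hy hp hk.1 hk.2, gseq, map_div₀, Complex.conj_ofReal, ← coeff_neg,
      neg_sub]
    generalize (((2 * Real.pi / a) ^ 2 * ((p : ℝ) ^ 2 - (j : ℝ) ^ 2) : ℝ) : ℂ) = d
    ring

lemma restConv_eq_fc (hq : LocallyIntegrable q volume) {y : ℤ → ℂ}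
    (hy : Summable fun k => ‖y k‖) (p : ℕ) (k : ℤ) :
    restConv q a p y k = fc a (fun t => (q t : ℂ) * trig a (rest p y) t) k := by
  have := hasSum_fc_mul_trig (a := a) (intervalIntegrable_ofReal hq 0 a) (summable_rest hy p) k
  simp only [← coeff_eq_fc] at this
  exact this.tsum_eq

/-- The second-order term as an integral. Estimating it by sup norms instead of coefficientwise is
what gives `O(1/p²)`. -/
lemma hasSum_conj_gseq_mul_restConv (ha : 0 < a) (hq : LocallyIntegrable q volume) {y : ℤ → ℂ}
    (hy : Summable fun k => ‖y k‖) {p : ℕ} (hp : 0 < p) :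
    HasSum (fun j => starRingEnd ℂ (gseq q a p j) * restConv q a p y j)
      (fc a (fun t => (q t : ℂ) *
        (trig a (rest p y) t * starRingEnd ℂ (trig a (gseq q a p) t))) 0) := by
  have h := hasSum_fc_mul_trig (a := a) (f := fun t => (q t : ℂ) * trig a (rest p y) t)
    ((intervalIntegrable_ofReal hq 0 a).mul_continuousOn
      (continuous_trig (summable_rest hy p)).continuousOn)
    (summable_norm_conj_neg (summable_gseq (q := q) ha hp)) 0
  simp only [← restConv_eq_fc hq hy, trig_conj_neg, mul_assoc] at h
  rw [← (Equiv.neg ℤ).hasSum_iff] at h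
  convert! h using 1
  ext j
  simp only [Function.comp, Equiv.neg_apply, zero_sub, neg_neg]
  exact mul_comm _ _

lemma hasSum_coeff_mul_gseq (ha : 0 < a) (hq : LocallyIntegrable q volume) {p : ℕ} (hp : 0 < p)
    (k : ℤ) : HasSum (fun j => coeff q a (k - j) * gseq q a p j)
      (fc a (fun t => (q t : ℂ) * trig a (gseq q a p) t) k) := by
  have := hasSum_fc_mul_trig (a := a) (intervalIntegrable_ofReal hq 0 a)
    (summable_gseq (q := q) ha hp) k
  simpa only [← coeff_eq_fc] using this

lemma hasSum_coeff_mul_conj_gseq (ha : 0 < a) (hq : LocallyIntegrable q volume) {p : ℕ} (hp : 0 < p)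
    (k : ℤ) : HasSum (fun j => coeff q a (k - j) * starRingEnd ℂ (gseq q a p (-j)))
      (starRingEnd ℂ (fc a (fun t => (q t : ℂ) * trig a (gseq q a p) t) (-k))) := by
  have h := Complex.hasSum_conj'.mpr (hasSum_coeff_mul_gseq ha hq hp (-k))
  rw [← (Equiv.neg ℤ).hasSum_iff] at h
  convert! h using 1
  ext j
  simp only [Function.comp, Equiv.neg_apply, map_mul, ← coeff_neg]
  congr 2
  ring

/-- The contribution of the non-resonant modes to the equation at `p`: the response to `p`, the
response to `-p`, and a second-order term. -/
lemma restConv_decomp (ha : 0 < a) (hq : LocallyIntegrable q volume) {ν : ℝ} {y : ℤ → ℂ}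
    (hy : IsEigSeq (coeff q a) (2 * Real.pi / a) ν y) {p : ℕ} (hp : 0 < p) :
    restConv q a p y p =
      y p * fc a (fun t => (q t : ℂ) * trig a (gseq q a p) t) p +
      y (-p) * starRingEnd ℂ (fc a (fun t => (q t : ℂ) * trig a (gseq q a p) t) (-p)) +
      (fc a (fun t => (q t : ℂ) * (trig a (rest p y) t *
        starRingEnd ℂ (trig a (gseq q a p) t))) 0 -
      ((ν - (2 * Real.pi / a * p) ^ 2 : ℝ) : ℂ) *
        ∑' j, starRingEnd ℂ (gseq q a p j) * rest p y j) := by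
  have h1 := (hasSum_coeff_mul_gseq (q := q) ha hq hp p).mul_left (y p)
  have h2 := (hasSum_coeff_mul_conj_gseq (q := q) ha hq hp p).mul_left (y (-p))
  have hb : ∀ j, ‖starRingEnd ℂ (gseq q a p j)‖ ≤
      qmean q a / (2 * Real.pi / a) ^ 2 * gapInv p j := fun j => by
    rw [RCLike.norm_conj]; exact norm_gseq_le ha p j
  have h3 : Summable fun j => starRingEnd ℂ (gseq q a p j) * rest p y j := by
    have hG := summable_gseq (q := q) ha hp
    refine Summable.of_norm_bounded ((summable_rest hy.summable p).mul_left (∑' k, ‖gseq q a p k‖))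
      fun j => ?_
    rw [norm_mul, RCLike.norm_conj]
    exact mul_le_mul_of_nonneg_right (hG.le_tsum j fun _ _ => norm_nonneg _) (norm_nonneg _)
  have h4 := (hasSum_conj_gseq_mul_restConv ha hq hy.summable hp).sub
    (h3.hasSum.mul_left ((ν - (2 * Real.pi / a * p) ^ 2 : ℝ) : ℂ))
  have h5 := (h1.add h2).add h4
  rw [← h5.tsum_eq, restConv]
  refine tsum_congr fun j => ?_
  have h6 := coeff_mul_remainder ha hy hp j
  rw [mul_sub] at h6
  rw [mul_left_comm _ (starRingEnd ℂ (gseq q a p j)) (rest p y j), ← h6, remainder]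
  ring

lemma trig_rest_eq (ha : 0 < a) {y : ℤ → ℂ} (hy : Summable fun k => ‖y k‖) {p : ℕ}
    (hp : 0 < p) (x : ℝ) : trig a (rest p y) x =
      y p * trig a (gseq q a p) x + y (-p) * starRingEnd ℂ (trig a (gseq q a p) x) +
        trig a (remainder q a p y) x := by
  have hG := summable_gseq (q := q) ha hp
  have h1 := (summable_trig (a := a) hG x).hasSum.mul_left (y p)
  have h2 := (summable_trig (a := a) (summable_norm_conj_neg hG) x).hasSum.mul_left (y (-p))
  have h3 := (summable_trig (a := a) (summable_remainder (q := q) ha hy hp) x).hasSum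
  rw [← trig_conj_neg]
  refine Eq.trans (tsum_congr fun k => ?_) ((h1.add h2).add h3).tsum_eq
  rw [remainder]
  ring

/-- The non-resonant part of an eigenfunction in the window is `O(1/p)` uniformly on the period. -/
lemma exists_trig_rest_bound (ha : 0 < a) (hq : LocallyIntegrable q volume)
    (hper : Function.Periodic q a) (h0 : coeff q a 0 = 0) :
    ∃ C : ℝ, 0 < C ∧ ∀ᶠ p : ℕ in atTop, 0 < p ∧ ∀ (ν : ℝ) (y : ℤ → ℂ),
      IsEigSeq (coeff q a) (2 * Real.pi / a) ν y →
      (2 * Real.pi / a) ^ 2 * ((p : ℝ) - 1 / 2) ^ 2 ≤ ν →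
      ν ≤ (2 * Real.pi / a) ^ 2 * ((p : ℝ) + 1 / 2) ^ 2 →
      (∀ k, ‖rest p y k‖ ≤ C * (‖y p‖ + ‖y (-p)‖) * gapInv p k) ∧
      ∀ x ∈ Set.Icc 0 a, ‖trig a (rest p y) x‖ ≤ C * (‖y p‖ + ‖y (-p)‖) / p := by
  have hw : 0 < 2 * Real.pi / a := by have := Real.pi_pos; positivity
  obtain ⟨C1, hC1, h1⟩ := exists_rest_bound hw (norm_coeff_le (q := q) ha)
  obtain ⟨C2, hC2, h2⟩ := exists_resolvent_bounds ha hq hper h0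
  obtain ⟨Cg, hCg, hg⟩ := exists_gapInv_bounds
  have hB := qmean_nonneg (q := q) ha
  set w := 2 * Real.pi / a with hw_def
  set B := qmean q a
  set C3 := Cg * C1 * (B / w ^ 2 + 2) with hC3
  have hC3' : 0 < C3 := by positivity
  refine ⟨C1 + C2 + C3, by positivity, ?_⟩
  filter_upwards [h1] with p hp1
  obtain ⟨hp, h1⟩ := hp1
  refine ⟨hp, fun ν y hy hl hu => ?_⟩
  have hp' : (0 : ℝ) < p := by exact_mod_cast hp
  have hp1 : (1 : ℝ) ≤ p := by exact_mod_cast hp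
  obtain ⟨hr, hN⟩ := h1 ν y hy hl hu
  obtain ⟨⟨gs, gb⟩, ⟨gs2, gb2⟩⟩ := hg p hp
  set Y := ‖y p‖ + ‖y (-p)‖ with hY
  have hY0 : 0 ≤ Y := by positivity
  have hD : |ν - (w * p) ^ 2| ≤ 2 * w ^ 2 * p := by
    have := sq_nonneg w
    rw [abs_le]; constructor <;> nlinarith
  refine ⟨fun k => (hr k).trans ?_, fun x hx => ?_⟩
  · have := gapInv_nonneg p k
    exact mul_le_mul_of_nonneg_right (mul_le_mul_of_nonneg_right (by linarith) hY0) this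
  -- the remainder has two powers of `1/√p`: one from `∑ ‖rest‖` and one from `∑ gapInv`
  have hE : ∑' k, ‖remainder q a p y k‖ ≤ C3 * Y / p := by
    have hb : ∀ k, ‖remainder q a p y k‖ ≤
        1 / w ^ 2 * (B * (C1 / √p * Y)) * gapInv p k + 2 * p * (C1 * Y) * gapInv p k ^ 2 := by
      intro k
      have hgk := gapInv_nonneg p k
      refine (norm_remainder_le ha hy hp k).trans ?_
      calc _ ≤ 1 / w ^ 2 * gapInv p k * (B * (C1 / √p * Y) +
            2 * w ^ 2 * p * (C1 * Y * gapInv p k)) := by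
            have := hr k
            gcongr
        _ = _ := by field_simp
    refine (hasSum_le hb (summable_remainder ha hy.summable hp).hasSum
      ((gs.mul_left _).add (gs2.mul_left _)).hasSum).trans ?_
    rw [(gs.mul_left _).tsum_add (gs2.mul_left _), tsum_mul_left, tsum_mul_left]
    calc _ ≤ 1 / w ^ 2 * (B * (C1 / √p * Y)) * (Cg / √p) + 2 * p * (C1 * Y) * (Cg / p ^ 2) := by
          gcongr
      _ = 1 / w ^ 2 * B * C1 * Cg * Y / (√p * √p) + 2 * C1 * Cg * Y / p := by field_simp
      _ = C3 * Y / p := by rw [Real.mul_self_sqrt hp'.le, hC3]; field_simp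
  have hRex := (h2 p hp (∫ t in (0 : ℝ)..a, ‖(q t : ℂ)‖) le_rfl (fun x hx => by
    have := norm_integral_le_total (f := fun t => (q t : ℂ) * harm a (-(2 * p)) t)
      ((intervalIntegrable_ofReal hq 0 a).mul_continuousOn (continuous_harm _).continuousOn) hx
    simpa using this)).1 x hx
  rw [trig_rest_eq (q := q) ha hy.summable hp]
  calc _ ≤ ‖y p‖ * (C2 / p) + ‖y (-p)‖ * (C2 / p) + C3 * Y / p := by
        refine (norm_add₃_le).trans ?_
        rw [norm_mul, norm_mul, RCLike.norm_conj]
        gcongr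
        exact (norm_trig_le (summable_remainder ha hy.summable hp) x).trans hE
    _ = (C2 + C3) * Y / p := by rw [hY]; ring
    _ ≤ _ := by
      refine div_le_div_of_nonneg_right (mul_le_mul_of_nonneg_right (by linarith) hY0) hp'.le

/-- The equation at the mode `p`: up to a small error, `(ν - (w p)²) y_p = c_{2p} y_{-p}`. The term
with `|ν - (w p)²|` on the right is absorbed later, once this difference is known to be bounded. -/
lemma exists_window_bound (ha : 0 < a) (hq : LocallyIntegrable q volume)
    (hper : Function.Periodic q a) (h0 : coeff q a 0 = 0) :
    ∃ C : ℝ, 0 < C ∧ ∀ᶠ p : ℕ in atTop, 0 < p ∧ ∀ (ν : ℝ) (y : ℤ → ℂ),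
      IsEigSeq (coeff q a) (2 * Real.pi / a) ν y →
      (2 * Real.pi / a) ^ 2 * ((p : ℝ) - 1 / 2) ^ 2 ≤ ν →
      ν ≤ (2 * Real.pi / a) ^ 2 * ((p : ℝ) + 1 / 2) ^ 2 →
      (∀ k, ‖rest p y k‖ ≤ C * (‖y p‖ + ‖y (-p)‖) * gapInv p k) ∧
      ∀ R : ℝ, R ≤ (∫ t in (0 : ℝ)..a, ‖(q t : ℂ)‖) →
      (∀ x ∈ Set.Icc 0 a, ‖∫ t in (0 : ℝ)..x, (q t : ℂ) * harm a (-(2 * p)) t‖ ≤ R) →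
      ‖((ν - (2 * Real.pi / a * p) ^ 2 : ℝ) : ℂ) * y p - coeff q a (2 * p) * y (-p)‖ ≤
        C * (R / p + 1 / p ^ 2 + |ν - (2 * Real.pi / a * p) ^ 2| / p ^ 2) *
          (‖y p‖ + ‖y (-p)‖) := by
  have hw : 0 < 2 * Real.pi / a := by have := Real.pi_pos; positivity
  obtain ⟨C1, hC1, h1⟩ := exists_trig_rest_bound ha hq hper h0
  obtain ⟨C2, hC2, h2⟩ := exists_resolvent_bounds ha hq hper h0
  obtain ⟨Cg, hCg, hg⟩ := exists_gapInv_bounds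
  have hB := qmean_nonneg (q := q) ha
  set w := 2 * Real.pi / a with hw_def
  set B := qmean q a with hB_def
  set K1 := B * (C1 * C2) with hK1
  set K2 := B / w ^ 2 * (C1 * Cg) with hK2
  have hK1' : 0 ≤ K1 := by positivity
  have hK2' : 0 ≤ K2 := by positivity
  refine ⟨C1 + C2 + K1 + K2, by positivity, ?_⟩
  filter_upwards [h1] with p hp1
  obtain ⟨hp, h1⟩ := hp1
  refine ⟨hp, fun ν y hy hl hu => ?_⟩
  have hp' : (0 : ℝ) < p := by exact_mod_cast hp
  obtain ⟨hr, hrt⟩ := h1 ν y hy hl hu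
  obtain ⟨-, ⟨gs2, gb2⟩⟩ := hg p hp
  set Y := ‖y p‖ + ‖y (-p)‖ with hY
  have hY0 : 0 ≤ Y := by positivity
  refine ⟨fun k => (hr k).trans ?_, fun R hRq hR => ?_⟩
  · have := gapInv_nonneg p k
    exact mul_le_mul_of_nonneg_right (mul_le_mul_of_nonneg_right (by linarith) hY0) this
  have hR0 : 0 ≤ R := (norm_nonneg _).trans (hR 0 ⟨le_rfl, ha.le⟩)
  obtain ⟨g1, g2, g3⟩ := h2 p hp R hRq hR
  set D := ν - (w * p) ^ 2 with hD
  have e := hy.eq p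
  rw [conv_split (norm_coeff_le ha) hy.summable hp, sub_self, h0, zero_mul, zero_add] at e
  have e2 := restConv_decomp ha hq hy hp
  rw [restConv] at e2
  rw [e2, ← two_mul] at e
  have f1 : ‖fc a (fun t => (q t : ℂ) * (trig a (rest p y) t *
      starRingEnd ℂ (trig a (gseq q a p) t))) 0‖ ≤ K1 * (1 / p ^ 2) * Y := by
    refine (norm_fc_mul_le ha (intervalIntegrable_ofReal hq 0 a)
      (R := C1 * Y / p * (C2 / p)) (fun x hx => ?_) 0).trans (le_of_eq ?_)
    · rw [norm_mul, RCLike.norm_conj]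
      have := hrt x hx
      have := g1 x hx
      gcongr
    · rw [← qmean, ← hB_def, hK1]; field_simp
  have f2 : ‖∑' j, starRingEnd ℂ (gseq q a p j) * rest p y j‖ ≤ K2 * (1 / p ^ 2) * Y := by
    refine (tsum_of_norm_bounded (gs2.mul_left (B / w ^ 2 * (C1 * Y))).hasSum fun j => ?_).trans ?_
    · rw [norm_mul, RCLike.norm_conj]
      have hgj := gapInv_nonneg p j
      calc _ ≤ B / w ^ 2 * gapInv p j * (C1 * Y * gapInv p j) := by
            have := hr j
            have := norm_gseq_le (q := q) ha p j
            gcongr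
        _ = _ := by ring
    · rw [tsum_mul_left]
      calc _ ≤ B / w ^ 2 * (C1 * Y) * (Cg / p ^ 2) := by gcongr
        _ = _ := by rw [hK2]; field_simp
  have e3 : (D : ℂ) * y p - coeff q a (2 * p) * y (-p) =
      y p * fc a (fun t => (q t : ℂ) * trig a (gseq q a p) t) p +
      y (-p) * starRingEnd ℂ (fc a (fun t => (q t : ℂ) * trig a (gseq q a p) t) (-p)) +
      (fc a (fun t => (q t : ℂ) * (trig a (rest p y) t *
        starRingEnd ℂ (trig a (gseq q a p) t))) 0 -
      (D : ℂ) * ∑' j, starRingEnd ℂ (gseq q a p j) * rest p y j) := by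
    rw [sub_eq_iff_eq_add, add_comm]
    exact_mod_cast e
  rw [e3]
  calc _ ≤ ‖y p‖ * (C2 * R / p) + ‖y (-p)‖ * (C2 * R / p) +
        (K1 * (1 / p ^ 2) * Y + |D| * (K2 * (1 / p ^ 2) * Y)) := by
        refine (norm_add₃_le).trans ?_
        refine add_le_add (add_le_add ?_ ?_) ((norm_sub_le _ _).trans (add_le_add f1 ?_))
        · rw [norm_mul]; gcongr
        · rw [norm_mul, RCLike.norm_conj]; gcongr
        · rw [norm_mul, Complex.norm_real, Real.norm_eq_abs]; gcongr
    _ = (C2 * (R / p) + K1 * (1 / p ^ 2) + K2 * (|D| / p ^ 2)) * Y := by rw [hY]; ring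
    _ ≤ ((C1 + C2 + K1 + K2) * (R / p) + (C1 + C2 + K1 + K2) * (1 / p ^ 2) +
          (C1 + C2 + K1 + K2) * (|D| / p ^ 2)) * Y := by
        refine mul_le_mul_of_nonneg_right (add_le_add (add_le_add ?_ ?_) ?_) hY0 <;>
        exact mul_le_mul_of_nonneg_right (by linarith) (by positivity)
    _ = _ := by ring

end WindowEstimate

/-! ### Partial Fourier integrals and the function `ρ` -/

section Oscillation

variable {a : ℝ} {q : ℝ → ℝ}

/-- The supremum of the partial integrals of `q e^{-2π i n t / a}`; `ρ(m)` is its value at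
`n = 2 (m + 1)`. -/
noncomputable def supOsc (q : ℝ → ℝ) (a : ℝ) (n : ℤ) : ℝ :=
  ⨆ x : Set.Icc (0 : ℝ) a, ‖∫ t in (0 : ℝ)..(x : ℝ), (q t : ℂ) * harm a (-n) t‖

lemma rho_eq_supOsc (m : ℕ) : rho q a m = supOsc q a (2 * ((m + 1 : ℕ) : ℤ)) := by
  unfold rho supOsc
  refine iSup_congr fun x => ?_
  congr 2
  ext t
  rw [harm_neg_eq]
  congr 5
  push_cast
  ring

lemma intervalIntegrable_mul_harm (hq : LocallyIntegrable q volume) (n : ℤ) (x z : ℝ) :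
    IntervalIntegrable (fun t => (q t : ℂ) * harm a n t) volume x z :=
  (intervalIntegrable_ofReal hq x z).mul_continuousOn (continuous_harm _).continuousOn

lemma norm_integral_mul_harm_le (hq : LocallyIntegrable q volume) (n : ℤ) {x : ℝ}
    (hx : x ∈ Set.Icc 0 a) :
    ‖∫ t in (0 : ℝ)..x, (q t : ℂ) * harm a n t‖ ≤ ∫ t in (0 : ℝ)..a, ‖(q t : ℂ)‖ := by
  simpa using norm_integral_le_total (f := fun t => (q t : ℂ) * harm a n t)
    (intervalIntegrable_mul_harm hq n 0 a) hx

lemma supOsc_le (ha : 0 < a) {n : ℤ} {b : ℝ}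
    (h : ∀ x ∈ Set.Icc 0 a, ‖∫ t in (0 : ℝ)..x, (q t : ℂ) * harm a (-n) t‖ ≤ b) :
    supOsc q a n ≤ b := by
  have : Nonempty (Set.Icc (0 : ℝ) a) := ⟨⟨0, le_rfl, ha.le⟩⟩
  exact ciSup_le fun x => h x x.2

lemma le_supOsc (hq : LocallyIntegrable q volume) (n : ℤ) {x : ℝ} (hx : x ∈ Set.Icc 0 a) :
    ‖∫ t in (0 : ℝ)..x, (q t : ℂ) * harm a (-n) t‖ ≤ supOsc q a n :=
  le_ciSup (f := fun x : Set.Icc (0 : ℝ) a => ‖∫ t in (0 : ℝ)..(x : ℝ), (q t : ℂ) * harm a (-n) t‖)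
    ⟨_, Set.forall_mem_range.mpr fun z => norm_integral_mul_harm_le hq (-n) z.2⟩ ⟨x, hx⟩

lemma supOsc_nonneg (n : ℤ) : 0 ≤ supOsc q a n := Real.iSup_nonneg fun _ => norm_nonneg _

lemma norm_coeff_le_supOsc (ha : 0 < a) (hq : LocallyIntegrable q volume) (n : ℤ) :
    ‖coeff q a n‖ ≤ supOsc q a n / a := by
  rw [coeff_eq_fc, fc, norm_mul, norm_div, norm_one, Complex.norm_real, Real.norm_of_nonneg ha.le,
    one_div_mul_eq_div]
  gcongr
  exact le_supOsc hq n ⟨ha.le, le_rfl⟩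

/-- The Riemann–Lebesgue lemma, uniformly in the endpoint. -/
lemma tendsto_supOsc (ha : 0 < a) (hq : LocallyIntegrable q volume) :
    Tendsto (supOsc q a) cofinite (𝓝 0) := by
  have hqi := intervalIntegrable_ofReal hq
  -- for a fixed endpoint: the Riemann–Lebesgue lemma for an indicator times `q`
  have hpt : ∀ x ∈ Set.Icc 0 a, Tendsto (fun n : ℤ => ∫ t in (0 : ℝ)..x, (q t : ℂ) * harm a (-n) t)
      cofinite (𝓝 0) := by
    intro x hx
    have h := Real.tendsto_integral_exp_smul_cocompact (E := ℂ)
      (Set.indicator (Set.Ioc 0 x) fun t => (q t : ℂ))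
    have h2 : Tendsto (fun n : ℤ => (n : ℝ) * a⁻¹) cofinite (cocompact ℝ) :=
      (Homeomorph.mulRight₀ a⁻¹ (inv_ne_zero ha.ne')).isClosedEmbedding.tendsto_cocompact.comp
        Int.tendsto_coe_cofinite
    refine (h.comp h2).congr fun n => ?_
    rw [Function.comp, intervalIntegral.integral_of_le hx.1, ← integral_indicator measurableSet_Ioc]
    congr 1
    ext t
    simp only [Set.indicator_apply]
    split_ifs
    · rw [harm_neg_eq, mul_comm (q t : ℂ), Circle.smul_def, smul_eq_mul, Real.fourierChar_apply]
      congr 2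
      push_cast
      ring
    · simp
  have hcont : Continuous fun x => ∫ t in (0 : ℝ)..x, ‖(q t : ℂ)‖ :=
    intervalIntegral.continuous_primitive (fun x z => (hqi x z).norm) 0
  rw [Metric.tendsto_nhds]
  intro ε hε
  -- uniformly in the endpoint: compactness, and continuity of `x ↦ ∫₀ˣ |q|`
  have key : ∀ᶠ n : ℤ in cofinite, ∀ x ∈ Set.Icc 0 a,
      ‖∫ t in (0 : ℝ)..x, (q t : ℂ) * harm a (-n) t‖ ≤ ε / 2 := by
    refine isCompact_Icc.induction_on (p := fun s => ∀ᶠ n : ℤ in cofinite, ∀ x ∈ s,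
      ‖∫ t in (0 : ℝ)..x, (q t : ℂ) * harm a (-n) t‖ ≤ ε / 2) (by simp)
      (fun s t hst h => h.mono fun n hn x hx => hn x (hst hx))
      (fun s t hs ht => (hs.and ht).mono fun n hn x hx => hx.elim (hn.1 x) (hn.2 x)) ?_
    intro x hx
    refine ⟨{z | |(∫ t in (0 : ℝ)..z, ‖(q t : ℂ)‖) - ∫ t in (0 : ℝ)..x, ‖(q t : ℂ)‖| < ε / 4},
      mem_nhdsWithin_of_mem_nhds (hcont.continuousAt.eventually
        (Metric.ball_mem_nhds _ (by positivity : 0 < ε / 4))), ?_⟩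
    filter_upwards [(hpt x hx).eventually (Metric.ball_mem_nhds _ (by positivity : 0 < ε / 4))]
      with n hn z hz
    have h1 := intervalIntegrable_mul_harm (a := a) hq (-n)
    rw [dist_zero_right] at hn
    have h2 : ‖∫ t in x..z, (q t : ℂ) * harm a (-n) t‖ ≤ ε / 4 := by
      refine (intervalIntegral.norm_integral_le_abs_integral_norm).trans ?_
      simp only [norm_mul, norm_harm, mul_one]
      rw [← intervalIntegral.integral_interval_sub_left (hqi 0 z).norm (hqi 0 x).norm]
      exact le_of_lt hz
    rw [← intervalIntegral.integral_add_adjacent_intervals (h1 0 x) (h1 x z)]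
    refine (norm_add_le _ _).trans ?_
    linarith
  filter_upwards [key] with n hn
  rw [Real.dist_0_eq_abs, abs_of_nonneg (supOsc_nonneg n)]
  exact (supOsc_le ha hn).trans_lt (by linarith)

lemma tendsto_coeff (ha : 0 < a) (hq : LocallyIntegrable q volume) :
    Tendsto (coeff q a) cofinite (𝓝 0) := by
  have := (tendsto_supOsc ha hq).div_const a
  rw [zero_div] at this
  exact squeeze_zero_norm (norm_coeff_le_supOsc ha hq) this

/-- If `q` has a nonzero Fourier coefficient, then `ρ` is at least of the order `1/p`: integrating
`q e^{-2iκx} · e^{i(2κ - κ_k)x}` by parts expresses `c_k` through the partial integrals at the cost of a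
factor `O(p)`. Thus errors `O(1/p²)` are `O(ρ/p)`. -/
lemma exists_supOsc_ge (ha : 0 < a) (hq : LocallyIntegrable q volume) {k : ℤ}
    (hk : coeff q a k ≠ 0) : ∃ b : ℝ, 0 < b ∧ ∀ p : ℕ, 0 < p → b / p ≤ supOsc q a (2 * p) := by
  have hπ := Real.pi_pos
  set L := 1 / a + 2 * Real.pi / a * (|(k : ℝ)| + 2) with hL
  have hL' : 0 < L := by positivity
  refine ⟨‖coeff q a k‖ / L, by positivity, fun p hp => ?_⟩
  have hp' : (1 : ℝ) ≤ p := by exact_mod_cast hp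
  set S := supOsc q a (2 * p) with hS
  have hS0 : 0 ≤ S := supOsc_nonneg _
  set F : ℝ → ℂ := fun x => ∫ t in (0 : ℝ)..x, (q t : ℂ) * harm a (-(2 * p)) t with hF
  have hFle : ∀ x ∈ Set.Icc 0 a, ‖F x‖ ≤ S := fun x hx => le_supOsc hq _ hx
  have h := fc_of_primitive ha (intervalIntegrable_mul_harm (a := a) hq (-(2 * p)) 0 a) (F := F)
    (fun t _ => by simp [hF]) (k - 2 * p)
  rw [fc_mul_harm, ← coeff_eq_fc, show k - 2 * (p : ℤ) - -(2 * p) = k by ring] at h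
  have h1 : ‖fc a F (k - 2 * p)‖ ≤ S := by
    have := norm_fc_mul_le (f := fun _ => 1) ha intervalIntegrable_const hFle (k - 2 * p)
    simpa [ha.ne'] using this
  have h2 : ‖F a - F 0‖ ≤ S := by
    have := hFle a ⟨ha.le, le_rfl⟩
    simpa [hF] using this
  have h3 : |((k - 2 * p : ℤ) : ℝ)| ≤ |(k : ℝ)| + 2 * p := by
    push_cast
    refine (abs_sub _ _).trans (le_of_eq ?_)
    rw [abs_of_nonneg (by positivity : (0 : ℝ) ≤ 2 * p)]
  have h4 : ‖coeff q a k‖ ≤ S / a + 2 * Real.pi / a * (|(k : ℝ)| + 2 * p) * S := by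
    rw [h]
    refine (norm_add_le _ _).trans ?_
    have e : ‖Complex.I * ((2 * Real.pi / a : ℝ) * ((k - 2 * p : ℤ) : ℂ))‖ =
        2 * Real.pi / a * |((k - 2 * p : ℤ) : ℝ)| := by
      rw [norm_mul, Complex.norm_I, one_mul, norm_mul, Complex.norm_real,
        Real.norm_of_nonneg (by positivity), ← Complex.norm_intCast]
    rw [norm_div, norm_mul, e, Complex.norm_real, Real.norm_of_nonneg ha.le]
    gcongr
  rw [div_div, div_le_iff₀ (by positivity)]
  refine h4.trans ?_
  have h5 : 2 * Real.pi / a * (|(k : ℝ)| + 2 * p) * S ≤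
      2 * Real.pi / a * (|(k : ℝ)| * p + 2 * p) * S := by
    gcongr
    nlinarith [abs_nonneg (k : ℝ)]
  have h6 : S / a ≤ S / a * p := le_mul_of_one_le_right (by positivity) hp'
  calc _ ≤ S / a * p + 2 * Real.pi / a * (|(k : ℝ)| * p + 2 * p) * S := add_le_add h6 h5
    _ = _ := by rw [hL]; ring

/-- Each of the three conditions implies `c_{2p} ≠ 0` eventually and `ρ / p = o(|c_{2p}|)`, with
`p = m + 1`. The third one uses `ρ → 0`. -/
lemma eventually_supOsc_le_of_cond (ha : 0 < a) (hq : LocallyIntegrable q volume)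
    (hcond :
      ((∀ᶠ m : ℕ in atTop, coeff q a (2 * m + 2) ≠ 0) ∧
        Tendsto (fun m : ℕ => (rho q a m : ℂ) / ((m : ℂ) * coeff q a (2 * m + 2)))
          atTop (𝓝 0)) ∨
      (∃ C₁ C₂ : ℝ, 0 < C₁ ∧ C₁ < C₂ ∧ ∀ᶠ m : ℕ in atTop,
        C₁ < ‖coeff q a (2 * m + 2) / (rho q a m : ℂ)‖ ∧
        ‖coeff q a (2 * m + 2) / (rho q a m : ℂ)‖ < C₂) ∨
      (∃ ε : ℝ, 0 < ε ∧ ∀ᶠ m : ℕ in atTop, ε / (m : ℝ) < ‖coeff q a (2 * m + 2)‖))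
    {η : ℝ} (hη : 0 < η) : ∀ᶠ p : ℕ in atTop, coeff q a (2 * p) ≠ 0 ∧
      supOsc q a (2 * p) / p ≤ η * ‖coeff q a (2 * p)‖ := by
  have key : ∀ᶠ m : ℕ in atTop, coeff q a (2 * m + 2) ≠ 0 ∧
      rho q a m ≤ η * (m * ‖coeff q a (2 * m + 2)‖) := by
    rcases hcond with ⟨h1, h2⟩ | ⟨C₁, C₂, hC, -, h⟩ | ⟨ε, hε, h⟩
    · filter_upwards [h1, h2.eventually (Metric.ball_mem_nhds _ hη), eventually_gt_atTop 0]
        with m hm1 hm2 hm3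
      have hm3' : (0 : ℝ) < m := by exact_mod_cast hm3
      have hc := norm_pos_iff.mpr hm1
      refine ⟨hm1, ?_⟩
      rw [dist_zero_right, norm_div, norm_mul, Complex.norm_real, Complex.norm_natCast,
        div_lt_iff₀ (by positivity)] at hm2
      exact (Real.le_norm_self _).trans hm2.le
    · filter_upwards [h, eventually_ge_atTop ⌈1 / (C₁ * η)⌉₊] with m hm1 hm2
      have hm := hm1.1
      have hm2' : 1 / (C₁ * η) ≤ m := (Nat.le_ceil _).trans (by exact_mod_cast hm2)
      rw [norm_div, Complex.norm_real] at hm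
      have hr : 0 < ‖rho q a m‖ := by
        by_contra h0
        rw [le_antisymm (not_lt.mp h0) (norm_nonneg _), div_zero] at hm
        linarith
      rw [lt_div_iff₀ hr] at hm
      have hc : 0 < ‖coeff q a (2 * m + 2)‖ := lt_of_le_of_lt (by positivity) hm
      refine ⟨norm_pos_iff.mp hc, (Real.le_norm_self _).trans ?_⟩
      calc ‖rho q a m‖ = 1 / C₁ * (C₁ * ‖rho q a m‖) := by field_simp
        _ ≤ 1 / C₁ * ‖coeff q a (2 * m + 2)‖ := by gcongr
        _ = η * (1 / (C₁ * η) * ‖coeff q a (2 * m + 2)‖) := by field_simp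
        _ ≤ _ := by gcongr
    · have hinj : Tendsto (fun m : ℕ => 2 * ((m + 1 : ℕ) : ℤ)) atTop cofinite := by
        rw [← Nat.cofinite_eq_atTop]
        exact Function.Injective.tendsto_cofinite fun x y h => by
          have h' : 2 * ((x + 1 : ℕ) : ℤ) = 2 * ((y + 1 : ℕ) : ℤ) := h
          omega
      have hrho := (tendsto_supOsc ha hq).comp hinj
      filter_upwards [h, hrho.eventually (gt_mem_nhds (by positivity : 0 < η * ε)),
        eventually_gt_atTop 0] with m hm1 hm2 hm3
      have hm3' : (0 : ℝ) < m := by exact_mod_cast hm3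
      have hc : 0 < ‖coeff q a (2 * m + 2)‖ := lt_of_le_of_lt (by positivity) hm1
      rw [div_lt_iff₀ hm3'] at hm1
      refine ⟨norm_pos_iff.mp hc, ?_⟩
      rw [rho_eq_supOsc]
      refine (le_of_lt hm2).trans ?_
      rw [mul_comm (m : ℝ)]
      gcongr
  rw [← map_add_atTop_eq_nat 1, eventually_map]
  filter_upwards [key, eventually_gt_atTop 0] with m hm hm0
  have e : (2 * ((m + 1 : ℕ) : ℤ)) = 2 * (m : ℤ) + 2 := by push_cast; ring
  rw [rho_eq_supOsc] at hm
  rw [e] at hm ⊢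
  refine ⟨hm.1, ?_⟩
  rw [div_le_iff₀ (by positivity)]
  refine hm.2.trans ?_
  push_cast
  nlinarith [norm_nonneg (coeff q a (2 * m + 2)),
    mul_nonneg hη.le (norm_nonneg (coeff q a (2 * m + 2)))]

end Oscillation

/-! ### Orthogonality and two-by-two algebra -/

section Algebra

variable {c : ℤ → ℂ} {w : ℝ}

/-- Eigensequences with different eigenvalues are orthogonal. -/
lemma IsEigSeq.tsum_mul_conj_eq_zero (hherm : ∀ k, c (-k) = starRingEnd ℂ (c k)) {B : ℝ}
    (hB : ∀ k, ‖c k‖ ≤ B) {ν ν' : ℝ} {y z : ℤ → ℂ} (hy : IsEigSeq c w ν y)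
    (hz : IsEigSeq c w ν' z) (hne : ν ≠ ν') : ∑' k, z k * starRingEnd ℂ (y k) = 0 := by
  have h := tsum_conv_symm hherm hB hy.summable hz.summable
  simp only [← hy.eq, ← hz.eq] at h
  have hs : Summable fun k => z k * starRingEnd ℂ (y k) := by
    refine Summable.of_norm_bounded (hz.summable.mul_right (∑' k, ‖y k‖)) fun k => ?_
    rw [norm_mul, RCLike.norm_conj]
    exact mul_le_mul_of_nonneg_left (hy.summable.le_tsum k fun _ _ => norm_nonneg _) (norm_nonneg _)
  have hs1 : Summable fun k : ℤ => z k * starRingEnd ℂ (((ν - (w * k) ^ 2 : ℝ) : ℂ) * y k) := by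
    refine Summable.of_norm_bounded (hz.summable.mul_right (B * ∑' k, ‖y k‖)) fun k => ?_
    rw [norm_mul, RCLike.norm_conj, hy.eq k]
    exact mul_le_mul_of_nonneg_left (norm_conv_le hB hy.summable k) (norm_nonneg _)
  have hs2 : Summable fun k : ℤ => ((ν' - (w * k) ^ 2 : ℝ) : ℂ) * z k * starRingEnd ℂ (y k) := by
    refine (hs1.sub (hs.mul_left ((ν - ν' : ℝ) : ℂ))).congr fun k => ?_
    rw [map_mul, Complex.conj_ofReal]
    push_cast; ring
  have h3 : ((ν - ν' : ℝ) : ℂ) * ∑' k, z k * starRingEnd ℂ (y k) = 0 := by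
    rw [← tsum_mul_left, ← sub_eq_zero.mpr h, ← hs1.tsum_sub hs2]
    refine tsum_congr fun k => ?_
    rw [map_mul, Complex.conj_ofReal]
    push_cast; ring
  refine (mul_eq_zero.mp h3).resolve_left ?_
  exact_mod_cast sub_ne_zero.mpr hne

lemma IsEigSeq.lin_comb {B : ℝ} (hB : ∀ k, ‖c k‖ ≤ B) {ν : ℝ} {y z : ℤ → ℂ}
    (hy : IsEigSeq c w ν y) (hz : IsEigSeq c w ν z) (s t : ℂ) :
    IsEigSeq c w ν fun k => s * y k + t * z k := by
  refine ⟨((hy.summable.of_norm.mul_left s).add (hz.summable.of_norm.mul_left t)).norm,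
    fun k => ?_⟩
  have h1 := (summable_conv hB hy.summable k).hasSum.mul_left s
  have h2 := (summable_conv hB hz.summable k).hasSum.mul_left t
  rw [← hy.eq] at h1
  rw [← hz.eq] at h2
  refine Eq.symm (Eq.trans (Eq.trans (tsum_congr fun j => ?_) (h1.add h2).tsum_eq) ?_) <;> ring

/-- The eigenvalues of the matrix with rows `(0, γ)` and `(γ̄, 0)` are `±|γ|`; this is the version
for approximate eigenvectors. -/
lemma abs_sub_le_of_pair {D e : ℝ} {u v γ : ℂ} (hY : 0 < ‖u‖ + ‖v‖)
    (h1 : ‖(D : ℂ) * u - γ * v‖ ≤ e * (‖u‖ + ‖v‖))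
    (h2 : ‖(D : ℂ) * v - starRingEnd ℂ γ * u‖ ≤ e * (‖u‖ + ‖v‖)) : |(|D| - ‖γ‖)| ≤ 2 * e := by
  have a1 := norm_sub_norm_le ((D : ℂ) * u) (γ * v)
  have a2 := norm_sub_norm_le ((D : ℂ) * v) (starRingEnd ℂ γ * u)
  have a3 := norm_sub_norm_le (γ * v) ((D : ℂ) * u)
  have a4 := norm_sub_norm_le (starRingEnd ℂ γ * u) ((D : ℂ) * v)
  rw [norm_sub_rev] at a3 a4
  simp only [norm_mul, RCLike.norm_conj, Complex.norm_real, Real.norm_eq_abs] at a1 a2 a3 a4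
  rw [abs_le]
  constructor <;> refine le_of_mul_le_mul_right ?_ hY <;> nlinarith

/-- An approximate eigenvector of that matrix near `s |γ|`, `s = ±1`, is nearly a multiple of
`(s γ / |γ|, 1)`. -/
lemma norm_sub_mul_le_of_pair {D e s : ℝ} {u v γ : ℂ} (hγ : γ ≠ 0)
    (h1 : ‖(D : ℂ) * u - γ * v‖ ≤ e * (‖u‖ + ‖v‖)) (he : 24 * e ≤ ‖γ‖) (hs : |s| = 1)
    (hD : |D - s * ‖γ‖| ≤ 2 * e) :
    ‖u - (s * γ / ‖γ‖ : ℂ) * v‖ ≤ 1 / 8 * (‖u‖ + ‖v‖) := by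
  have hγ' : 0 < ‖γ‖ := norm_pos_iff.mpr hγ
  have hγ0 : (‖γ‖ : ℂ) ≠ 0 := by exact_mod_cast hγ'.ne'
  have hs2 : (s : ℂ) * s = 1 := by
    have : s * s = 1 := by rw [← abs_mul_abs_self, hs, one_mul]
    exact_mod_cast this
  have e1 : (‖γ‖ : ℂ) * (u - (s * γ / ‖γ‖ : ℂ) * v) =
      s * (((D : ℂ) * u - γ * v) - ((D - s * ‖γ‖ : ℝ) : ℂ) * u) := by
    push_cast
    field_simp
    linear_combination (‖γ‖ * u) * (-hs2)
  have e2 := congrArg norm e1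
  rw [norm_mul, norm_mul, Complex.norm_real, Complex.norm_real, Real.norm_of_nonneg hγ'.le,
    Real.norm_eq_abs, hs, one_mul] at e2
  have e3 : ‖((D - s * ‖γ‖ : ℝ) : ℂ) * u‖ ≤ 2 * e * (‖u‖ + ‖v‖) := by
    rw [norm_mul, Complex.norm_real, Real.norm_eq_abs]
    have := norm_nonneg v
    have := (abs_nonneg _).trans hD
    exact mul_le_mul hD (by linarith) (norm_nonneg _) this
  have e4 := norm_sub_le ((D : ℂ) * u - γ * v) (((D - s * ‖γ‖ : ℝ) : ℂ) * u)
  have hY : 0 ≤ ‖u‖ + ‖v‖ := by positivity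
  refine le_of_mul_le_mul_left ?_ hγ'
  rw [e2]
  nlinarith

/-- Two vectors that are nearly multiples of the same `(θ, 1)` are far from orthogonal. -/
lemma le_norm_add_of_aligned {θ u v u' v' : ℂ} (hθ : ‖θ‖ = 1)
    (h : ‖u - θ * v‖ ≤ 1 / 8 * (‖u‖ + ‖v‖)) (h' : ‖u' - θ * v'‖ ≤ 1 / 8 * (‖u'‖ + ‖v'‖)) :
    1 / 5 * ((‖u‖ + ‖v‖) * (‖u'‖ + ‖v'‖)) ≤
      ‖u * starRingEnd ℂ u' + v * starRingEnd ℂ v'‖ := by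
  have key : ∀ {x z : ℂ}, ‖x - θ * z‖ ≤ 1 / 8 * (‖x‖ + ‖z‖) →
      7 / 16 * (‖x‖ + ‖z‖) ≤ ‖z‖ ∧ ‖z‖ ≤ 9 / 16 * (‖x‖ + ‖z‖) := by
    intro x z hxz
    have h1 := norm_sub_norm_le x (θ * z)
    have h2 := norm_sub_norm_le (θ * z) x
    rw [norm_sub_rev] at h2
    rw [norm_mul, hθ, one_mul] at h1 h2
    constructor <;> linarith
  obtain ⟨k1, k2⟩ := key h
  obtain ⟨k3, k4⟩ := key h'
  set Y := ‖u‖ + ‖v‖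
  set Y' := ‖u'‖ + ‖v'‖
  have hY : 0 ≤ Y := by positivity
  have hY' : 0 ≤ Y' := by positivity
  set d := u - θ * v with hd
  set d' := u' - θ * v' with hd'
  have hθ2 : θ * starRingEnd ℂ θ = 1 := by
    rw [Complex.mul_conj, Complex.normSq_eq_norm_sq, hθ]; norm_num
  have e1 : 2 * (v * starRingEnd ℂ v') = (u * starRingEnd ℂ u' + v * starRingEnd ℂ v') -
      (θ * v * starRingEnd ℂ d' + d * starRingEnd ℂ (θ * v') + d * starRingEnd ℂ d') := by
    rw [hd, hd']
    simp only [map_sub, map_mul]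
    linear_combination (v * starRingEnd ℂ v') * (-hθ2)
  have e2 := congrArg norm e1
  rw [norm_mul, norm_mul, RCLike.norm_conj, Complex.norm_ofNat] at e2
  have e3 := norm_sub_le (u * starRingEnd ℂ u' + v * starRingEnd ℂ v')
    (θ * v * starRingEnd ℂ d' + d * starRingEnd ℂ (θ * v') + d * starRingEnd ℂ d')
  have e4 := norm_add₃_le (a := θ * v * starRingEnd ℂ d') (b := d * starRingEnd ℂ (θ * v'))
    (c := d * starRingEnd ℂ d')
  simp only [norm_mul, RCLike.norm_conj, hθ, one_mul] at e4
  have m1 : ‖v‖ * ‖d'‖ ≤ 9 / 16 * Y * (1 / 8 * Y') := by gcongr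
  have m2 : ‖d‖ * ‖v'‖ ≤ 1 / 8 * Y * (9 / 16 * Y') := by gcongr
  have m3 : ‖d‖ * ‖d'‖ ≤ 1 / 8 * Y * (1 / 8 * Y') := by gcongr
  have m4 : 7 / 16 * Y * (7 / 16 * Y') ≤ ‖v‖ * ‖v'‖ := by gcongr
  have m5 : 0 ≤ Y * Y' := by positivity
  linarith

end Algebra

/-! ### Splitting of the eigenvalue pair -/

section Splitting

variable {a : ℝ} {q : ℝ → ℝ}

/-- The two resonant equations with the error `O(ρ/p)`. The equation at `-p` is the one at `p` for
the conjugate sequence. -/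
lemma exists_window_approx (ha : 0 < a) (hq : LocallyIntegrable q volume)
    (hper : Function.Periodic q a) (h0 : coeff q a 0 = 0) {k : ℤ} (hk : coeff q a k ≠ 0) :
    ∃ C : ℝ, 0 < C ∧ ∀ᶠ p : ℕ in atTop, 0 < p ∧ ∀ (ν : ℝ) (y : ℤ → ℂ),
      IsEigSeq (coeff q a) (2 * Real.pi / a) ν y →
      (2 * Real.pi / a) ^ 2 * ((p : ℝ) - 1 / 2) ^ 2 ≤ ν →
      ν ≤ (2 * Real.pi / a) ^ 2 * ((p : ℝ) + 1 / 2) ^ 2 → y ≠ 0 →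
      0 < ‖y p‖ + ‖y (-p)‖ ∧
      (∀ k, ‖rest p y k‖ ≤ C * (‖y p‖ + ‖y (-p)‖) * gapInv p k) ∧
      ‖((ν - (2 * Real.pi / a * p) ^ 2 : ℝ) : ℂ) * y p - coeff q a (2 * p) * y (-p)‖ ≤
        C * (supOsc q a (2 * p) / p) * (‖y p‖ + ‖y (-p)‖) ∧
      ‖((ν - (2 * Real.pi / a * p) ^ 2 : ℝ) : ℂ) * y (-p) -
          starRingEnd ℂ (coeff q a (2 * p)) * y p‖ ≤
        C * (supOsc q a (2 * p) / p) * (‖y p‖ + ‖y (-p)‖) := by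
  obtain ⟨C, hC, h⟩ := exists_window_bound ha hq hper h0
  obtain ⟨b, hb, hS⟩ := exists_supOsc_ge ha hq hk
  set T := ∫ t in (0 : ℝ)..a, ‖(q t : ℂ)‖ with hT
  have hT0 : 0 ≤ T := (norm_nonneg _).trans
    (norm_integral_mul_harm_le hq 0 (x := 0) ⟨le_rfl, ha.le⟩)
  -- `K` bounds `|ν - (w p)²|`; this a priori bound makes the last error term `O(1/p²)`
  set K := 2 * (T / a) + 4 * (C * (T + 1)) with hK
  have hK0 : 0 ≤ K := by positivity
  refine ⟨C * (1 + (1 + K) / b), by positivity, ?_⟩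
  filter_upwards [h, tendsto_natCast_atTop_atTop.eventually_ge_atTop (4 * C + 1)] with p hp hpC
  obtain ⟨hp, h⟩ := hp
  refine ⟨hp, fun ν y hy hl hu hne => ?_⟩
  have hp1 : (1 : ℝ) ≤ p := by exact_mod_cast hp
  have hp' : (0 : ℝ) < p := by linarith
  set S := supOsc q a (2 * p) with hSdef
  set γ := coeff q a (2 * p) with hγ
  set D := ν - (2 * Real.pi / a * p) ^ 2 with hD
  have hSb : b / p ≤ S := hS p hp
  have hS0 : 0 ≤ S := supOsc_nonneg _
  have hST : S ≤ T := supOsc_le ha fun x hx => norm_integral_mul_harm_le hq _ hx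
  obtain ⟨hr, hR⟩ := h ν y hy hl hu
  have f1 := hR S hST fun x hx => le_supOsc hq _ hx
  have f2 := (h ν _ (hy.conj_neg coeff_neg) hl hu).2 S hST fun x hx => le_supOsc hq _ hx
  simp only [neg_neg, RCLike.norm_conj] at f2
  rw [add_comm ‖y (-p)‖, ← RCLike.norm_conj] at f2
  simp only [map_sub, map_mul, Complex.conj_ofReal, Complex.conj_conj] at f2
  set Y := ‖y p‖ + ‖y (-p)‖ with hY
  have hYpos : 0 < Y := by
    refine lt_of_le_of_ne (by positivity) fun h0 => hne ?_
    have hyp : ‖y p‖ = 0 := by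
      have := norm_nonneg (y (-p)); have := norm_nonneg (y p); linarith
    have hyn : ‖y (-p)‖ = 0 := by
      have := norm_nonneg (y (-p)); have := norm_nonneg (y p); linarith
    ext j
    have := hr j
    rw [← h0, mul_zero, zero_mul] at this
    by_cases hj : j = p ∨ j = -p
    · rcases hj with rfl | rfl
      · exact norm_eq_zero.mp hyp
      · exact norm_eq_zero.mp hyn
    · rw [rest, if_neg hj] at this
      exact norm_eq_zero.mp (le_antisymm this (norm_nonneg _))
  -- both equations with the error of `exists_window_bound`, in which `|D|` is absorbed for `p ≥ 4C`
  have hDK : |D| ≤ K := by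
    have g := abs_sub_le_of_pair hYpos f1 f2
    rw [abs_le] at g
    have g1 : ‖γ‖ ≤ T / a := (norm_coeff_le_supOsc ha hq _).trans (by gcongr)
    have g2 : S / p ≤ T := (div_le_self hS0 hp1).trans hST
    have g3 : 1 / (p : ℝ) ^ 2 ≤ 1 := by
      rw [div_le_one (by positivity)]; nlinarith
    have g4 : C * (|D| / (p : ℝ) ^ 2) ≤ 1 / 4 * |D| := by
      rw [mul_div_assoc', div_le_iff₀ (by positivity)]
      have : 4 * C ≤ (p : ℝ) ^ 2 := by nlinarith
      nlinarith [abs_nonneg D]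
    have g5 : C * (S / p) ≤ C * T := by gcongr
    have g6 : C * (1 / (p : ℝ) ^ 2) ≤ C * 1 := by gcongr
    nlinarith [g.2]
  have hE : C * (S / p + 1 / p ^ 2 + |D| / p ^ 2) ≤ C * (1 + (1 + K) / b) * (S / p) := by
    have g1 : 1 / (p : ℝ) ^ 2 ≤ 1 / b * (S / p) := by
      rw [one_div_mul_eq_div, le_div_iff₀ hb, div_mul_eq_mul_div, one_mul, pow_two, ← div_div]
      gcongr
    have g2 : |D| / (p : ℝ) ^ 2 ≤ K / b * (S / p) := by
      calc |D| / (p : ℝ) ^ 2 ≤ K / p ^ 2 := by gcongr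
        _ = K * (1 / p ^ 2) := by ring
        _ ≤ K * (1 / b * (S / p)) := by gcongr
        _ = _ := by ring
    calc _ ≤ C * (S / p + 1 / b * (S / p) + K / b * (S / p)) := by gcongr
      _ = _ := by ring
  refine ⟨hYpos, fun k => (hr k).trans ?_, f1.trans ?_, f2.trans ?_⟩
  · have := gapInv_nonneg p k
    have : C ≤ C * (1 + (1 + K) / b) := le_mul_of_one_le_right hC.le (by
      have : 0 ≤ (1 + K) / b := by positivity
      linarith)
    gcongr
  · exact mul_le_mul_of_nonneg_right hE hYpos.le
  · exact mul_le_mul_of_nonneg_right hE hYpos.le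

/-- An eigenvalue in the window around `(w p)²` is within `O(ρ/p)` of `(w p)² ± |c_{2p}|`, and for each
sign there is at most one, which is simple. -/
theorem exists_splitting (ha : 0 < a) (hq : LocallyIntegrable q volume)
    (hper : Function.Periodic q a) (h0 : coeff q a 0 = 0)
    (hgap : ∀ η : ℝ, 0 < η → ∀ᶠ p : ℕ in atTop, coeff q a (2 * p) ≠ 0 ∧
      supOsc q a (2 * p) / p ≤ η * ‖coeff q a (2 * p)‖) :
    ∃ C : ℝ, 0 < C ∧ ∀ᶠ p : ℕ in atTop, 0 < p ∧ coeff q a (2 * p) ≠ 0 ∧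
      24 * (C * (supOsc q a (2 * p) / p)) ≤ ‖coeff q a (2 * p)‖ ∧
      (∀ (ν : ℝ) (y : ℤ → ℂ), IsEigSeq (coeff q a) (2 * Real.pi / a) ν y → y ≠ 0 →
        (2 * Real.pi / a) ^ 2 * ((p : ℝ) - 1 / 2) ^ 2 ≤ ν →
        ν ≤ (2 * Real.pi / a) ^ 2 * ((p : ℝ) + 1 / 2) ^ 2 →
        ∃ s : ℝ, (s = 1 ∨ s = -1) ∧ |ν - (2 * Real.pi / a * p) ^ 2 - s * ‖coeff q a (2 * p)‖| ≤
          2 * (C * (supOsc q a (2 * p) / p))) ∧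
      ∀ s : ℝ, (s = 1 ∨ s = -1) → ∀ (ν ν' : ℝ) (y z : ℤ → ℂ),
        IsEigSeq (coeff q a) (2 * Real.pi / a) ν y → y ≠ 0 →
        (2 * Real.pi / a) ^ 2 * ((p : ℝ) - 1 / 2) ^ 2 ≤ ν →
        ν ≤ (2 * Real.pi / a) ^ 2 * ((p : ℝ) + 1 / 2) ^ 2 →
        IsEigSeq (coeff q a) (2 * Real.pi / a) ν' z → z ≠ 0 →
        (2 * Real.pi / a) ^ 2 * ((p : ℝ) - 1 / 2) ^ 2 ≤ ν' →
        ν' ≤ (2 * Real.pi / a) ^ 2 * ((p : ℝ) + 1 / 2) ^ 2 →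
        |ν - (2 * Real.pi / a * p) ^ 2 - s * ‖coeff q a (2 * p)‖| ≤
          2 * (C * (supOsc q a (2 * p) / p)) →
        |ν' - (2 * Real.pi / a * p) ^ 2 - s * ‖coeff q a (2 * p)‖| ≤
          2 * (C * (supOsc q a (2 * p) / p)) →
        ν = ν' ∧ ∃ t : ℂ, z = t • y := by
  obtain ⟨p₀, hp₀⟩ := (hgap 1 one_pos).exists
  obtain ⟨C, hC, h⟩ := exists_window_approx ha hq hper h0 hp₀.1
  obtain ⟨Cg, hCg, hg⟩ := exists_gapInv_bounds
  have hlim : Tendsto (fun p : ℕ => C ^ 2 * Cg / (p : ℝ) ^ 2) atTop (𝓝 0) :=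
    tendsto_const_nhds.div_atTop
      ((tendsto_pow_atTop two_ne_zero).comp tendsto_natCast_atTop_atTop)
  refine ⟨C, hC, ?_⟩
  filter_upwards [h, hgap (1 / (24 * C)) (by positivity),
    hlim.eventually (gt_mem_nhds (by norm_num : (0 : ℝ) < 1 / 5))] with p hp hc hsmall
  obtain ⟨hp, h⟩ := hp
  obtain ⟨hγ, hSγ⟩ := hc
  obtain ⟨-, gs, gb⟩ := hg p hp
  set γ := coeff q a (2 * p)
  set e := C * (supOsc q a (2 * p) / p) with he
  have he24 : 24 * e ≤ ‖γ‖ := by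
    calc 24 * e = 24 * C * (supOsc q a (2 * p) / p) := by rw [he]; ring
      _ ≤ 24 * C * (1 / (24 * C) * ‖γ‖) := by gcongr
      _ = ‖γ‖ := by field_simp
  have hγ' : 0 < ‖γ‖ := norm_pos_iff.mpr hγ
  refine ⟨hp, hγ, he24, fun ν y hy hne hl hu => ?_, ?_⟩
  · obtain ⟨hY, -, f1, f2⟩ := h ν y hy hl hu hne
    have g := abs_sub_le_of_pair hY f1 f2
    rcases abs_cases (ν - (2 * Real.pi / a * p) ^ 2) with h1 | h1
    · exact ⟨1, Or.inl rfl, by rw [one_mul, ← h1.1]; exact g⟩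
    · refine ⟨-1, Or.inr rfl, ?_⟩
      rw [h1.1] at g
      rw [abs_sub_comm] at g
      convert g using 2
      ring
  · intro s hs ν ν' y z hy hy0 hl hu hz hz0 hl' hu' hν hν'
    have hs1 : |s| = 1 := by rcases hs with rfl | rfl <;> simp
    set θ : ℂ := s * γ / ‖γ‖ with hθ
    have hθ1 : ‖θ‖ = 1 := by
      rw [hθ, norm_div, norm_mul, Complex.norm_real, Complex.norm_real, norm_norm,
        Real.norm_eq_abs, hs1, one_mul, div_self hγ'.ne']
    have align : ∀ (ν : ℝ) (y : ℤ → ℂ), IsEigSeq (coeff q a) (2 * Real.pi / a) ν y → y ≠ 0 →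
        (2 * Real.pi / a) ^ 2 * ((p : ℝ) - 1 / 2) ^ 2 ≤ ν →
        ν ≤ (2 * Real.pi / a) ^ 2 * ((p : ℝ) + 1 / 2) ^ 2 →
        |ν - (2 * Real.pi / a * p) ^ 2 - s * ‖γ‖| ≤ 2 * e →
        0 < ‖y p‖ + ‖y (-p)‖ ∧ ‖y p - θ * y (-p)‖ ≤ 1 / 8 * (‖y p‖ + ‖y (-p)‖) ∧
        ∀ k, ‖rest p y k‖ ≤ C * (‖y p‖ + ‖y (-p)‖) * gapInv p k := by
      intro ν y hy hne hl hu hν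
      obtain ⟨hY, hr, f1, -⟩ := h ν y hy hl hu hne
      exact ⟨hY, norm_sub_mul_le_of_pair hγ f1 he24 hs1 hν, hr⟩
    obtain ⟨hY, hal, hr⟩ := align ν y hy hy0 hl hu hν
    obtain ⟨hY', hal', hr'⟩ := align ν' z hz hz0 hl' hu' hν'
    -- for `ν ≠ ν'` the sequences are orthogonal, but the resonant modes alone contribute `1/5` and
    -- the others only `O(1/p²)`
    have heq : ν = ν' := by
      by_contra hne
      have ho := hy.tsum_mul_conj_eq_zero coeff_neg (norm_coeff_le ha) hz hne
      have hs : Summable fun k => z k * starRingEnd ℂ (y k) := by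
        refine Summable.of_norm_bounded (hz.summable.mul_right (∑' k, ‖y k‖)) fun k => ?_
        rw [norm_mul, RCLike.norm_conj]
        exact mul_le_mul_of_nonneg_left (hy.summable.le_tsum k fun _ _ => norm_nonneg _)
          (norm_nonneg _)
      rw [tsum_split hs hp] at ho
      have g1 := le_norm_add_of_aligned hθ1 hal' hal
      rw [eq_neg_of_add_eq_zero_left ho, norm_neg] at g1
      have g2 : ‖∑' k : ℤ, if k = p ∨ k = -p then 0 else z k * starRingEnd ℂ (y k)‖ ≤
          C ^ 2 * ((‖z p‖ + ‖z (-p)‖) * (‖y p‖ + ‖y (-p)‖)) * ∑' k, gapInv p k ^ 2 := by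
        rw [← tsum_mul_left]
        refine tsum_of_norm_bounded (gs.mul_left _).hasSum fun k => ?_
        have a1 := hr k
        have a2 := hr' k
        have hgk := gapInv_nonneg p k
        by_cases hk : k = p ∨ k = -p
        · rw [if_pos hk, norm_zero]; positivity
        · rw [rest, if_neg hk] at a1 a2
          rw [if_neg hk, norm_mul, RCLike.norm_conj]
          calc _ ≤ C * (‖z p‖ + ‖z (-p)‖) * gapInv p k *
                (C * (‖y p‖ + ‖y (-p)‖) * gapInv p k) := by gcongr
            _ = _ := by ring
      have hYY := mul_pos hY' hY
      have g3 : C ^ 2 * ((‖z p‖ + ‖z (-p)‖) * (‖y p‖ + ‖y (-p)‖)) * ∑' k, gapInv p k ^ 2 <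
          1 / 5 * ((‖z p‖ + ‖z (-p)‖) * (‖y p‖ + ‖y (-p)‖)) := by
        calc _ ≤ C ^ 2 * ((‖z p‖ + ‖z (-p)‖) * (‖y p‖ + ‖y (-p)‖)) * (Cg / p ^ 2) := by gcongr
          _ = C ^ 2 * Cg / p ^ 2 * ((‖z p‖ + ‖z (-p)‖) * (‖y p‖ + ‖y (-p)‖)) := by ring
          _ < _ := mul_lt_mul_of_pos_right hsmall hYY
      linarith
    subst heq
    -- the combination that vanishes at `-p` is not aligned, so it must be zero
    refine ⟨rfl, z (-p) / y (-p), ?_⟩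
    have hyn : y (-p) ≠ 0 := by
      intro h1
      rw [h1, mul_zero, sub_zero, norm_zero, add_zero] at hal
      rw [h1, norm_zero, add_zero] at hY
      linarith
    have hx0 : (fun k => z (-p) * y k + -y (-p) * z k) = 0 := by
      by_contra hx
      obtain ⟨k1, k2, -⟩ := align ν _ (hy.lin_comb (norm_coeff_le ha) hz (z (-p)) (-y (-p))) hx
        hl hu hν
      have h1 : z (-p) * y (-p) + -y (-p) * z (-p) = 0 := by ring
      simp only [h1, mul_zero, sub_zero, norm_zero, add_zero] at k1 k2
      linarith
    ext k
    have h1 := congrFun hx0 k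
    simp only [Pi.zero_apply] at h1
    rw [Pi.smul_apply, smul_eq_mul, div_mul_eq_mul_div, eq_div_iff hyn]
    linear_combination -h1

end Splitting

/-! ### Families of eigenfunctions -/

section Transfer

variable {a : ℝ} {q : ℝ → ℝ}

lemma trig_sum_smul {ι : Type*} (s : Finset ι) (t : ι → ℂ) {y : ι → ℤ → ℂ}
    (hy : ∀ i, Summable fun k => ‖y i k‖) :
    trig a (∑ i ∈ s, t i • y i) = ∑ i ∈ s, t i • trig a (y i) := by
  ext x
  have h := hasSum_sum (s := s) fun i _ =>
    (summable_trig (a := a) (hy i) x).hasSum.mul_left (t i)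
  simp only [Finset.sum_apply, Pi.smul_apply, smul_eq_mul]
  refine Eq.trans (tsum_congr fun k => ?_) h.tsum_eq
  simp only [Finset.sum_apply, Pi.smul_apply, smul_eq_mul, Finset.sum_mul, mul_assoc]

lemma trig_smul (t : ℂ) (y : ℤ → ℂ) : trig a (t • y) = t • trig a y := by
  ext x
  simp only [trig, Pi.smul_apply, smul_eq_mul, mul_assoc, tsum_mul_left]

/-- Independent families of eigenfunctions and of eigensequences correspond to each other. -/
lemma exists_eigenspace_family_iff (ha : 0 < a) (hq : LocallyIntegrable q volume)
    (hper : Function.Periodic q a) (n : ℕ) (μ : ℝ) :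
    (∃ f : Fin n → (ℝ → ℂ), LinearIndependent ℂ f ∧ ∀ i, ∃ ν ≤ μ, f i ∈ eigenspace q a ν) ↔
    ∃ y : Fin n → (ℤ → ℂ), LinearIndependent ℂ y ∧
      ∀ i, ∃ ν ≤ μ, IsEigSeq (coeff q a) (2 * Real.pi / a) ν (y i) := by
  constructor
  · rintro ⟨f, hf, h⟩
    choose ν hν hm using h
    have hb := fun i => isEigSeq_of_mem_eigenspace ha hq hper (hm i)
    refine ⟨fun i => fc a (f i), ?_, fun i => ⟨ν i, hν i, (hb i).1⟩⟩
    rw [Fintype.linearIndependent_iff] at hf ⊢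
    intro t ht
    refine hf t ?_
    have := trig_sum_smul (a := a) Finset.univ t fun i => (hb i).1.summable
    rw [ht] at this
    simp only [(hb _).2] at this
    rw [← this]
    ext x
    simp [trig]
  · rintro ⟨y, hy, h⟩
    choose ν hν hm using h
    refine ⟨fun i => trig a (y i), ?_, fun i => ⟨ν i, hν i, trig_mem_eigenspace ha hq hper (hm i)⟩⟩
    rw [Fintype.linearIndependent_iff] at hy ⊢
    intro t ht
    refine hy t ?_
    rw [← trig_sum_smul (a := a) Finset.univ t fun i => (hm i).summable] at ht
    have hs : Summable fun k => ‖(∑ i, t i • y i) k‖ := by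
      simp only [Finset.sum_apply, Pi.smul_apply, smul_eq_mul]
      exact (summable_sum fun i _ => (hm i).summable.of_norm.mul_left (t i)).norm
    ext k
    rw [← fc_trig ha hs k, ht]
    simp [fc]

lemma finrank_eigenspace_eq_one (ha : 0 < a) (hq : LocallyIntegrable q volume)
    (hper : Function.Periodic q a) {ν : ℝ} {y : ℤ → ℂ}
    (hy : IsEigSeq (coeff q a) (2 * Real.pi / a) ν y) (hy0 : y ≠ 0)
    (h : ∀ z, IsEigSeq (coeff q a) (2 * Real.pi / a) ν z → z ≠ 0 → ∃ t : ℂ, z = t • y) :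
    Module.finrank ℂ (eigenspace q a ν) = 1 := by
  have hmem := trig_mem_eigenspace ha hq hper hy
  rw [finrank_eq_one_iff']
  refine ⟨⟨trig a y, hmem⟩, fun h0 => hy0 ?_, fun f => ?_⟩
  · have h1 : trig a y = 0 := congrArg Subtype.val h0
    ext k
    rw [← fc_trig ha hy.summable k, h1]
    simp [fc]
  · obtain ⟨hz, hf⟩ := isEigSeq_of_mem_eigenspace ha hq hper f.2
    by_cases hz0 : fc a f = 0
    · refine ⟨0, Subtype.ext ?_⟩
      rw [← hf, hz0]
      ext x
      simp [trig]
    · obtain ⟨t, ht⟩ := h _ hz hz0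
      refine ⟨t, Subtype.ext ?_⟩
      rw [← hf, ht, trig_smul]
      rfl

end Transfer

/-! ### The enumeration of eigenvalues -/

section Enumeration

variable {c : ℤ → ℂ} {w : ℝ}

/-- The bounds `μ` below which there are `n` independent eigensequences. The set for `n + 1` is the
one whose infimum is `eigenvalue q a n`. -/
def eigSeqBounds (c : ℤ → ℂ) (w : ℝ) (n : ℕ) : Set ℝ :=
  {μ | ∃ y : Fin n → ℤ → ℂ, LinearIndependent ℂ y ∧ ∀ i, ∃ ν ≤ μ, IsEigSeq c w ν (y i)}

lemma card_filter_le_of_forall {l : ℝ} {n : ℕ}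
    (hcount : ∀ (d : ℕ) (y : Fin d → ℤ → ℂ), LinearIndependent ℂ y →
      (∀ i, ∃ ν ≤ l, IsEigSeq c w ν (y i)) → d ≤ n)
    {N : ℕ} {y : Fin N → ℤ → ℂ} (hy : LinearIndependent ℂ y) {ν : Fin N → ℝ}
    (h : ∀ i, IsEigSeq c w (ν i) (y i)) (s : Finset (Fin N)) (hs : ∀ i ∈ s, ν i ≤ l) :
    s.card ≤ n :=
  hcount s.card (fun i => y (s.orderEmbOfFin rfl i))
    (hy.comp _ (s.orderEmbOfFin rfl).injective)
    fun i => ⟨_, hs _ (s.orderEmbOfFin_mem rfl i), h _⟩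

lemma ne_smul_of_linearIndependent {N : ℕ} {y : Fin N → ℤ → ℂ} (hy : LinearIndependent ℂ y)
    {i j : Fin N} (hij : i ≠ j) (t : ℂ) : y j ≠ t • y i := by
  intro h
  have h1 : LinearIndependent ℂ ![y i, y j] := by
    have h2 := hy.comp ![i, j] (by
      intro x z; fin_cases x <;> fin_cases z <;> simp [hij, hij.symm])
    convert! h2 using 1
    ext k
    fin_cases k <;> rfl
  rw [LinearIndependent.pair_iff] at h1
  have := h1 t (-1) (by rw [h, neg_one_smul, add_neg_cancel])
  simpa using this.2

/-- The counting argument: at most `2m + 1` eigensequences below `l`, at least `2m + 3` below `u`, and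
in between at most one for each sign. So there is exactly one for each sign, and these two eigenvalues
are number `2m + 2` and `2m + 3`. -/
lemma exists_isLeast_pair {m : ℕ} {l u κ g e : ℝ}
    (hcount : ∀ (d : ℕ) (y : Fin d → ℤ → ℂ), LinearIndependent ℂ y →
      (∀ i, ∃ ν ≤ l, IsEigSeq c w ν (y i)) → d ≤ 2 * m + 1)
    (hex : ∃ y : Fin (2 * m + 3) → ℤ → ℂ, LinearIndependent ℂ y ∧
      ∀ i, ∃ ν ≤ u, IsEigSeq c w ν (y i))
    (hge : 2 * e < g)
    (hsign : ∀ (ν : ℝ) (y : ℤ → ℂ), IsEigSeq c w ν y → y ≠ 0 → l ≤ ν → ν ≤ u →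
      ∃ s : ℝ, (s = 1 ∨ s = -1) ∧ |ν - κ - s * g| ≤ 2 * e)
    (hdep : ∀ s : ℝ, (s = 1 ∨ s = -1) → ∀ (ν ν' : ℝ) (y z : ℤ → ℂ),
      IsEigSeq c w ν y → y ≠ 0 → l ≤ ν → ν ≤ u → IsEigSeq c w ν' z → z ≠ 0 → l ≤ ν' → ν' ≤ u →
      |ν - κ - s * g| ≤ 2 * e → |ν' - κ - s * g| ≤ 2 * e → ν = ν' ∧ ∃ t : ℂ, z = t • y) :
    ∃ ν₁ ν₂ : ℝ,
      (l ≤ ν₁ ∧ ν₁ ≤ u ∧ |ν₁ - κ - (-1) * g| ≤ 2 * e ∧ ∃ y, IsEigSeq c w ν₁ y ∧ y ≠ 0) ∧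
      (l ≤ ν₂ ∧ ν₂ ≤ u ∧ |ν₂ - κ - 1 * g| ≤ 2 * e ∧ ∃ y, IsEigSeq c w ν₂ y ∧ y ≠ 0) ∧
      IsLeast (eigSeqBounds c w (2 * m + 2)) ν₁ ∧ IsLeast (eigSeqBounds c w (2 * m + 3)) ν₂ := by
  obtain ⟨y, hy, h⟩ := hex
  choose ν hνu hν using h
  -- an index above `l` has a sign, and it is determined by that sign
  have hS : ∀ i, l < ν i → ∃ s : ℝ, (s = 1 ∨ s = -1) ∧ |ν i - κ - s * g| ≤ 2 * e := fun i hi =>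
    hsign _ _ (hν i) (hy.ne_zero i) hi.le (hνu i)
  have huniq : ∀ s : ℝ, (s = 1 ∨ s = -1) → ∀ i j, l < ν i → l < ν j →
      |ν i - κ - s * g| ≤ 2 * e → |ν j - κ - s * g| ≤ 2 * e → i = j := by
    intro s hs i j hi hj h1 h2
    by_contra hij
    obtain ⟨-, t, ht⟩ := hdep s hs _ _ _ _ (hν i) (hy.ne_zero i) hi.le (hνu i) (hν j)
      (hy.ne_zero j) hj.le (hνu j) h1 h2
    exact ne_smul_of_linearIndependent hy hij t ht
  have hcard : 1 < (Finset.univ.filter fun i => ¬ ν i ≤ l).card := by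
    have h1 := card_filter_le_of_forall hcount hy hν (Finset.univ.filter fun i => ν i ≤ l)
      (by simp)
    have h2 := Finset.card_filter_add_card_filter_not (s := Finset.univ) fun i => ν i ≤ l
    rw [Finset.card_univ, Fintype.card_fin] at h2
    omega
  obtain ⟨i, hi, j, hj, hij⟩ := Finset.one_lt_card.mp hcard
  simp only [Finset.mem_filter, Finset.mem_univ, true_and, not_le] at hi hj
  obtain ⟨i₁, i₂, hi1, hi2, hb1, hb2⟩ : ∃ i₁ i₂, l < ν i₁ ∧ l < ν i₂ ∧
      |ν i₁ - κ - 1 * g| ≤ 2 * e ∧ |ν i₂ - κ - (-1) * g| ≤ 2 * e := by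
    obtain ⟨s, hs, h1⟩ := hS i hi
    obtain ⟨s', hs', h2⟩ := hS j hj
    rcases hs with rfl | rfl <;> rcases hs' with rfl | rfl
    · exact absurd (huniq 1 (Or.inl rfl) i j hi hj h1 h2) hij
    · exact ⟨i, j, hi, hj, h1, h2⟩
    · exact ⟨j, i, hj, hi, h2, h1⟩
    · exact absurd (huniq (-1) (Or.inr rfl) i j hi hj h1 h2) hij
  have hlow : ∀ k, k ≠ i₁ → k ≠ i₂ → ν k ≤ l := by
    intro k h1 h2
    by_contra hk
    push Not at hk
    obtain ⟨s, hs, hb⟩ := hS k hk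
    rcases hs with rfl | rfl
    · exact h1 (huniq 1 (Or.inl rfl) k i₁ hk hi1 hb hb1)
    · exact h2 (huniq (-1) (Or.inr rfl) k i₂ hk hi2 hb hb2)
  have hb1' := abs_le.mp hb1
  have hb2' := abs_le.mp hb2
  have hlt : ν i₂ < ν i₁ := by linarith
  refine ⟨ν i₂, ν i₁, ⟨hi2.le, hνu _, hb2, _, hν i₂, hy.ne_zero _⟩,
    ⟨hi1.le, hνu _, hb1, _, hν i₁, hy.ne_zero _⟩, ⟨?_, ?_⟩, ⟨?_, ?_⟩⟩
  · refine ⟨fun k => y (i₁.succAbove k), hy.comp _ Fin.succAbove_right_injective, fun k =>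
      ⟨_, ?_, hν _⟩⟩
    by_cases hk : i₁.succAbove k = i₂
    · rw [hk]
    · exact (hlow _ (Fin.succAbove_ne _ _) hk).trans hi2.le
  · rintro μ ⟨z, hz, hm⟩
    by_contra hμ
    push Not at hμ
    choose ν' hνμ hν' using hm
    refine absurd (hcount _ z hz fun k => ⟨ν' k, ?_, hν' k⟩) (by omega)
    by_contra hk
    push Not at hk
    have hku : ν' k ≤ u := (hνμ k).trans (hμ.le.trans (hνu i₂))
    obtain ⟨s, hs, hb⟩ := hsign _ _ (hν' k) (hz.ne_zero k) hk.le hku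
    have hνk := hνμ k
    rcases hs with rfl | rfl
    · have := abs_le.mp hb
      linarith
    · have := (hdep (-1) (Or.inr rfl) _ _ _ _ (hν' k) (hz.ne_zero k) hk.le hku (hν i₂)
        (hy.ne_zero _) hi2.le (hνu _) hb hb2).1
      linarith
  · refine ⟨y, hy, fun k => ⟨_, ?_, hν k⟩⟩
    by_cases h1 : k = i₁
    · rw [h1]
    · by_cases h2 : k = i₂
      · rw [h2]; exact hlt.le
      · exact (hlow k h1 h2).trans hi1.le
  · rintro μ ⟨z, hz, hm⟩
    by_contra hμ
    push Not at hμ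
    choose ν' hνμ hν' using hm
    have hku : ∀ k, ν' k ≤ u := fun k => (hνμ k).trans (hμ.le.trans (hνu i₁))
    have hneg : ∀ k, l < ν' k → |ν' k - κ - (-1) * g| ≤ 2 * e := by
      intro k hk
      obtain ⟨s, hs, hb⟩ := hsign _ _ (hν' k) (hz.ne_zero k) hk.le (hku k)
      rcases hs with rfl | rfl
      · have := (hdep 1 (Or.inl rfl) _ _ _ _ (hν' k) (hz.ne_zero k) hk.le (hku k) (hν i₁)
          (hy.ne_zero _) hi1.le (hνu _) hb hb1).1
        have := hνμ k
        linarith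
      · exact hb
    have hcard' : (Finset.univ.filter fun k => ¬ ν' k ≤ l).card ≤ 1 := by
      rw [Finset.card_le_one]
      intro k hk k' hk'
      simp only [Finset.mem_filter, Finset.mem_univ, true_and, not_le] at hk hk'
      by_contra hne
      obtain ⟨-, t, ht⟩ := hdep (-1) (Or.inr rfl) _ _ _ _ (hν' k) (hz.ne_zero k) hk.le (hku k)
        (hν' k') (hz.ne_zero k') hk'.le (hku k') (hneg k hk) (hneg k' hk')
      exact ne_smul_of_linearIndependent hz hne t ht
    have h1 := card_filter_le_of_forall hcount hz hν' (Finset.univ.filter fun i => ν' i ≤ l)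
      (by simp)
    have h2 := Finset.card_filter_add_card_filter_not (s := Finset.univ) fun i => ν' i ≤ l
    rw [Finset.card_univ, Fintype.card_fin] at h2
    omega

end Enumeration

/-! ### Asymptotics of the eigenvalue pair -/

section Main

variable {a : ℝ} {q : ℝ → ℝ}

lemma eigenvalue_eq_of_isLeast (ha : 0 < a) (hq : LocallyIntegrable q volume)
    (hper : Function.Periodic q a) {n : ℕ} {ν : ℝ}
    (h : IsLeast (eigSeqBounds (coeff q a) (2 * Real.pi / a) (n + 1)) ν) :
    eigenvalue q a n = ν := by
  rw [eigenvalue, ← h.csInf_eq]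
  congr 1
  ext μ
  exact exists_eigenspace_family_iff ha hq hper (n + 1) μ

theorem exists_eventually_eigenvalue_pair (ha : 0 < a) (hq : LocallyIntegrable q volume)
    (hper : Function.Periodic q a) (h0 : coeff q a 0 = 0)
    (hgap : ∀ η : ℝ, 0 < η → ∀ᶠ p : ℕ in atTop, coeff q a (2 * p) ≠ 0 ∧
      supOsc q a (2 * p) / p ≤ η * ‖coeff q a (2 * p)‖) :
    ∃ C : ℝ, ∀ᶠ m : ℕ in atTop,
      (Module.finrank ℂ (eigenspace q a (eigenvalue q a (2 * m + 1))) = 1 ∧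
        Module.finrank ℂ (eigenspace q a (eigenvalue q a (2 * m + 2))) = 1) ∧
      |eigenvalue q a (2 * m + 1) -
        ((2 * (m : ℝ) + 2) ^ 2 * Real.pi ^ 2 / a ^ 2 - ‖coeff q a (2 * m + 2)‖)| ≤
          C * (rho q a m / m) ∧
      |eigenvalue q a (2 * m + 2) -
        ((2 * (m : ℝ) + 2) ^ 2 * Real.pi ^ 2 / a ^ 2 + ‖coeff q a (2 * m + 2)‖)| ≤
          C * (rho q a m / m) := by
  have hw : 0 < 2 * Real.pi / a := by have := Real.pi_pos; positivity
  have hc0 := tendsto_coeff ha hq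
  obtain ⟨C, hC, hsplit⟩ := exists_splitting ha hq hper h0 hgap
  refine ⟨2 * C, ?_⟩
  filter_upwards [eventually_card_le hc0 coeff_neg hw,
    (tendsto_add_atTop_nat 1).eventually (eventually_exists_low hc0 coeff_neg hw),
    (tendsto_add_atTop_nat 1).eventually hsplit, eventually_gt_atTop 0] with m h1 h2 h3 hm
  obtain ⟨-, hγ, hge, hsign, hdep⟩ := h3
  have hm' : (0 : ℝ) < m := by exact_mod_cast hm
  have eidx : (2 * ((m + 1 : ℕ) : ℤ)) = 2 * (m : ℤ) + 2 := by push_cast; ring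
  have el : ((m + 1 : ℕ) : ℝ) - 1 / 2 = m + 1 / 2 := by push_cast; ring
  have eκ : (2 * Real.pi / a * ((m + 1 : ℕ) : ℝ)) ^ 2 =
      (2 * (m : ℝ) + 2) ^ 2 * Real.pi ^ 2 / a ^ 2 := by push_cast; ring
  rw [← rho_eq_supOsc, eidx] at hge
  rw [eidx] at hγ
  simp only [← rho_eq_supOsc, el, eκ] at hsign hdep
  simp only [eidx] at hsign hdep
  have hγ' : 0 < ‖coeff q a (2 * m + 2)‖ := norm_pos_iff.mpr hγ
  obtain ⟨ν₁, ν₂, ⟨l1, u1, b1, y₁, hy₁, hne₁⟩, ⟨l2, u2, b2, y₂, hy₂, hne₂⟩, hl1, hl2⟩ :=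
    exists_isLeast_pair h1 h2 (by linarith) hsign hdep
  rw [eigenvalue_eq_of_isLeast ha hq hper hl1, eigenvalue_eq_of_isLeast ha hq hper hl2]
  have hρ : 0 ≤ rho q a m := by rw [rho_eq_supOsc]; exact supOsc_nonneg _
  have hle : 2 * (C * (rho q a m / ((m + 1 : ℕ) : ℝ))) ≤ 2 * C * (rho q a m / m) := by
    rw [← mul_assoc]
    have : (m : ℝ) ≤ ((m + 1 : ℕ) : ℝ) := by push_cast; linarith
    gcongr
  refine ⟨⟨finrank_eigenspace_eq_one ha hq hper hy₁ hne₁ fun z hz hz0 => ?_,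
    finrank_eigenspace_eq_one ha hq hper hy₂ hne₂ fun z hz hz0 => ?_⟩, ?_, ?_⟩
  · exact (hdep (-1) (Or.inr rfl) _ _ _ _ hy₁ hne₁ l1 u1 hz hz0 l1 u1 b1 b1).2
  · exact (hdep 1 (Or.inl rfl) _ _ _ _ hy₂ hne₂ l2 u2 hz hz0 l2 u2 b2 b2).2
  · refine le_trans (le_of_eq ?_) (b1.trans hle)
    congr 1; ring
  · refine le_trans (le_of_eq ?_) (b2.trans hle)
    congr 1; ring

end Main

end Hill

theorem theorem1 (a : ℝ) (ha : 0 < a) (q : ℝ → ℝ)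
    (hq : LocallyIntegrable q volume) (hper : Function.Periodic q a)
    (hmean : Hill.coeff q a 0 = 0)
    (hcond :
      ((∀ᶠ m : ℕ in atTop, Hill.coeff q a (2 * m + 2) ≠ 0) ∧
        Tendsto (fun m : ℕ => (Hill.rho q a m : ℂ) / ((m : ℂ) * Hill.coeff q a (2 * m + 2)))
          atTop (𝓝 0)) ∨
      (∃ C₁ C₂ : ℝ, 0 < C₁ ∧ C₁ < C₂ ∧ ∀ᶠ m : ℕ in atTop,
        C₁ < ‖Hill.coeff q a (2 * m + 2) / (Hill.rho q a m : ℂ)‖ ∧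
        ‖Hill.coeff q a (2 * m + 2) / (Hill.rho q a m : ℂ)‖ < C₂) ∨
      (∃ ε : ℝ, 0 < ε ∧ ∀ᶠ m : ℕ in atTop, ε / (m : ℝ) < ‖Hill.coeff q a (2 * m + 2)‖)) :
    (∀ᶠ m : ℕ in atTop,
      Module.finrank ℂ (Hill.eigenspace q a (Hill.eigenvalue q a (2 * m + 1))) = 1 ∧
      Module.finrank ℂ (Hill.eigenspace q a (Hill.eigenvalue q a (2 * m + 2))) = 1) ∧
    (fun m : ℕ => Hill.eigenvalue q a (2 * m + 1) -
        ((2 * (m : ℝ) + 2) ^ 2 * Real.pi ^ 2 / a ^ 2 - ‖Hill.coeff q a (2 * m + 2)‖))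
      =O[atTop] (fun m : ℕ => Hill.rho q a m / (m : ℝ)) ∧
    (fun m : ℕ => Hill.eigenvalue q a (2 * m + 2) -
        ((2 * (m : ℝ) + 2) ^ 2 * Real.pi ^ 2 / a ^ 2 + ‖Hill.coeff q a (2 * m + 2)‖))
      =O[atTop] (fun m : ℕ => Hill.rho q a m / (m : ℝ)) := by
  obtain ⟨C, hC⟩ := Hill.exists_eventually_eigenvalue_pair ha hq hper hmean
    fun η hη => Hill.eventually_supOsc_le_of_cond ha hq hcond hη
  refine ⟨hC.mono fun m hm => hm.1, IsBigO.of_bound |C| ?_, IsBigO.of_bound |C| ?_⟩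
  · filter_upwards [hC] with m hm
    rw [Real.norm_eq_abs]
    refine hm.2.1.trans ((le_abs_self _).trans (le_of_eq ?_))
    rw [abs_mul, Real.norm_eq_abs]
  · filter_upwards [hC] with m hm
    rw [Real.norm_eq_abs]
    refine hm.2.2.trans ((le_abs_self _).trans (le_of_eq ?_))
    rw [abs_mul, Real.norm_eq_abs]
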